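/- Let $M$ be a complete $3$-dimensional hyperbolic cone-manifold whose singular locus $\Sigma$ is a link with finitely many components $\Sigma_c$, where $\Sigma_c$ is a closed geodesic of length $\ell_c>0$ with cone angle $\alpha_c>0$: that is, $M$ is a complete length space, every point of $M\setminus\Sigma$ has a ball isometric to a ball in $\mathbb H^3$, and for small $r$ the $r$-neighbourhood of $\Sigma_c$ is a model tube. The model tube of radius $r$ is the $r$-neighbourhood of the axis in the infinite cyclic branched cover of $\mathbb H^3$ along a geodesic, with cylindrical coordinates $(r,\theta,\zeta)$, $\theta\in\mathbb R$, and metric $dr^2+\sinh^2 r\,d\theta^2+\cosh^2 r\,d\zeta^2$, divided by the group $\Gamma_c\cong\mathbb Z^2$ generated by the translations $(\alpha_c,0)$ and $(\tau_c,\ell_c)$ of the $(\theta,\zeta)$-plane. A tube of radius $r$ about $\Sigma_c$ is embedded if the $r$-neighbourhood of $\Sigma_c$ is the bijective, locally isometric image of the model tube of radius $r$. Let $R>0$ be the radius of the maximal embedded tube about $\Sigma$: the greatest number such that the open tubes of radius $R$ about all the components of $\Sigma$ are embedded and pairwise disjoint. For each component $\Sigma_c$ let $T_R$ be the flat torus at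 distance $R$ from $\Sigma_c$, i.e. the surface $\{r=R\}$ with metric $\sinh^2 R\,d\theta^2+\cosh^2 R\,d\zeta^2$, modulo $\Gamma_c$. Put $h(R)=3.3957\,\dfrac{\tanh R}{\cosh(2R)}$. 1. If $\Sigma$ is connected, with cone angle $\alpha$ and length $\ell$, then $$\operatorname{area}(T_R)\ \ge\ 3.3957\,\frac{\sinh^2 R}{\cosh(2R)}\qquad\text{and}\qquad \alpha\,\ell\ \ge\ h(R).$$ 2. In general (in particular if $\Sigma$ has several components), the bounds are half as large: for each component $\Sigma_c$ whose tube is maximal, in the sense that the tube about $\Sigma_c$ cannot be enlarged, keeping the tubes of radius $R$ about the other components, so that all tubes remain embedded and disjoint, $$\operatorname{area}(T_R)\ \ge\ \frac{3.3957}{2}\,\frac{\sinh^2 R}{\cosh(2R)}\qquad\text{and}\qquad \alpha_c\,\ell_c\ \ge\ \tfrac12\,h(R).$$ There is always at least one such component. -/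

import Mathlib

/-- The Lorentz form of signature `(3, 1)` on `ℝ⁴`. -/
def lorentzForm (x y : Fin 4 → ℝ) : ℝ :=
  -(x 0 * y 0) + x 1 * y 1 + x 2 * y 2 + x 3 * y 3

/-- Hyperbolic 3-space: the upper sheet of the hyperboloid `⟨x, x⟩ = -1`. -/
def HypSpace : Type := {x : Fin 4 → ℝ // lorentzForm x x = -1 ∧ 0 < x 0}

/-- The hyperbolic distance, `cosh d(x, y) = -⟨x, y⟩`. -/
noncomputable def hypDist (x y : HypSpace) : ℝ := Real.arcosh (-lorentzForm x.1 y.1)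

/-- The point of hyperbolic space with cylindrical coordinates `(r, θ, ζ)` about a geodesic `g`:
`r` is the distance from `g`, `θ` the angle around `g`, and `ζ` the position along `g`.
The metric in these coordinates is `dr² + sinh² r dθ² + cosh² r dζ²`. -/
noncomputable def cylPoint (r θ ζ : ℝ) : HypSpace :=
  ⟨![Real.cosh r * Real.cosh ζ, Real.cosh r * Real.sinh ζ,
      Real.sinh r * Real.cos θ, Real.sinh r * Real.sin θ], by
    constructor
    · simp only [lorentzForm, Matrix.cons_val]
      linear_combination (-(Real.cosh r ^ 2)) * Real.cosh_sq_sub_sinh_sq ζ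
        + (Real.sinh r ^ 2) * Real.sin_sq_add_cos_sq θ - Real.cosh_sq_sub_sinh_sq r
    · simp only [Matrix.cons_val]
      exact mul_pos (Real.cosh_pos r) (Real.cosh_pos ζ)⟩

/-- Points, in cylindrical coordinates, of the infinite cyclic cover of hyperbolic space branched
over the geodesic `g`: the angle `θ` is a real number, not taken modulo `2π`. Points with `r = 0`
and the same `ζ` are the same point of the axis; they are at distance `0` from each other for
`branchedDist` below. -/
structure BranchedPoint where
  /-- distance from the axis -/
  r : ℝ
  /-- angle around the axis -/
  θ : ℝ
  /-- position along the axis -/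
  ζ : ℝ
  r_nonneg : 0 ≤ r

/-- The distance in the infinite cyclic branched cover. Two points whose angles differ by at most
`π` are joined by a lift of a hyperbolic geodesic; if the angles differ by more than `π`, a shortest
path runs through the axis, so its length is the same as for angle difference `π`. -/
noncomputable def branchedDist (p q : BranchedPoint) : ℝ :=
  hypDist (cylPoint p.r 0 p.ζ) (cylPoint q.r (min |p.θ - q.θ| Real.pi) q.ζ)

/-- The isometry of the branched cover that rotates by `g.1` about the axis and translates by `g.2`
along it. -/
def BranchedPoint.translate (p : BranchedPoint) (g : ℝ × ℝ) : BranchedPoint :=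
  ⟨p.r, p.θ + g.1, p.ζ + g.2, p.r_nonneg⟩

/-- The group of isometries (identified with a lattice of translations of the `(θ, ζ)`-plane)
generated by the rotation by the angle `α` (the meridian) and by the screw motion with translation
length `ℓ` and rotation angle `τ` (the longitude). -/
def tubeGroup (α ℓ τ : ℝ) : Submodule ℤ (ℝ × ℝ) :=
  Submodule.span ℤ {(α, 0), (τ, ℓ)}

/-- The distance in the quotient of the branched cover by the group `tubeGroup α ℓ τ`, that is, in
the model tube of cone angle `α` about a closed singular geodesic of complex length `ℓ + iτ`. -/
noncomputable def tubeDist (α ℓ τ : ℝ) (p q : BranchedPoint) : ℝ :=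
  ⨅ g : tubeGroup α ℓ τ, branchedDist p (q.translate g)

/-- The set `S` has an embedded (open) tube of radius `ρ` with cone angle `α`, core length `ℓ` and
twist `τ`: there is a map `φ` which induces a locally isometric bijection of the model tube of
radius `ρ`, i.e. of the quotient of `{r < ρ}` by `tubeGroup α ℓ τ`, onto the `ρ`-neighbourhood of
`S`, carrying the core onto `S`. Locally isometric means that small balls are mapped isometrically
onto balls. -/
def HasEmbeddedTube {M : Type*} [MetricSpace M] (S : Set M) (α ℓ τ ρ : ℝ) : Prop :=
  ∃ φ : BranchedPoint → M,
    φ '' {p | p.r = 0} = S ∧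
    φ '' {p | p.r < ρ} = Metric.thickening ρ S ∧
    (∀ p q : BranchedPoint, p.r < ρ → q.r < ρ → φ p = φ q → tubeDist α ℓ τ p q = 0) ∧
    ∀ p : BranchedPoint, p.r < ρ → ∃ δ > 0,
      φ '' {q | q.r < ρ ∧ tubeDist α ℓ τ p q < δ} = Metric.ball (φ p) δ ∧
      ∀ q q' : BranchedPoint, q.r < ρ → q'.r < ρ →
        tubeDist α ℓ τ p q < δ → tubeDist α ℓ τ p q' < δ →
          dist (φ q) (φ q') = tubeDist α ℓ τ q q'

/-- The structure, on a metric space `M`, of a 3-dimensional hyperbolic cone-manifold whose singular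
locus is a link, with components indexed by `ι`. The distance of `M` is the infimum of the lengths
of paths; away from the singular locus `M` is locally isometric to hyperbolic 3-space; and each
component of the singular locus has a neighbourhood which is a tube of some cone angle `α > 0` about
a closed geodesic of some length `ℓ > 0`. -/
structure HyperbolicConeManifold (M : Type*) [MetricSpace M] (ι : Type*) where
  /-- the components of the singular locus -/
  component : ι → Set M
  /-- the cone angle along each component -/
  coneAngle : ι → ℝ
  /-- the length of each component -/
  length : ι → ℝ
  /-- the rotational part of the holonomy of a longitude of each component -/
  twist : ι → ℝ
  coneAngle_pos : ∀ i, 0 < coneAngle i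
  length_pos : ∀ i, 0 < length i
  disjoint_components : Pairwise fun i j => Disjoint (component i) (component j)
  length_metric : ∀ x y : M, ∀ L > dist x y, ∃ γ : ℝ → M,
    ContinuousOn γ (Set.Icc 0 1) ∧ γ 0 = x ∧ γ 1 = y ∧
      eVariationOn γ (Set.Icc 0 1) ≤ ENNReal.ofReal L
  locally_hyperbolic : ∀ x ∉ ⋃ i, component i, ∃ ε > 0, ∃ f : M → HypSpace,
    f '' Metric.ball x ε = {p | hypDist (f x) p < ε} ∧
      ∀ y ∈ Metric.ball x ε, ∀ z ∈ Metric.ball x ε, hypDist (f y) (f z) = dist y z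
  exists_tube : ∀ i, ∃ ε > 0,
    HasEmbeddedTube (component i) (coneAngle i) (length i) (twist i) ε

namespace HyperbolicConeManifold

/-- The singular locus `Σ`. -/
def singularLocus {M : Type*} [MetricSpace M] {ι : Type*} (C : HyperbolicConeManifold M ι) :
    Set M := ⋃ i, C.component i

/-- The tubes of radius `ρ i` about the components of the singular locus are embedded and pairwise
disjoint. -/
def EmbeddedTubes {M : Type*} [MetricSpace M] {ι : Type*} (C : HyperbolicConeManifold M ι)
    (ρ : ι → ℝ) : Prop :=
  (∀ i, 0 < ρ i ∧
    HasEmbeddedTube (C.component i) (C.coneAngle i) (C.length i) (C.twist i) (ρ i)) ∧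
  Pairwise fun i j =>
    Disjoint (Metric.thickening (ρ i) (C.component i)) (Metric.thickening (ρ j) (C.component j))

/-- `R` is the radius of the maximal embedded tube about the singular locus, the tubes about all
the components having the same radius. -/
def IsMaximalTubeRadius {M : Type*} [MetricSpace M] {ι : Type*} (C : HyperbolicConeManifold M ι)
    (R : ℝ) : Prop :=
  IsGreatest {r : ℝ | 0 < r ∧ C.EmbeddedTubes fun _ => r} R

/-- In the system of tubes of radius `R` about all the components, the tube about the component `c`
cannot be enlarged, the other tubes being kept: it is tangent to itself or to another tube. -/
def TubeIsMaximalAt {M : Type*} [MetricSpace M] {ι : Type*} (C : HyperbolicConeManifold M ι)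
    (R : ℝ) (c : ι) : Prop :=
  ∀ ρ : ι → ℝ, (∀ i, i ≠ c → ρ i = R) → C.EmbeddedTubes ρ → ρ c ≤ R

end HyperbolicConeManifold

/-- The Euclidean coordinates `(θ sinh R, ζ cosh R)` on the surface at distance `R` from the axis,
whose induced metric is `sinh² R dθ² + cosh² R dζ²`. -/
noncomputable def cylinderCoords (R : ℝ) : (ℝ × ℝ) →ₗ[ℤ] EuclideanSpace ℝ (Fin 2) where
  toFun g := !₂[g.1 * Real.sinh R, g.2 * Real.cosh R]
  map_add' g h := by
    ext i
    fin_cases i <;> simp [add_mul]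
  map_smul' n g := by
    ext i
    fin_cases i <;> simp [mul_assoc]

namespace HyperbolicConeManifold

/-- The area of the flat torus `T_R` at distance `R` from the component `c` of the singular locus:
the quotient of the Euclidean plane `{r = R}` by the group of the tube. The area of the quotient is
the covolume of the lattice. -/
noncomputable def torusArea {M : Type*} [MetricSpace M] {ι : Type*}
    (C : HyperbolicConeManifold M ι) (c : ι) (R : ℝ) : ℝ :=
  ZLattice.covolume
    ((tubeGroup (C.coneAngle c) (C.length c) (C.twist c)).map (cylinderCoords R))

end HyperbolicConeManifold

/-- The function `h(r) = 3.3957 tanh r / cosh 2r`. -/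
noncomputable def tubeFunction (r : ℝ) : ℝ := 3.3957 * (Real.tanh r / Real.cosh (2 * r))

/-! Fix a component whose tube is maximal and let `Φ r u` be its normal exponential map, with `u =
(θ, ζ)`. For `r < R` it parametrizes the tube. For `R ≤ r < 2R` it stays at distance at least `2R -
r` from the singular locus, because the tubes of radius `R` are embedded and disjoint; so
completeness allows `Φ` to be continued as a local isometry for all `0 < r < 2R`
(`exists_continuesTo`, `IsTubeMap.exists_development`). Beyond `R` it need not be injective modulo
the tube group.

A maximal tube touches itself or another tube (`Developments.exists_contact`), since otherwise
compactness of the boundary tori would leave room to enlarge it. At a contact the two tubes are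
tangent, and the ray leaving one tube runs straight down a ray of the other to its core
(`IsDevelopment.eq_of_tangency`), hence meets the singular locus at distance `2R`. So do all
translates of this direction by the tube group. If the singular locus is connected, the tube touches
itself and the contact yields two inequivalent directions, that is, two orbits.

The geometric heart is that distinct directions of this kind, with angles differing by less than
`1`, end at points of the surface `r = 2R` at distance at least `2R` (`IsDevelopment.le_dist_of_lt`,
`IsDevelopment.two_mul_le_dist`). Otherwise take a short chord between the two rays at a radius `s`
slightly below `2R`. Along its image the distance to the singular locus stays below `R`, hence has
no interior maximum and is at most `2R - s`. It is also at least `2R - ρ` at radius `ρ`, so the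
chord would never get closer to the axis than `s`; but its midpoint does.

Consequently the differences of these directions lie outside an ellipse with semi-axes `1 / cosh R`
and `2√2 log 2 sinh R / cosh 2R` (`one_le_ellipse`). After rescaling the ellipse to the unit disc, a
planar lattice with minimal length at least `1` has covolume at least `√3 / 2`, and at least `√3` if
a second orbit keeps distance `1` from it. Scaling back gives the bounds for `αℓ`, because `2√2 log
2 √3 > 3.3957`; the area is `αℓ sinh R cosh R`. -/

open Set Metric Filter Topology

/-! ### The hyperboloid model and its metric -/

section LorentzForm

theorem lorentzForm_comm (x y : Fin 4 → ℝ) : lorentzForm x y = lorentzForm y x := by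
  simp only [lorentzForm]; ring

theorem lorentzForm_add_left (x y z : Fin 4 → ℝ) :
    lorentzForm (x + y) z = lorentzForm x z + lorentzForm y z := by
  simp only [lorentzForm, Pi.add_apply]; ring

theorem lorentzForm_sub_left (x y z : Fin 4 → ℝ) :
    lorentzForm (x - y) z = lorentzForm x z - lorentzForm y z := by
  simp only [lorentzForm, Pi.sub_apply]; ring

theorem lorentzForm_smul_left (a : ℝ) (x y : Fin 4 → ℝ) :
    lorentzForm (a • x) y = a * lorentzForm x y := by
  simp only [lorentzForm, Pi.smul_apply, smul_eq_mul]; ring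

theorem lorentzForm_add_right (x y z : Fin 4 → ℝ) :
    lorentzForm x (y + z) = lorentzForm x y + lorentzForm x z := by
  simp only [lorentzForm, Pi.add_apply]; ring

theorem lorentzForm_sub_right (x y z : Fin 4 → ℝ) :
    lorentzForm x (y - z) = lorentzForm x y - lorentzForm x z := by
  simp only [lorentzForm, Pi.sub_apply]; ring

theorem lorentzForm_smul_right (a : ℝ) (x y : Fin 4 → ℝ) :
    lorentzForm x (a • y) = a * lorentzForm x y := by
  simp only [lorentzForm, Pi.smul_apply, smul_eq_mul]; ring

theorem cauchy_schwarz_three (a b c x y z : ℝ) :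
    (a * x + b * y + c * z) ^ 2 ≤ (a ^ 2 + b ^ 2 + c ^ 2) * (x ^ 2 + y ^ 2 + z ^ 2) := by
  nlinarith [sq_nonneg (a * y - b * x), sq_nonneg (a * z - c * x), sq_nonneg (b * z - c * y)]

theorem HypSpace.time_sq (y : HypSpace) :
    y.1 0 ^ 2 = 1 + (y.1 1 ^ 2 + y.1 2 ^ 2 + y.1 3 ^ 2) := by
  have := y.2.1; simp only [lorentzForm] at this; linarith

/-- Cauchy–Schwarz for the spatial parts, with the spatial norm of `y` eliminated. Positive
definiteness of the form on the complement of a timelike vector is read off from it. -/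
theorem lorentzForm_orthogonal_aux {v : Fin 4 → ℝ} {y : HypSpace} (h : lorentzForm v y.1 = 0) :
    v 0 ^ 2 * y.1 0 ^ 2 ≤ (v 1 ^ 2 + v 2 ^ 2 + v 3 ^ 2) * (y.1 0 ^ 2 - 1) := by
  have h1 : v 0 * y.1 0 = v 1 * y.1 1 + v 2 * y.1 2 + v 3 * y.1 3 := by
    simp only [lorentzForm] at h; linarith
  have h2 := cauchy_schwarz_three (v 1) (v 2) (v 3) (y.1 1) (y.1 2) (y.1 3)
  rw [← h1, mul_pow] at h2
  have := y.time_sq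
  rw [this] at h2 ⊢
  linarith

theorem lorentzForm_self_nonneg_of_orthogonal {v : Fin 4 → ℝ} {y : HypSpace}
    (h : lorentzForm v y.1 = 0) : 0 ≤ lorentzForm v v := by
  have h1 := lorentzForm_orthogonal_aux h
  have h2 : 0 < y.1 0 ^ 2 := pow_pos y.2.2 2
  have h3 : v 0 ^ 2 ≤ v 1 ^ 2 + v 2 ^ 2 + v 3 ^ 2 := by
    by_contra! hc
    nlinarith [sq_nonneg (v 1), sq_nonneg (v 2), sq_nonneg (v 3)]
  simp only [lorentzForm]; linarith

theorem eq_zero_of_orthogonal_of_lorentzForm_self_eq_zero {v : Fin 4 → ℝ} {y : HypSpace}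
    (h : lorentzForm v y.1 = 0) (h0 : lorentzForm v v = 0) : v = 0 := by
  have h1 := lorentzForm_orthogonal_aux h
  have h3 : v 0 ^ 2 = v 1 ^ 2 + v 2 ^ 2 + v 3 ^ 2 := by
    simp only [lorentzForm] at h0; linarith
  have h4 : v 1 ^ 2 + v 2 ^ 2 + v 3 ^ 2 ≤ 0 := by rw [h3] at h1; linarith
  have a1 := sq_nonneg (v 1)
  have a2 := sq_nonneg (v 2)
  have a3 := sq_nonneg (v 3)
  ext i
  fin_cases i <;> apply pow_eq_zero_iff (two_ne_zero) |>.1 <;> simp only <;> dsimp <;> linarith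

theorem lorentzForm_sq_le_of_orthogonal {v w : Fin 4 → ℝ} {y : HypSpace}
    (hv : lorentzForm v y.1 = 0) (hw : lorentzForm w y.1 = 0) :
    lorentzForm v w ^ 2 ≤ lorentzForm v v * lorentzForm w w := by
  rcases (lorentzForm_self_nonneg_of_orthogonal hw).eq_or_lt with h0 | hpos
  · have := eq_zero_of_orthogonal_of_lorentzForm_self_eq_zero hw h0.symm
    subst this
    simp [lorentzForm]
  · have h : lorentzForm (lorentzForm w w • v - lorentzForm v w • w) y.1 = 0 := by
      simp [lorentzForm_sub_left, lorentzForm_smul_left, hv, hw]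
    have h2 := lorentzForm_self_nonneg_of_orthogonal h
    simp only [lorentzForm_sub_left, lorentzForm_smul_left, lorentzForm_sub_right,
      lorentzForm_smul_right] at h2
    rw [lorentzForm_comm w v] at h2
    have h3 : 0 ≤ lorentzForm w w * (lorentzForm v v * lorentzForm w w - lorentzForm v w ^ 2) := by
      linarith
    nlinarith [(mul_nonneg_iff_of_pos_left hpos).1 h3]

theorem HypSpace.neg_lorentzForm_pos (x y : HypSpace) : 0 < -lorentzForm x.1 y.1 := by
  have h := cauchy_schwarz_three (x.1 1) (x.1 2) (x.1 3) (y.1 1) (y.1 2) (y.1 3)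
  have h1 : (x.1 1 * y.1 1 + x.1 2 * y.1 2 + x.1 3 * y.1 3) ^ 2 < (x.1 0 * y.1 0) ^ 2 := by
    rw [mul_pow, x.time_sq, y.time_sq]
    nlinarith [sq_nonneg (x.1 1), sq_nonneg (x.1 2), sq_nonneg (x.1 3),
      sq_nonneg (y.1 1), sq_nonneg (y.1 2), sq_nonneg (y.1 3)]
  have h2 := lt_of_abs_lt (abs_lt_of_sq_lt_sq h1 (mul_pos x.2.2 y.2.2).le)
  simp only [lorentzForm]; linarith

theorem HypSpace.lorentzForm_component (x y : HypSpace) :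
    lorentzForm (x.1 + lorentzForm x.1 y.1 • y.1) y.1 = 0 := by
  simp [lorentzForm_add_left, lorentzForm_smul_left, y.2.1]

theorem HypSpace.lorentzForm_component_self (x y : HypSpace) :
    lorentzForm (x.1 + lorentzForm x.1 y.1 • y.1) (x.1 + lorentzForm x.1 y.1 • y.1) =
      lorentzForm x.1 y.1 ^ 2 - 1 := by
  simp only [lorentzForm_add_left, lorentzForm_smul_left, lorentzForm_add_right,
    lorentzForm_smul_right, y.2.1, x.2.1, lorentzForm_comm y.1 x.1]
  ring

theorem HypSpace.one_le_neg_lorentzForm (x y : HypSpace) : 1 ≤ -lorentzForm x.1 y.1 := by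
  have h := lorentzForm_self_nonneg_of_orthogonal (HypSpace.lorentzForm_component x y)
  rw [HypSpace.lorentzForm_component_self] at h
  have := HypSpace.neg_lorentzForm_pos x y
  nlinarith

theorem HypSpace.cosh_hypDist (x y : HypSpace) : Real.cosh (hypDist x y) = -lorentzForm x.1 y.1 :=
  Real.cosh_arcosh (HypSpace.one_le_neg_lorentzForm x y)

theorem HypSpace.hypDist_nonneg (x y : HypSpace) : 0 ≤ hypDist x y :=
  Real.arcosh_nonneg (HypSpace.one_le_neg_lorentzForm x y)

/-- By the law of cosines at `y`: the components of `x` and `z` orthogonal to `y` have norms `sinh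
d(x, y)` and `sinh d(y, z)`, and Cauchy–Schwarz bounds their product from below, so that `cosh d(x,
z)` is at most the expansion of `cosh` of the sum. -/
theorem HypSpace.hypDist_triangle (x y z : HypSpace) :
    hypDist x z ≤ hypDist x y + hypDist y z := by
  have h0 := add_nonneg (hypDist_nonneg x y) (hypDist_nonneg y z)
  rw [← abs_of_nonneg (hypDist_nonneg x z), ← abs_of_nonneg h0, ← Real.cosh_le_cosh,
    Real.cosh_add, cosh_hypDist, cosh_hypDist, cosh_hypDist]
  have h1 := lorentzForm_sq_le_of_orthogonal (lorentzForm_component x y)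
    (lorentzForm_component z y)
  rw [lorentzForm_component_self, lorentzForm_component_self] at h1
  have s1 : Real.sinh (hypDist x y) ^ 2 = lorentzForm x.1 y.1 ^ 2 - 1 := by
    rw [Real.sinh_sq, cosh_hypDist]; ring
  have s2 : Real.sinh (hypDist y z) ^ 2 = lorentzForm z.1 y.1 ^ 2 - 1 := by
    rw [Real.sinh_sq, cosh_hypDist, lorentzForm_comm z.1]; ring
  rw [← s1, ← s2, ← mul_pow] at h1
  have h2 := abs_le_of_sq_le_sq h1 (mul_nonneg (Real.sinh_nonneg_iff.2 (hypDist_nonneg x y))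
    (Real.sinh_nonneg_iff.2 (hypDist_nonneg y z)))
  have h3 := (abs_le.1 h2).1
  simp only [lorentzForm_add_left, lorentzForm_smul_left, lorentzForm_add_right,
    lorentzForm_smul_right, y.2.1] at h3
  rw [lorentzForm_comm z.1 y.1] at h3
  linarith

/-- Hyperbolic space as a metric space. -/
noncomputable instance : MetricSpace HypSpace where
  dist := hypDist
  dist_self x := by simp [hypDist, x.2.1]
  dist_comm x y := by simp [hypDist, lorentzForm_comm]
  dist_triangle := HypSpace.hypDist_triangle
  eq_of_dist_eq_zero {x y} h := by
    have h1 : lorentzForm x.1 y.1 = -1 := by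
      have := HypSpace.cosh_hypDist x y
      rw [show hypDist x y = 0 from h, Real.cosh_zero] at this
      linarith
    have h2 := HypSpace.lorentzForm_component_self x y
    have h3 := eq_zero_of_orthogonal_of_lorentzForm_self_eq_zero
      (HypSpace.lorentzForm_component x y) (by rw [h2, h1]; norm_num)
    rw [h1] at h3
    apply Subtype.ext
    simpa [← sub_eq_add_neg, sub_eq_zero] using h3

theorem HypSpace.cosh_dist (x y : HypSpace) : Real.cosh (dist x y) = -lorentzForm x.1 y.1 :=
  HypSpace.cosh_hypDist x y

theorem HypSpace.lorentzForm_eq (x y : HypSpace) : lorentzForm x.1 y.1 = -Real.cosh (dist x y) := by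
  rw [HypSpace.cosh_dist, neg_neg]

/-- The point of hyperbolic space on the ray through a timelike vector. -/
noncomputable def HypSpace.normalize (v : Fin 4 → ℝ) (h : lorentzForm v v < 0) (h0 : 0 < v 0) :
    HypSpace :=
  ⟨(√(-lorentzForm v v))⁻¹ • v, by
    have : 0 < √(-lorentzForm v v) := Real.sqrt_pos.2 (by linarith)
    constructor
    · rw [lorentzForm_smul_left, lorentzForm_smul_right]
      have h2 := Real.sq_sqrt (show 0 ≤ -lorentzForm v v by linarith)
      field_simp
      linarith
    · simp only [Pi.smul_apply, smul_eq_mul]; positivity⟩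

theorem HypSpace.exists_midpoint (x y : HypSpace) :
    ∃ m : HypSpace, dist x m = dist x y / 2 ∧ dist m y = dist x y / 2 ∧
      m.1 = (√(2 + 2 * Real.cosh (dist x y)))⁻¹ • (x.1 + y.1) := by
  have hc := HypSpace.one_le_neg_lorentzForm x y
  have hs : -lorentzForm (x.1 + y.1) (x.1 + y.1) = 2 + 2 * Real.cosh (dist x y) := by
    simp only [lorentzForm_add_left, lorentzForm_add_right, x.2.1, y.2.1, lorentzForm_comm y.1 x.1,
      HypSpace.lorentzForm_eq]
    ring
  have hpos := Real.cosh_pos (dist x y)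
  have h1 : lorentzForm (x.1 + y.1) (x.1 + y.1) < 0 := by linarith
  let m := HypSpace.normalize (x.1 + y.1) h1 (add_pos x.2.2 y.2.2)
  have hm : m.1 = (√(2 + 2 * Real.cosh (dist x y)))⁻¹ • (x.1 + y.1) := by
    simp only [m, HypSpace.normalize, hs]
  have hd : Real.cosh (dist x y) = 2 * Real.cosh (dist x y / 2) ^ 2 - 1 := by
    have := Real.cosh_two_mul (dist x y / 2)
    rw [mul_div_cancel₀ _ (two_ne_zero)] at this
    rw [this, Real.sinh_sq]; ring
  have hsq : √(2 + 2 * Real.cosh (dist x y)) = 2 * Real.cosh (dist x y / 2) := by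
    rw [Real.sqrt_eq_iff_mul_self_eq (by linarith) (by positivity), hd]; ring
  have hp2 := Real.cosh_pos (dist x y / 2)
  have key : ∀ z : HypSpace, lorentzForm z.1 (x.1 + y.1) = -(2 * Real.cosh (dist x y / 2) ^ 2) →
      dist z m = dist x y / 2 := by
    intro z hz
    have h2 : Real.cosh (dist z m) = Real.cosh (dist x y / 2) := by
      rw [HypSpace.cosh_dist, hm, lorentzForm_smul_right, hz, hsq]
      field_simp
    exact Real.cosh_injOn (Set.mem_Ici.2 dist_nonneg)
      (Set.mem_Ici.2 (div_nonneg dist_nonneg two_pos.le)) h2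
  refine ⟨m, key x ?_, ?_, hm⟩
  · rw [lorentzForm_add_right, x.2.1, HypSpace.lorentzForm_eq, hd]; ring
  · rw [dist_comm]
    refine key y ?_
    rw [lorentzForm_add_right, y.2.1, lorentzForm_comm, HypSpace.lorentzForm_eq, hd]; ring

/-- The difference of the two sides is orthogonal to `z` and null, hence zero. This linear form of
"`z` is the midpoint" gives both the uniqueness of geodesic continuation and the convexity of the
distance from the axis. -/
theorem HypSpace.add_eq_of_dist_eq {a b z : HypSpace} {h : ℝ} (ha : dist a z = h)
    (hb : dist b z = h) (hab : dist a b = 2 * h) : a.1 + b.1 = (2 * Real.cosh h) • z.1 := by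
  have e : Real.cosh (2 * h) = 2 * Real.cosh h ^ 2 - 1 := by
    rw [Real.cosh_two_mul, Real.sinh_sq]; ring
  have h1 : lorentzForm (a.1 + b.1 - (2 * Real.cosh h) • z.1) z.1 = 0 := by
    simp only [lorentzForm_sub_left, lorentzForm_add_left, lorentzForm_smul_left, z.2.1,
      HypSpace.lorentzForm_eq, ha, hb]
    ring
  have h2 : lorentzForm (a.1 + b.1 - (2 * Real.cosh h) • z.1)
      (a.1 + b.1 - (2 * Real.cosh h) • z.1) = 0 := by
    simp only [lorentzForm_sub_left, lorentzForm_add_left, lorentzForm_smul_left,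
      lorentzForm_sub_right, lorentzForm_add_right, lorentzForm_smul_right, z.2.1, a.2.1, b.2.1]
    rw [lorentzForm_comm b.1 a.1, lorentzForm_comm z.1 a.1, lorentzForm_comm z.1 b.1]
    simp only [HypSpace.lorentzForm_eq, ha, hb, hab, e]
    ring
  exact sub_eq_zero.1 (eq_zero_of_orthogonal_of_lorentzForm_self_eq_zero h1 h2)

theorem HypSpace.eq_of_dist_eq {a b b' z : HypSpace} {h : ℝ} (ha : dist a z = h)
    (hb : dist b z = h) (hb' : dist b' z = h) (hab : dist a b = 2 * h)
    (hab' : dist a b' = 2 * h) : b = b' :=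
  Subtype.ext (add_left_cancel ((HypSpace.add_eq_of_dist_eq ha hb hab).trans
    (HypSpace.add_eq_of_dist_eq ha hb' hab').symm))

end LorentzForm

/-! ### Rigidity: local isometries of hyperbolic space extend uniquely -/

section Rigidity

/-- The Lorentz form as a bilinear form. -/
noncomputable def lorentzBilin : LinearMap.BilinForm ℝ (Fin 4 → ℝ) :=
  LinearMap.mk₂ ℝ lorentzForm lorentzForm_add_left
    (fun a x y => by rw [lorentzForm_smul_left, smul_eq_mul]) lorentzForm_add_right
    (fun a x y => by rw [lorentzForm_smul_right, smul_eq_mul])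

theorem lorentzBilin_apply (x y : Fin 4 → ℝ) : lorentzBilin x y = lorentzForm x y := rfl

theorem eq_zero_of_forall_lorentzForm_eq_zero {w : Fin 4 → ℝ}
    (h : ∀ v, lorentzForm w v = 0) : w = 0 := by
  ext i
  have := h (Pi.single i 1)
  fin_cases i <;> simpa [lorentzForm, Pi.single_apply] using this

theorem HypSpace.time_pos_of_lorentzForm_neg {v : Fin 4 → ℝ} (hv : lorentzForm v v = -1)
    (y : HypSpace) (h : lorentzForm v y.1 < 0) : 0 < v 0 := by
  by_contra! hc
  have h0 : v 0 ≠ 0 := by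
    intro h0
    simp only [lorentzForm, h0] at hv
    nlinarith [sq_nonneg (v 1), sq_nonneg (v 2), sq_nonneg (v 3)]
  have hneg : v 0 < 0 := lt_of_le_of_ne hc h0
  have e : lorentzForm ((-1 : ℝ) • v) ((-1 : ℝ) • v) = -1 := by
    rw [lorentzForm_smul_left, lorentzForm_smul_right, hv]; ring
  have := HypSpace.neg_lorentzForm_pos ⟨(-1 : ℝ) • v, e, by simpa using hneg⟩ y
  simp only [lorentzForm_smul_left] at this
  linarith

/-- The normalizations of `x + t eᵢ` are close to `x` for small `t > 0`, and they are independent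
unless `t + ∑ xₖ = 0`, which excludes at most one `t`. -/
theorem HypSpace.exists_basis_mem_ball (x : HypSpace) {δ : ℝ} (hδ : 0 < δ) :
    ∃ b : Module.Basis (Fin 4) ℝ (Fin 4 → ℝ), ∃ p : Fin 4 → HypSpace,
      ∀ i, p i ∈ ball x δ ∧ b i = (p i).1 := by
  let v : ℝ → Fin 4 → Fin 4 → ℝ := fun t i => x.1 + t • Pi.single i (1 : ℝ)
  have hv : ∀ i, Continuous fun t => v t i := fun i => by fun_prop
  have hl : ∀ i, Continuous fun t => lorentzForm (v t i) (v t i) := fun i => by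
    unfold lorentzForm; fun_prop
  have hl2 : ∀ i, Continuous fun t => lorentzForm x.1 (v t i) := fun i => by
    unfold lorentzForm; fun_prop
  have v0 : ∀ i, v 0 i = x.1 := fun i => by simp [v]
  have e1 : ∀ i, ∀ᶠ t in 𝓝 (0 : ℝ), lorentzForm (v t i) (v t i) < 0 := fun i =>
    (hl i).continuousAt.eventually_lt continuousAt_const (by simp only [v0, x.2.1]; norm_num)
  have e2 : ∀ i, ∀ᶠ t in 𝓝 (0 : ℝ), (√(-lorentzForm (v t i) (v t i)))⁻¹ *
      (-lorentzForm x.1 (v t i)) < Real.cosh δ := fun i => by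
    refine ContinuousAt.eventually_lt (ContinuousAt.mul (ContinuousAt.inv₀
      ((hl i).neg.sqrt.continuousAt) ?_) (hl2 i).neg.continuousAt) continuousAt_const ?_
    · simp [v0, x.2.1]
    · simpa [v0, x.2.1] using hδ.ne'
  have e3 : ∀ᶠ t in 𝓝 (0 : ℝ), ∀ i, lorentzForm (v t i) (v t i) < 0 ∧
      (√(-lorentzForm (v t i) (v t i)))⁻¹ * (-lorentzForm x.1 (v t i)) < Real.cosh δ :=
    eventually_all.2 fun i => (e1 i).and (e2 i)
  have e4 : ∃ t : ℝ, 0 < t ∧ t + ∑ k, x.1 k ≠ 0 ∧ ∀ i, lorentzForm (v t i) (v t i) < 0 ∧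
      (√(-lorentzForm (v t i) (v t i)))⁻¹ * (-lorentzForm x.1 (v t i)) < Real.cosh δ := by
    obtain ⟨ε, hε, h⟩ := Metric.eventually_nhds_iff.1 e3
    by_cases hs : ε / 2 + ∑ k, x.1 k = 0
    · refine ⟨ε / 4, by positivity, fun h' => by linarith, h ?_⟩
      rw [Real.dist_eq, sub_zero, abs_of_pos (by positivity)]; linarith
    · refine ⟨ε / 2, by positivity, hs, h ?_⟩
      rw [Real.dist_eq, sub_zero, abs_of_pos (by positivity)]; linarith
  obtain ⟨t, ht, hts, h⟩ := e4
  have hpos : ∀ i, 0 < v t i 0 := fun i => by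
    have : 0 ≤ (Pi.single i (1 : ℝ) : Fin 4 → ℝ) 0 := by
      rw [Pi.single_apply]; split_ifs <;> norm_num
    simp only [v, Pi.add_apply, Pi.smul_apply, smul_eq_mul]
    have := x.2.2
    positivity
  let p : Fin 4 → HypSpace := fun i => HypSpace.normalize (v t i) (h i).1 (hpos i)
  have hp : ∀ i, (p i).1 = (√(-lorentzForm (v t i) (v t i)))⁻¹ • v t i := fun i => rfl
  have hs : ∀ i, 0 < √(-lorentzForm (v t i) (v t i)) := fun i =>
    Real.sqrt_pos.2 (by linarith [(h i).1])
  have li : LinearIndependent ℝ (v t) := by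
    rw [Fintype.linearIndependent_iff]
    intro c hc
    have hk : ∀ k, (∑ i, c i) * x.1 k + t * c k = 0 := by
      intro k
      have := congrFun hc k
      simpa [v, Finset.sum_apply, mul_add, Finset.sum_add_distrib, Pi.single_apply,
        ← Finset.sum_mul, mul_comm t] using this
    have hsum : (∑ i, c i) * (t + ∑ k, x.1 k) = 0 := by
      have := Finset.sum_congr rfl (fun k (_ : k ∈ Finset.univ) => hk k)
      rw [Finset.sum_add_distrib, ← Finset.mul_sum, ← Finset.mul_sum] at this
      simp only [Finset.sum_const_zero] at this
      linarith
    have h0 := (mul_eq_zero.1 hsum).resolve_right hts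
    intro k
    have := hk k
    rw [h0, zero_mul, zero_add] at this
    exact (mul_eq_zero.1 this).resolve_left ht.ne'
  have li2 : LinearIndependent ℝ fun i => (p i).1 := by
    have := li.units_smul (fun i => Units.mk0 _ (inv_pos.2 (hs i)).ne')
    convert this using 1
    funext i
    simp [hp, Units.smul_def]
  refine ⟨basisOfLinearIndependentOfCardEqFinrank li2 (by simp), p, fun i => ⟨?_, by simp⟩⟩
  rw [mem_ball, dist_comm, ← abs_of_nonneg (dist_nonneg (x := x)), ← abs_of_pos hδ,
    ← Real.cosh_lt_cosh, HypSpace.cosh_dist, hp, lorentzForm_smul_right]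
  have := (h i).2
  linarith

theorem HypSpace.eq_of_forall_dist_eq {x y y' : HypSpace} {δ : ℝ} (hδ : 0 < δ)
    (h : ∀ p ∈ ball x δ, dist y p = dist y' p) : y = y' := by
  obtain ⟨b, p, hp⟩ := HypSpace.exists_basis_mem_ball x hδ
  have h1 : lorentzBilin (y.1 - y'.1) = 0 := b.ext fun i => by
    rw [(hp i).2, lorentzBilin_apply, lorentzForm_sub_left, HypSpace.lorentzForm_eq,
      HypSpace.lorentzForm_eq, h _ (hp i).1]
    simp
  have h2 := eq_zero_of_forall_lorentzForm_eq_zero (w := y.1 - y'.1) fun v => by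
    rw [← lorentzBilin_apply, h1]; rfl
  exact Subtype.ext (sub_eq_zero.1 h2)

/-- An isometric embedding of a ball of hyperbolic space extends to an isometry. -/
theorem HypSpace.exists_isometryEquiv_extends {x : HypSpace} {δ : ℝ} (hδ : 0 < δ)
    {f : HypSpace → HypSpace} (hf : ∀ p ∈ ball x δ, ∀ q ∈ ball x δ, dist (f p) (f q) = dist p q) :
    ∃ A : HypSpace ≃ᵢ HypSpace, ∀ p ∈ ball x δ, A p = f p := by
  obtain ⟨b, p, hp⟩ := HypSpace.exists_basis_mem_ball x hδ
  -- Distances determine Lorentz products, so this linear map preserves the Gram matrix of a basis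
  -- and therefore the form.
  let T : (Fin 4 → ℝ) →ₗ[ℝ] (Fin 4 → ℝ) := b.constr ℝ fun i => (f (p i)).1
  have hT : ∀ i, T (p i).1 = (f (p i)).1 := fun i => by
    rw [← (hp i).2]; exact b.constr_basis ℝ _ i
  have hform : ∀ v w, lorentzForm (T v) (T w) = lorentzForm v w := by
    have : lorentzBilin.compl₁₂ T T = lorentzBilin := by
      refine LinearMap.ext_basis b b fun i j => ?_
      rw [LinearMap.compl₁₂_apply, (hp i).2, (hp j).2, hT, hT, lorentzBilin_apply,
        lorentzBilin_apply, HypSpace.lorentzForm_eq, HypSpace.lorentzForm_eq,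
        hf _ (hp i).1 _ (hp j).1]
    intro v w
    exact LinearMap.congr_fun₂ this v w
  have hinj : Function.Injective T := by
    rw [← LinearMap.ker_eq_bot, LinearMap.ker_eq_bot']
    intro v hv
    refine eq_zero_of_forall_lorentzForm_eq_zero fun w => ?_
    rw [← hform, hv]
    simp [lorentzForm]
  have hsurj : Function.Surjective T := LinearMap.injective_iff_surjective.1 hinj
  have hself : ∀ y : HypSpace, lorentzForm (T y.1) (T y.1) = -1 ∧ 0 < T y.1 0 := fun y => by
    have h1 : lorentzForm (T y.1) (T y.1) = -1 := (hform _ _).trans y.2.1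
    refine ⟨h1, HypSpace.time_pos_of_lorentzForm_neg h1 (f (p 0)) ?_⟩
    rw [← hT, hform]
    linarith [HypSpace.neg_lorentzForm_pos y (p 0)]
  let A : HypSpace → HypSpace := fun y => ⟨T y.1, hself y⟩
  have hA : Isometry A := Isometry.of_dist_eq fun y z => by
    change Real.arcosh (-lorentzForm (T y.1) (T z.1)) = Real.arcosh (-lorentzForm y.1 z.1)
    rw [hform]
  have hAs : Function.Surjective A := by
    intro y
    obtain ⟨v, hv⟩ := hsurj y.1
    have h1 : lorentzForm v v = -1 := by rw [← hform, hv]; exact y.2.1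
    refine ⟨⟨v, h1, HypSpace.time_pos_of_lorentzForm_neg h1 (p 0) ?_⟩, Subtype.ext hv⟩
    rw [← hform, hT, hv]
    linarith [HypSpace.neg_lorentzForm_pos y (f (p 0))]
  refine ⟨⟨Equiv.ofBijective A ⟨hA.injective, hAs⟩, hA⟩, fun q hq => ?_⟩
  -- The vectors `T q` and `f q` have the same products with the images of the basis, and `T` is
  -- surjective.
  have h1 : lorentzBilin (T q.1 - (f q).1) ∘ₗ T = 0 := b.ext fun i => by
    rw [(hp i).2, LinearMap.comp_apply, lorentzBilin_apply, lorentzForm_sub_left, hform, hT,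
      HypSpace.lorentzForm_eq, HypSpace.lorentzForm_eq, hf _ hq _ (hp i).1]
    simp
  have h2 := eq_zero_of_forall_lorentzForm_eq_zero (w := T q.1 - (f q).1) fun v => by
    obtain ⟨w, rfl⟩ := hsurj v
    exact LinearMap.congr_fun h1 w
  exact Subtype.ext (sub_eq_zero.1 h2)

theorem HypSpace.eq_self_of_isometry {A : HypSpace → HypSpace} (hA : Isometry A) {x : HypSpace}
    {δ : ℝ} (hδ : 0 < δ) (h : ∀ p ∈ ball x δ, A p = p) (y : HypSpace) : A y = y :=
  HypSpace.eq_of_forall_dist_eq hδ fun p hp => by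
    conv_lhs => rw [← h p hp, hA.dist_eq]

end Rigidity

/-! ### Local isometries from hyperbolic space and their continuation -/

section LocalIsometry

variable {X M : Type*} [MetricSpace X] [MetricSpace M]

/-- `Ψ` maps the ball of radius `δ` about `x` isometrically onto the ball of radius `δ`
about `Ψ x`. -/
def IsoOn (Ψ : X → M) (x : X) (δ : ℝ) : Prop :=
  (∀ p ∈ ball x δ, ∀ q ∈ ball x δ, dist (Ψ p) (Ψ q) = dist p q) ∧ Ψ '' ball x δ = ball (Ψ x) δ

theorem IsoOn.mono {Ψ : X → M} {x : X} {δ δ' : ℝ} (h : IsoOn Ψ x δ) (hδ : δ' ≤ δ) :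
    IsoOn Ψ x δ' := by
  refine ⟨fun p hp q hq => h.1 p (ball_subset_ball hδ hp) q (ball_subset_ball hδ hq), ?_⟩
  rcases le_or_gt δ' 0 with h0 | h0
  · rw [ball_eq_empty.2 h0, ball_eq_empty.2 h0, image_empty]
  have hx : x ∈ ball x δ := mem_ball_self (h0.trans_le hδ)
  ext w
  constructor
  · rintro ⟨p, hp, rfl⟩
    rw [mem_ball, h.1 p (ball_subset_ball hδ hp) x hx]
    exact hp
  · intro hw
    obtain ⟨p, hp, rfl⟩ := h.2.symm ▸ ball_subset_ball hδ hw
    rw [mem_ball, h.1 p hp x hx] at hw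
    exact ⟨p, hw, rfl⟩

theorem IsoOn.recenter {Ψ : X → M} {x y : X} {δ δ' : ℝ} (h : IsoOn Ψ x δ) (hy : y ∈ ball x δ)
    (hδ : δ' ≤ δ - dist y x) : IsoOn Ψ y δ' := by
  have hsub : ball y δ' ⊆ ball x δ := ball_subset_ball' (by linarith)
  refine ⟨fun p hp q hq => h.1 p (hsub hp) q (hsub hq), ?_⟩
  have hx : x ∈ ball x δ := mem_ball_self (pos_of_mem_ball hy)
  ext w
  constructor
  · rintro ⟨p, hp, rfl⟩
    rw [mem_ball, h.1 p (hsub hp) y hy]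
    exact hp
  · intro hw
    have hw' : w ∈ ball (Ψ x) δ := by
      have h1 := h.1 y hy x hx
      rw [mem_ball] at hw ⊢
      linarith [dist_triangle w (Ψ y) (Ψ x)]
    obtain ⟨p, hp, rfl⟩ := h.2.symm ▸ hw'
    rw [mem_ball, h.1 p hp y hy] at hw
    exact ⟨p, hw, rfl⟩

theorem IsoOn.injOn {Ψ : X → M} {x : X} {δ : ℝ} (h : IsoOn Ψ x δ) : InjOn Ψ (ball x δ) :=
  fun p hp q hq e => dist_eq_zero.1 (by rw [← h.1 p hp q hq, e, dist_self])

theorem IsoOn.dist_center {Ψ : X → M} {x p : X} {δ : ℝ} (h : IsoOn Ψ x δ) (hp : p ∈ ball x δ) :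
    dist (Ψ p) (Ψ x) = dist p x :=
  h.1 p hp x (mem_ball_self (pos_of_mem_ball hp))

theorem IsoOn.exists_eq {Ψ : X → M} {x : X} {δ : ℝ} (h : IsoOn Ψ x δ) {w : M}
    (hw : w ∈ ball (Ψ x) δ) : ∃ p ∈ ball x δ, Ψ p = w := by
  rwa [← h.2] at hw

theorem IsoOn.continuousAt {Ψ : X → M} {x : X} {δ : ℝ} (h : IsoOn Ψ x δ) (hδ : 0 < δ) :
    ContinuousAt Ψ x := by
  rw [Metric.continuousAt_iff]
  intro ε hε
  refine ⟨min δ ε, lt_min hδ hε, fun {p} hp => ?_⟩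
  rw [h.dist_center (mem_ball.2 (lt_of_lt_of_le hp (min_le_left _ _)))]
  exact lt_of_lt_of_le hp (min_le_right _ _)

theorem IsoOn.comp_isometryEquiv {Ψ : X → M} {x : X} {δ : ℝ} (A : X ≃ᵢ X)
    (h : IsoOn Ψ (A x) δ) : IsoOn (Ψ ∘ A) x δ := by
  refine ⟨fun p hp q hq => ?_, ?_⟩
  · rw [Function.comp_apply, Function.comp_apply, h.1, A.isometry.dist_eq]
    · rwa [mem_ball, A.isometry.dist_eq]
    · rwa [mem_ball, A.isometry.dist_eq]
  · rw [image_comp, A.image_ball, h.2]; rfl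

/-- The transition map between two local isometries with common target. -/
theorem IsoOn.exists_transition {Ψ χ : X → M} {x y : X} {δ ε : ℝ} (hΨ : IsoOn Ψ x δ)
    (hχ : IsoOn χ y ε) (hsub : ball (Ψ x) δ ⊆ ball (χ y) ε) :
    ∃ f : X → X, (∀ p ∈ ball x δ, f p ∈ ball y ε ∧ χ (f p) = Ψ p) ∧
      ∀ p ∈ ball x δ, ∀ q ∈ ball x δ, dist (f p) (f q) = dist p q := by
  have h1 : ∀ p, ∃ q, p ∈ ball x δ → q ∈ ball y ε ∧ χ q = Ψ p := fun p => by
    by_cases hp : p ∈ ball x δ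
    · obtain ⟨q, hq⟩ := hχ.exists_eq (hsub (hΨ.2 ▸ mem_image_of_mem Ψ hp))
      exact ⟨q, fun _ => hq⟩
    · exact ⟨y, fun h => absurd h hp⟩
  choose f hf using h1
  refine ⟨f, hf, fun p hp q hq => ?_⟩
  rw [← hχ.1 _ (hf p hp).1 _ (hf q hq).1, (hf p hp).2, (hf q hq).2, hΨ.1 p hp q hq]

/-- The transition from `Ψ` to the chart `χ` extends to an isometry `A` of the whole space, and `χ ∘
A` is the continuation. It keeps the full radius `ε` of the chart, however small `δ` is. -/
theorem IsoOn.exists_continuation {Ψ χ : HypSpace → M} {x y : HypSpace} {δ ε : ℝ} (hδ : 0 < δ)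
    (hΨ : IsoOn Ψ x δ) (hχ : IsoOn χ y ε) (hx : Ψ x ∈ ball (χ y) ε) :
    ∃ χ' : HypSpace → M, ∃ y' : HypSpace, ∃ δ' > 0, IsoOn χ' y' ε ∧ x ∈ ball y' ε ∧
      χ' y' = χ y ∧ ∀ p ∈ ball x δ', χ' p = Ψ p := by
  have hd : 0 < ε - dist (Ψ x) (χ y) := sub_pos.2 hx
  set δ' := min δ (ε - dist (Ψ x) (χ y)) with hδ'
  have h0 : 0 < δ' := lt_min hδ hd
  have hΨ' := hΨ.mono (min_le_left δ (ε - dist (Ψ x) (χ y)))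
  obtain ⟨f, hf, hfi⟩ := hΨ'.exists_transition hχ
    (ball_subset_ball' (by linarith [min_le_right δ (ε - dist (Ψ x) (χ y))]))
  obtain ⟨A, hA⟩ := HypSpace.exists_isometryEquiv_extends h0 hfi
  have hA' : ∀ p ∈ ball x δ', (χ ∘ A) p = Ψ p := fun p hp => by
    rw [Function.comp_apply, hA p hp, (hf p hp).2]
  have hxx : x ∈ ball x δ' := mem_ball_self h0
  refine ⟨χ ∘ A, A.symm y, δ', h0, ?_, ?_, by simp, hA'⟩
  · apply IsoOn.comp_isometryEquiv; simpa using hχ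
  · rw [mem_ball, ← A.isometry.dist_eq, A.apply_symm_apply, hA x hxx]
    exact (hf x hxx).1

/-- Two local isometries on a ball which agree near one point agree. -/
theorem IsoOn.eqOn_of_eqOn_ball {Ψ Ψ' : HypSpace → M} {x p : HypSpace} {δ η : ℝ}
    (hΨ : IsoOn Ψ x δ) (hΨ' : IsoOn Ψ' x δ) (hx : Ψ x = Ψ' x) (hp : p ∈ ball x δ) (hη : 0 < η)
    (h : ∀ q ∈ ball p η, Ψ q = Ψ' q) : ∀ q ∈ ball x δ, Ψ q = Ψ' q := by
  obtain ⟨f, hf, hfi⟩ := hΨ.exists_transition hΨ' (by rw [hx])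
  obtain ⟨A, hA⟩ := HypSpace.exists_isometryEquiv_extends (pos_of_mem_ball hp) hfi
  obtain ⟨η', hη', hsub⟩ : ∃ η' > 0, ball p η' ⊆ ball x δ := isOpen_iff.1 isOpen_ball p hp
  -- The transition map from `Ψ` to `Ψ'` fixes a small ball about `p`, so its extension is the
  -- identity.
  have hAid : ∀ y, A y = y := HypSpace.eq_self_of_isometry A.isometry (lt_min hη hη')
    (x := p) fun q hq => by
      have hq1 := hsub (ball_subset_ball (min_le_right _ _) hq)
      rw [hA q hq1]
      apply hΨ'.injOn (hf q hq1).1 hq1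
      rw [(hf q hq1).2, h q (ball_subset_ball (min_le_left _ _) hq)]
  intro q hq
  rw [← (hf q hq).2, ← hA q hq, hAid]

end LocalIsometry

/-! ### Cylindrical coordinates and the distance in the branched cover -/

section CylindricalCoordinates

theorem HypSpace.continuous_of_continuous_val {Y : Type*} [TopologicalSpace Y] {f : Y → HypSpace}
    (hf : Continuous fun y => (f y).1) : Continuous f := by
  rw [continuous_iff_continuousAt]
  intro y
  rw [ContinuousAt, tendsto_iff_dist_tendsto_zero]
  have h1 : Continuous fun z => -lorentzForm (f z).1 (f y).1 := by
    have hi : ∀ i, Continuous fun z => (f z).1 i := fun i => (continuous_apply i).comp hf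
    have h0 := hi 0
    have h1 := hi 1
    have h2 := hi 2
    have h3 := hi 3
    unfold lorentzForm
    fun_prop
  have h2 : ContinuousOn Real.arcosh (Ici 1) := Real.continuousOn_arcosh
  have h3 : Continuous fun z => Real.arcosh (-lorentzForm (f z).1 (f y).1) :=
    h2.comp_continuous h1 fun z => HypSpace.one_le_neg_lorentzForm _ _
  have h4 := h3.tendsto y
  rw [(f y).2.1, neg_neg, Real.arcosh_zero] at h4
  exact h4

/-- The point at distance `r` from the axis in the direction `u = (θ, ζ)`. -/
noncomputable def cyl (r : ℝ) (u : ℝ × ℝ) : HypSpace := cylPoint r u.1 u.2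

theorem continuous_cyl : Continuous fun p : ℝ × ℝ × ℝ => cyl p.1 p.2 := by
  refine HypSpace.continuous_of_continuous_val (continuous_pi fun i => ?_)
  fin_cases i <;> simp [cyl, cylPoint] <;> fun_prop

/-- The hyperbolic cosine of the distance of two points with cylindrical coordinates. -/
theorem cosh_dist_cyl (r r' : ℝ) (u v : ℝ × ℝ) : Real.cosh (dist (cyl r u) (cyl r' v)) =
    Real.cosh (r - r') + Real.cosh r * Real.cosh r' * (Real.cosh (u.2 - v.2) - 1) +
      Real.sinh r * Real.sinh r' * (1 - Real.cos (u.1 - v.1)) := by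
  rw [HypSpace.cosh_dist]
  simp only [lorentzForm, cyl, cylPoint, Matrix.cons_val, Real.cosh_sub, Real.cos_sub]
  ring

theorem cosh_branchedDist (p q : BranchedPoint) : Real.cosh (branchedDist p q) =
    Real.cosh (p.r - q.r) + Real.cosh p.r * Real.cosh q.r * (Real.cosh (p.ζ - q.ζ) - 1) +
      Real.sinh p.r * Real.sinh q.r * (1 - Real.cos (min |p.θ - q.θ| Real.pi)) := by
  have := cosh_dist_cyl p.r q.r (0, p.ζ) (min |p.θ - q.θ| Real.pi, q.ζ)
  rw [zero_sub, Real.cos_neg] at this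
  exact this

theorem branchedDist_nonneg (p q : BranchedPoint) : 0 ≤ branchedDist p q :=
  HypSpace.hypDist_nonneg _ _

/-- The direction of a point of the branched cover. -/
def BranchedPoint.dir (p : BranchedPoint) : ℝ × ℝ := (p.θ, p.ζ)

theorem branchedDist_eq_dist {p q : BranchedPoint} (h : |p.θ - q.θ| ≤ Real.pi) :
    branchedDist p q = dist (cyl p.r p.dir) (cyl q.r q.dir) := by
  refine Real.cosh_injOn (mem_Ici.2 (branchedDist_nonneg p q)) (mem_Ici.2 dist_nonneg) ?_
  rw [cosh_branchedDist, cosh_dist_cyl, min_eq_left h, Real.cos_abs]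
  rfl

theorem le_of_cosh_le_cosh {a b : ℝ} (hb : 0 ≤ b) (h : Real.cosh a ≤ Real.cosh b) : |a| ≤ b := by
  rw [← abs_of_nonneg hb]; exact Real.cosh_le_cosh.1 h

theorem one_le_cosh_mul_cosh (r r' : ℝ) : 1 ≤ Real.cosh r * Real.cosh r' :=
  one_le_mul_of_one_le_of_one_le (Real.one_le_cosh r) (Real.one_le_cosh r')

theorem abs_sub_r_le_branchedDist (p q : BranchedPoint) : |p.r - q.r| ≤ branchedDist p q := by
  refine le_of_cosh_le_cosh (branchedDist_nonneg p q) ?_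
  rw [cosh_branchedDist]
  have h1 := one_le_cosh_mul_cosh p.r q.r
  have h2 := Real.one_le_cosh (p.ζ - q.ζ)
  have h3 := mul_nonneg (Real.sinh_nonneg_iff.2 p.r_nonneg) (Real.sinh_nonneg_iff.2 q.r_nonneg)
  have h4 := mul_nonneg h3 (sub_nonneg.2 (Real.cos_le_one (min |p.θ - q.θ| Real.pi)))
  nlinarith

theorem abs_sub_ζ_le_branchedDist (p q : BranchedPoint) : |p.ζ - q.ζ| ≤ branchedDist p q := by
  refine le_of_cosh_le_cosh (branchedDist_nonneg p q) ?_
  rw [cosh_branchedDist]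
  have h1 := one_le_cosh_mul_cosh p.r q.r
  have h2 := Real.one_le_cosh (p.ζ - q.ζ)
  have h5 := Real.one_le_cosh (p.r - q.r)
  have h3 := mul_nonneg (Real.sinh_nonneg_iff.2 p.r_nonneg) (Real.sinh_nonneg_iff.2 q.r_nonneg)
  have h4 := mul_nonneg h3 (sub_nonneg.2 (Real.cos_le_one (min |p.θ - q.θ| Real.pi)))
  nlinarith

theorem abs_sub_le_dist_cyl {r r' : ℝ} (hr : 0 ≤ r) (hr' : 0 ≤ r') (u v : ℝ × ℝ) :
    |r - r'| ≤ dist (cyl r u) (cyl r' v) := by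
  refine le_of_cosh_le_cosh dist_nonneg ?_
  rw [cosh_dist_cyl]
  have h1 := one_le_cosh_mul_cosh r r'
  have h2 := Real.one_le_cosh (u.2 - v.2)
  have h3 := mul_nonneg (Real.sinh_nonneg_iff.2 hr) (Real.sinh_nonneg_iff.2 hr')
  have h4 := mul_nonneg h3 (sub_nonneg.2 (Real.cos_le_one (u.1 - v.1)))
  nlinarith

theorem dist_cyl_ray (r r' : ℝ) (u : ℝ × ℝ) : dist (cyl r u) (cyl r' u) = |r - r'| := by
  refine Real.cosh_injOn (mem_Ici.2 dist_nonneg) (mem_Ici.2 (abs_nonneg _)) ?_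
  rw [cosh_dist_cyl, Real.cosh_abs]
  simp

theorem branchedDist_ray (p q : BranchedPoint) (h : p.dir = q.dir) :
    branchedDist p q = |p.r - q.r| := by
  have : p.θ = q.θ := congrArg Prod.fst h
  rw [branchedDist_eq_dist (by simp [this, Real.pi_pos.le]), h, dist_cyl_ray]

/-- Away from the axis, the distance controls the direction. -/
theorem exists_branchedDist_imp_dir {ρ η : ℝ} (hρ : 0 < ρ) (hη : 0 < η) :
    ∃ δ > 0, ∀ p q : BranchedPoint, ρ ≤ p.r → ρ ≤ q.r → branchedDist p q < δ →
      ‖p.dir - q.dir‖ < η := by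
  -- Capped at `π`, where cosine stops decreasing and where `branchedDist` stops seeing the angle.
  set η' := min η Real.pi with hη'
  have h0 : 0 < η' := lt_min hη Real.pi_pos
  have hc : Real.cos η' < 1 := by
    rw [← Real.cos_zero]
    exact Real.cos_lt_cos_of_nonneg_of_le_pi le_rfl (min_le_right _ _) h0
  have hs : 0 < Real.sinh ρ := Real.sinh_pos_iff.2 hρ
  have hk : 0 < Real.sinh ρ ^ 2 * (1 - Real.cos η') := by
    have := sub_pos.2 hc; positivity
  have hcont : ∀ᶠ d in 𝓝 (0 : ℝ), Real.cosh d < 1 + Real.sinh ρ ^ 2 * (1 - Real.cos η') :=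
    Real.continuous_cosh.continuousAt.eventually_lt continuousAt_const (by simp [hk])
  obtain ⟨δ, hδ, h⟩ := Metric.eventually_nhds_iff.1 hcont
  refine ⟨min δ η, lt_min hδ hη, fun p q hp hq hpq => ?_⟩
  have h1 : Real.cosh (branchedDist p q) < 1 + Real.sinh ρ ^ 2 * (1 - Real.cos η') := by
    apply h
    rw [Real.dist_eq, sub_zero, abs_of_nonneg (branchedDist_nonneg p q)]
    exact hpq.trans_le (min_le_left _ _)
  have hζ := (abs_sub_ζ_le_branchedDist p q).trans_lt (hpq.trans_le (min_le_right _ _))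
  have hθ : |p.θ - q.θ| < η' := by
    by_contra! hc
    have hm : Real.cos (min |p.θ - q.θ| Real.pi) ≤ Real.cos η' :=
      Real.cos_le_cos_of_nonneg_of_le_pi h0.le (min_le_right _ _)
        (le_min hc (min_le_right _ _))
    rw [cosh_branchedDist] at h1
    have h2 := one_le_cosh_mul_cosh p.r q.r
    have h3 := Real.one_le_cosh (p.ζ - q.ζ)
    have h4 := Real.one_le_cosh (p.r - q.r)
    have h5 : Real.sinh ρ ^ 2 ≤ Real.sinh p.r * Real.sinh q.r := by
      rw [sq]
      exact mul_le_mul (Real.sinh_le_sinh.2 hp) (Real.sinh_le_sinh.2 hq) hs.le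
        (Real.sinh_nonneg_iff.2 p.r_nonneg)
    have h6 : Real.sinh ρ ^ 2 * (1 - Real.cos η') ≤ Real.sinh p.r * Real.sinh q.r *
        (1 - Real.cos (min |p.θ - q.θ| Real.pi)) :=
      mul_le_mul h5 (by linarith) (by linarith) (le_trans (by positivity) h5)
    nlinarith
  rw [Prod.norm_def, max_lt_iff]
  exact ⟨hθ.trans_le (min_le_left _ _), hζ⟩

theorem exists_dist_cyl_imp_dir {ρ η : ℝ} (hρ : 0 < ρ) (hη : 0 < η) :
    ∃ δ > 0, ∀ (r r' : ℝ) (u v : ℝ × ℝ), ρ ≤ r → ρ ≤ r' → |u.1 - v.1| ≤ Real.pi →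
      dist (cyl r u) (cyl r' v) < δ → ‖u - v‖ < η := by
  obtain ⟨δ, hδ, h⟩ := exists_branchedDist_imp_dir hρ hη
  refine ⟨δ, hδ, fun r r' u v hr hr' huv hd => ?_⟩
  have := h ⟨r, u.1, u.2, hρ.le.trans hr⟩ ⟨r', v.1, v.2, hρ.le.trans hr'⟩ hr hr'
  rw [branchedDist_eq_dist huv] at this
  exact this hd

/-- Every point of hyperbolic space has cylindrical coordinates with angle in a given
interval of length `2π`. -/
theorem exists_eq_cyl (x : HypSpace) (θ₀ : ℝ) :
    ∃ r u, 0 ≤ r ∧ |u.1 - θ₀| ≤ Real.pi ∧ x = cyl r u := by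
  set z : ℂ := ⟨x.1 2, x.1 3⟩ with hz
  set θ := toIocMod Real.two_pi_pos (θ₀ - Real.pi) z.arg with hθ
  have hmem := toIocMod_mem_Ioc Real.two_pi_pos (θ₀ - Real.pi) z.arg
  rw [← hθ] at hmem
  have harg : z.arg = θ + toIocDiv Real.two_pi_pos (θ₀ - Real.pi) z.arg • (2 * Real.pi) :=
    (toIocMod_add_toIocDiv_zsmul _ _ _).symm
  have hcos : ‖z‖ * Real.cos θ = x.1 2 := by
    have h1 : Real.cos θ = Real.cos z.arg := by
      rw [harg, zsmul_eq_mul, Real.cos_add_int_mul_two_pi]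
    rw [h1, Complex.norm_mul_cos_arg]
  have hsin : ‖z‖ * Real.sin θ = x.1 3 := by
    have h1 : Real.sin θ = Real.sin z.arg := by
      rw [harg, zsmul_eq_mul, Real.sin_add_int_mul_two_pi]
    rw [h1, Complex.norm_mul_sin_arg]
  have hnorm : ‖z‖ ^ 2 = x.1 2 ^ 2 + x.1 3 ^ 2 := by
    rw [← Complex.normSq_eq_norm_sq, Complex.normSq_apply]; ring
  set r := Real.arsinh ‖z‖ with hr
  have hsr : Real.sinh r = ‖z‖ := Real.sinh_arsinh _
  have hcr := Real.cosh_pos r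
  set ζ := Real.arsinh (x.1 1 / Real.cosh r) with hζ
  have hsζ : Real.cosh r * Real.sinh ζ = x.1 1 := by
    rw [hζ, Real.sinh_arsinh]; field_simp
  have hcζ : Real.cosh r * Real.cosh ζ = x.1 0 := by
    have h1 : (Real.cosh r * Real.cosh ζ) ^ 2 = x.1 0 ^ 2 := by
      rw [x.time_sq, mul_pow, Real.cosh_sq ζ, mul_add, ← mul_pow, hsζ, Real.cosh_sq r, hsr, hnorm]
      ring
    exact (pow_left_inj₀ (mul_pos hcr (Real.cosh_pos ζ)).le x.2.2.le two_ne_zero).1 h1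
  refine ⟨r, (θ, ζ), Real.arsinh_nonneg_iff.2 (norm_nonneg z), ?_, Subtype.ext ?_⟩
  · rw [abs_le]; constructor <;> simp only <;> linarith [hmem.1, hmem.2]
  · ext i
    fin_cases i <;> simp [cyl, cylPoint, hsr, hcos, hsin, hsζ, hcζ]

/-- The angle is a real number but `cyl` is `2π`-periodic in it; the bound `π` selects one branch,
and `0 < r` avoids the axis, where the angle is lost. -/
theorem cyl_injective {r r' : ℝ} {u v : ℝ × ℝ} (hr : 0 < r) (hr' : 0 ≤ r')
    (huv : |u.1 - v.1| ≤ Real.pi) (h : cyl r u = cyl r' v) : r = r' ∧ u = v := by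
  have h1 : dist (cyl r u) (cyl r' v) = 0 := by rw [h, dist_self]
  have h2 := abs_sub_le_dist_cyl hr.le hr' u v
  have hrr : r = r' := by
    rw [h1] at h2; exact sub_eq_zero.1 (abs_nonpos_iff.1 h2)
  refine ⟨hrr, ?_⟩
  subst hrr
  by_contra hne
  obtain ⟨δ, hδ, h⟩ := exists_dist_cyl_imp_dir hr (norm_pos_iff.2 (sub_ne_zero.2 hne))
  exact lt_irrefl _ (h r r u v le_rfl le_rfl huv (by rw [h1]; exact hδ))

end CylindricalCoordinates

/-! ### The tube group and the distance in the model tube -/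

section TubeGroup

theorem mem_tubeGroup_iff {α ℓ τ : ℝ} {g : ℝ × ℝ} :
    g ∈ tubeGroup α ℓ τ ↔ ∃ m n : ℤ, g = (m * α + n * τ, n * ℓ) := by
  rw [tubeGroup, Submodule.mem_span_pair]
  constructor
  · rintro ⟨m, n, rfl⟩; exact ⟨m, n, by ext <;> simp⟩
  · rintro ⟨m, n, rfl⟩; exact ⟨m, n, by ext <;> simp⟩

theorem int_eq_zero_of_abs_mul_lt {m : ℤ} {a : ℝ} (ha : 0 < a) (h : |(m : ℝ) * a| < a) :
    m = 0 := by
  rw [abs_mul, abs_of_pos ha] at h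
  have h1 : |(m : ℝ)| < 1 := by
    by_contra! hc; nlinarith
  have : |m| < 1 := by exact_mod_cast h1
  exact Int.abs_lt_one_iff.1 this

theorem exists_tubeGroup_discrete {α ℓ : ℝ} (hα : 0 < α) (hℓ : 0 < ℓ) (τ : ℝ) :
    ∃ η > 0, ∀ g ∈ tubeGroup α ℓ τ, ‖g‖ < η → g = 0 := by
  refine ⟨min α ℓ, lt_min hα hℓ, fun g hg h => ?_⟩
  obtain ⟨m, n, rfl⟩ := mem_tubeGroup_iff.1 hg
  rw [Prod.norm_def, max_lt_iff] at h
  have hn : n = 0 := int_eq_zero_of_abs_mul_lt hℓ (h.2.trans_le (min_le_right _ _))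
  subst hn
  have hm : m = 0 := int_eq_zero_of_abs_mul_lt hα (by
    have := h.1.trans_le (min_le_left _ _)
    simpa using this)
  subst hm
  simp

/-- Reducing `ζ` modulo `ℓ` first, and then `θ` modulo `α`, reaches a compact rectangle; all
compactness arguments on the boundary torus take place there. -/
theorem exists_tubeGroup_add_mem_Icc {α ℓ : ℝ} (hα : 0 < α) (hℓ : 0 < ℓ) (τ : ℝ) (v : ℝ × ℝ) :
    ∃ g ∈ tubeGroup α ℓ τ, v + g ∈ Icc (0 : ℝ × ℝ) (α, ℓ) := by
  obtain ⟨n, hn⟩ : ∃ n : ℤ, v.2 + n * ℓ ∈ Icc 0 ℓ := by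
    refine ⟨-⌊v.2 / ℓ⌋, ?_⟩
    have h1 := Int.floor_le (v.2 / ℓ)
    have h2 := Int.lt_floor_add_one (v.2 / ℓ)
    rw [le_div_iff₀ hℓ] at h1
    rw [div_lt_iff₀ hℓ] at h2
    push_cast
    constructor <;> linarith
  obtain ⟨m, hm⟩ : ∃ m : ℤ, v.1 + n * τ + m * α ∈ Icc 0 α := by
    refine ⟨-⌊(v.1 + n * τ) / α⌋, ?_⟩
    have h1 := Int.floor_le ((v.1 + n * τ) / α)
    have h2 := Int.lt_floor_add_one ((v.1 + n * τ) / α)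
    rw [le_div_iff₀ hα] at h1
    rw [div_lt_iff₀ hα] at h2
    push_cast
    constructor <;> linarith
  refine ⟨(m * α + n * τ, n * ℓ), mem_tubeGroup_iff.2 ⟨m, n, rfl⟩, ?_⟩
  rw [mem_Icc, Prod.le_def, Prod.le_def]
  simp only [Prod.fst_add, Prod.snd_add, Prod.fst_zero, Prod.snd_zero]
  refine ⟨⟨?_, hn.1⟩, ?_, hn.2⟩
  · linarith [hm.1]
  · linarith [hm.2]

theorem tubeDist_nonneg (α ℓ τ : ℝ) (p q : BranchedPoint) : 0 ≤ tubeDist α ℓ τ p q :=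
  Real.iInf_nonneg fun _ => branchedDist_nonneg _ _

theorem tubeDist_le {α ℓ τ : ℝ} (p q : BranchedPoint) {g : ℝ × ℝ} (hg : g ∈ tubeGroup α ℓ τ) :
    tubeDist α ℓ τ p q ≤ branchedDist p (q.translate g) :=
  ciInf_le (f := fun g : tubeGroup α ℓ τ => branchedDist p (q.translate g))
    ⟨0, by rintro _ ⟨_, rfl⟩; exact branchedDist_nonneg _ _⟩ ⟨g, hg⟩

theorem BranchedPoint.translate_zero (q : BranchedPoint) : q.translate 0 = q := by
  simp [BranchedPoint.translate]

theorem tubeDist_le_branchedDist (α ℓ τ : ℝ) (p q : BranchedPoint) :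
    tubeDist α ℓ τ p q ≤ branchedDist p q := by
  simpa [BranchedPoint.translate_zero] using
    tubeDist_le (α := α) (ℓ := ℓ) (τ := τ) p q (Submodule.zero_mem _)

theorem exists_branchedDist_lt_of_tubeDist_lt {α ℓ τ δ : ℝ} {p q : BranchedPoint}
    (h : tubeDist α ℓ τ p q < δ) :
    ∃ g ∈ tubeGroup α ℓ τ, branchedDist p (q.translate g) < δ := by
  obtain ⟨g, hg⟩ := exists_lt_of_ciInf_lt h
  exact ⟨g.1, g.2, hg⟩

theorem le_tubeDist {α ℓ τ d : ℝ} {p q : BranchedPoint}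
    (h : ∀ g ∈ tubeGroup α ℓ τ, d ≤ branchedDist p (q.translate g)) : d ≤ tubeDist α ℓ τ p q :=
  le_ciInf fun g : tubeGroup α ℓ τ => h g.1 g.2

theorem abs_sub_r_le_tubeDist (α ℓ τ : ℝ) (p q : BranchedPoint) :
    |p.r - q.r| ≤ tubeDist α ℓ τ p q :=
  le_tubeDist fun g _ => abs_sub_r_le_branchedDist p (q.translate g)

theorem branchedDist_self (p : BranchedPoint) : branchedDist p p = 0 := by
  rw [branchedDist_ray p p rfl]; simp

theorem tubeDist_translate {α ℓ τ : ℝ} (p : BranchedPoint) {g : ℝ × ℝ}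
    (hg : g ∈ tubeGroup α ℓ τ) : tubeDist α ℓ τ p (p.translate g) = 0 := by
  refine le_antisymm ?_ (tubeDist_nonneg _ _ _ _ _)
  refine (tubeDist_le p (p.translate g) (neg_mem hg)).trans ?_
  have : (p.translate g).translate (-g) = p := by simp [BranchedPoint.translate]
  rw [this, branchedDist_self]

theorem BranchedPoint.dir_translate (q : BranchedPoint) (g : ℝ × ℝ) :
    (q.translate g).dir = q.dir + g := rfl

/-- Points at distance zero in the quotient differ by an element of the group. -/
theorem exists_dir_eq_of_tubeDist_eq_zero {α ℓ τ : ℝ} (hα : 0 < α) (hℓ : 0 < ℓ)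
    {p q : BranchedPoint} (hp : 0 < p.r) (h : tubeDist α ℓ τ p q = 0) :
    p.r = q.r ∧ ∃ g ∈ tubeGroup α ℓ τ, p.dir = q.dir + g := by
  have hr : p.r = q.r := by
    have := abs_sub_r_le_tubeDist α ℓ τ p q
    rw [h] at this
    exact sub_eq_zero.1 (abs_nonpos_iff.1 this)
  refine ⟨hr, ?_⟩
  have key : ∀ ε > 0, ∃ g ∈ tubeGroup α ℓ τ, ‖p.dir - (q.dir + g)‖ < ε := fun ε hε => by
    obtain ⟨δ, hδ, h1⟩ := exists_branchedDist_imp_dir hp hε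
    obtain ⟨g, hg, h2⟩ := exists_branchedDist_lt_of_tubeDist_lt (h.trans_lt hδ)
    exact ⟨g, hg, h1 p (q.translate g) le_rfl hr.le h2⟩
  -- Discreteness makes the infimum attained: any two group elements within `η / 2` of the
  -- difference of the directions coincide.
  obtain ⟨η, hη, hdis⟩ := exists_tubeGroup_discrete hα hℓ τ
  obtain ⟨g, hg, h1⟩ := key (η / 2) (by positivity)
  refine ⟨g, hg, ?_⟩
  by_contra hne
  have hpos : 0 < ‖p.dir - (q.dir + g)‖ := norm_pos_iff.2 (sub_ne_zero.2 hne)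
  obtain ⟨g', hg', h2⟩ := key (min (η / 2) ‖p.dir - (q.dir + g)‖) (lt_min (by positivity) hpos)
  have h3 : g' - g = 0 := hdis _ (sub_mem hg' hg) (by
    have : g' - g = (p.dir - (q.dir + g)) - (p.dir - (q.dir + g')) := by abel
    rw [this]
    have := h2.trans_le (min_le_left _ _)
    linarith [norm_sub_le (p.dir - (q.dir + g)) (p.dir - (q.dir + g'))])
  rw [sub_eq_zero.1 h3] at h2
  exact lt_irrefl _ (h2.trans_le (min_le_right _ _))

theorem exists_forall_norm_sub_ge_of_notMem {α ℓ τ : ℝ} (hα : 0 < α) (hℓ : 0 < ℓ) {v : ℝ × ℝ}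
    (hv : v ∉ tubeGroup α ℓ τ) : ∃ η > 0, ∀ g ∈ tubeGroup α ℓ τ, η ≤ ‖v - g‖ := by
  by_contra! hc
  obtain ⟨η, hη, hdis⟩ := exists_tubeGroup_discrete hα hℓ τ
  obtain ⟨g, hg, h1⟩ := hc (η / 2) (by positivity)
  have hpos : 0 < ‖v - g‖ := norm_pos_iff.2 (sub_ne_zero.2 fun h => hv (h ▸ hg))
  obtain ⟨g', hg', h2⟩ := hc (min (η / 2) ‖v - g‖) (lt_min (by positivity) hpos)
  have h3 : g' - g = 0 := hdis _ (sub_mem hg' hg) (by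
    have : g' - g = (v - g) - (v - g') := by abel
    rw [this]
    have := h2.trans_le (min_le_left _ _)
    linarith [norm_sub_le (v - g) (v - g')])
  rw [sub_eq_zero.1 h3] at h2
  exact lt_irrefl _ (h2.trans_le (min_le_right _ _))

/-- Near a point off the axis, the distance in the quotient is the distance in the cover. -/
theorem exists_tubeDist_eq_branchedDist {α ℓ : ℝ} (hα : 0 < α) (hℓ : 0 < ℓ) (τ : ℝ) {ρ : ℝ}
    (hρ : 0 < ρ) : ∃ η > 0, ∃ δ > 0, ∀ q q' : BranchedPoint, ρ ≤ q.r → ρ ≤ q'.r →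
      ‖q.dir - q'.dir‖ < η → branchedDist q q' < δ → tubeDist α ℓ τ q q' = branchedDist q q' := by
  obtain ⟨η, hη, hdis⟩ := exists_tubeGroup_discrete hα hℓ τ
  obtain ⟨δ, hδ, h⟩ := exists_branchedDist_imp_dir hρ (half_pos hη)
  refine ⟨η / 2, half_pos hη, δ, hδ, fun q q' hq hq' hd hqq => ?_⟩
  refine le_antisymm (tubeDist_le_branchedDist _ _ _ _ _) (le_tubeDist fun g hg => ?_)
  by_contra! hc
  have h1 := h q (q'.translate g) hq hq' (hc.trans hqq)
  rw [BranchedPoint.dir_translate] at h1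
  have h2 : g = 0 := hdis g hg (by
    have : g = (q.dir - q'.dir) - (q.dir - (q'.dir + g)) := by abel
    rw [this]
    linarith [norm_sub_le (q.dir - q'.dir) (q.dir - (q'.dir + g))])
  rw [h2, BranchedPoint.translate_zero] at hc
  exact lt_irrefl _ hc

end TubeGroup

/-! ### Real induction, lengths of paths, length spaces -/

section Paths

/-- Induction over a half-open real interval. -/
theorem real_induction_Ico {P : ℝ → Prop} {a b : ℝ}
    (h : ∀ t ∈ Ico a b, (∀ s ∈ Ico a t, P s) → ∃ δ > 0, ∀ s ∈ Ico t (t + δ), s < b → P s) :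
    ∀ t ∈ Ico a b, P t := by
  by_contra! hc
  obtain ⟨t₁, ht₁, hP⟩ := hc
  set B := {t | t ∈ Ico a b ∧ ¬ P t} with hB
  have hne : B.Nonempty := ⟨t₁, ht₁, hP⟩
  have hbdd : BddBelow B := ⟨a, fun t ht => ht.1.1⟩
  have hc1 : a ≤ sInf B := le_csInf hne fun t ht => ht.1.1
  have hc2 : sInf B ≤ t₁ := csInf_le hbdd ⟨ht₁, hP⟩
  obtain ⟨δ, hδ, hs⟩ := h (sInf B) ⟨hc1, hc2.trans_lt ht₁.2⟩ fun s hs => by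
    by_contra hn
    exact absurd (csInf_le hbdd ⟨⟨hs.1, hs.2.trans (hc2.trans_lt ht₁.2)⟩, hn⟩) (not_le.2 hs.2)
  obtain ⟨t, ht, hlt⟩ := exists_lt_of_csInf_lt hne (lt_add_of_pos_right (sInf B) hδ)
  exact ht.2 (hs t ⟨csInf_le hbdd ht, hlt⟩ ht.1.2)

/-- A locally antitone function on a closed interval is antitone. -/
theorem le_of_locally_antitone {f : ℝ → ℝ} {a b : ℝ} (hab : a ≤ b)
    (h : ∀ t ∈ Icc a b, ∃ δ > 0, ∀ t₁ ∈ Icc a b, ∀ t₂ ∈ Icc a b, |t₁ - t| < δ → |t₂ - t| < δ →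
      t₁ ≤ t₂ → f t₂ ≤ f t₁) : f b ≤ f a := by
  -- The interval is prolonged to `b + 1` so that the half-open induction reaches `b` itself.
  have := real_induction_Ico (P := fun t => t ≤ b → f t ≤ f a) (a := a) (b := b + 1) ?_ b
    ⟨hab, by linarith⟩ le_rfl
  · exact this
  intro t ht hs
  rcases lt_or_ge b t with hbt | htb
  · exact ⟨1, one_pos, fun s hs _ hsb => absurd (hbt.trans_le hs.1) (not_lt.2 hsb)⟩
  obtain ⟨δ, hδ, hd⟩ := h t ⟨ht.1, htb⟩
  refine ⟨δ, hδ, fun s hst _ hsb => ?_⟩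
  have hs' : |s - t| < δ := by rw [abs_of_nonneg (by linarith [hst.1])]; linarith [hst.2]
  rcases ht.1.eq_or_lt with rfl | hat
  · exact hd a ⟨le_rfl, hab⟩ s ⟨hst.1, hsb⟩ (by simpa) hs' hst.1
  · have hm1 : max a (t - δ / 2) < t := max_lt hat (by linarith)
    have h1 := hs (max a (t - δ / 2)) ⟨le_max_left _ _, hm1⟩ (hm1.le.trans htb)
    refine (hd _ ⟨le_max_left _ _, hm1.le.trans htb⟩ s ⟨ht.1.trans hst.1, hsb⟩ ?_ hs'
      (hm1.le.trans hst.1)).trans h1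
    rw [abs_of_neg (by linarith)]
    linarith [le_max_right a (t - δ / 2)]

variable {M : Type*} [MetricSpace M]

/-- The distance is the infimum of the lengths of paths. -/
def IsLengthSpace (M : Type*) [MetricSpace M] : Prop :=
  ∀ x y : M, ∀ L > dist x y, ∃ γ : ℝ → M,
    ContinuousOn γ (Icc 0 1) ∧ γ 0 = x ∧ γ 1 = y ∧ eVariationOn γ (Icc 0 1) ≤ ENNReal.ofReal L

/-- The variation up to time `t` plays the role of arc length along a path that is only continuous.
-/
theorem dist_le_variation {γ : ℝ → M} {L : ℝ} (hL : 0 ≤ L)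
    (hγ : eVariationOn γ (Icc 0 1) ≤ ENNReal.ofReal L) {s t : ℝ} (h0 : 0 ≤ s) (hst : s ≤ t)
    (h1 : t ≤ 1) :
    dist (γ s) (γ t) ≤ (eVariationOn γ (Icc 0 t)).toReal - (eVariationOn γ (Icc 0 s)).toReal ∧
      (eVariationOn γ (Icc 0 t)).toReal ≤ L := by
  have hadd := eVariationOn.Icc_add_Icc γ (s := univ) h0 hst (mem_univ _)
  simp only [univ_inter] at hadd
  have hle : eVariationOn γ (Icc 0 t) ≤ ENNReal.ofReal L :=
    (eVariationOn.mono γ (Icc_subset_Icc_right h1)).trans hγ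
  have hfin : eVariationOn γ (Icc 0 t) ≠ ⊤ := ne_top_of_le_ne_top ENNReal.ofReal_ne_top hle
  have hf1 : eVariationOn γ (Icc 0 s) ≠ ⊤ :=
    ne_top_of_le_ne_top hfin (hadd ▸ le_self_add)
  have hf2 : eVariationOn γ (Icc s t) ≠ ⊤ := ne_top_of_le_ne_top hfin (hadd ▸ le_add_self)
  constructor
  · rw [← hadd, ENNReal.toReal_add hf1 hf2, add_sub_cancel_left, dist_edist]
    exact ENNReal.toReal_mono hf2 (eVariationOn.edist_le γ ⟨le_rfl, hst⟩ ⟨hst, le_rfl⟩)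
  · exact (ENNReal.toReal_mono ENNReal.ofReal_ne_top hle).trans (ENNReal.toReal_ofReal hL).le

theorem IsLengthSpace.exists_between (hM : IsLengthSpace M) {x y : M} {a b : ℝ} (ha : 0 < a)
    (hb : 0 < b) (h : dist x y < a + b) : ∃ w, dist x w < a ∧ dist w y < b := by
  obtain ⟨L, hL1, hL2⟩ := _root_.exists_between h
  have hL0 : 0 ≤ L := dist_nonneg.trans hL1.le
  obtain ⟨γ, hγ, rfl, rfl, hv⟩ := hM x y L hL1
  -- Since `L - b < a' < a`, a point of the path at distance `a'` from its origin leaves less than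
  -- `b` of the length `L`.
  obtain ⟨a', ha1, ha2⟩ := _root_.exists_between (max_lt ha (sub_lt_iff_lt_add.2 hL2))
  have ha0 := (le_max_left _ _).trans ha1.le
  rcases le_or_gt (dist (γ 0) (γ 1)) a' with hc | hc
  · exact ⟨γ 1, hc.trans_lt ha2, by simpa using hb⟩
  have hcont : ContinuousOn (fun t => dist (γ 0) (γ t)) (Icc 0 1) :=
    (continuous_const.dist continuous_id).comp_continuousOn hγ
  obtain ⟨t, ht, he⟩ := intermediate_value_Icc zero_le_one hcont
    (show a' ∈ Icc (dist (γ 0) (γ 0)) (dist (γ 0) (γ 1)) from ⟨by simpa using ha0, hc.le⟩)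
  refine ⟨γ t, by simpa only [he] using ha2, ?_⟩
  have h1 := dist_le_variation hL0 hv le_rfl ht.1 ht.2
  have h2 := dist_le_variation hL0 hv ht.1 ht.2 le_rfl
  have h3 : (eVariationOn γ (Icc 0 0)).toReal = 0 := by simp
  have h4 := (le_max_right _ _).trans_lt ha1
  simp only at he
  linarith [h1.1, h2.1, h2.2]

end Paths

/-! ### Embedded tubes: the radius is the distance from the core -/

section Tube

variable {M : Type*} [MetricSpace M]

/-- `φ` parametrizes an embedded tube of radius `ρ` about `S`. -/
def IsTubeMap (φ : BranchedPoint → M) (S : Set M) (α ℓ τ ρ : ℝ) : Prop :=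
  φ '' {p | p.r = 0} = S ∧
  φ '' {p | p.r < ρ} = Metric.thickening ρ S ∧
  (∀ p q : BranchedPoint, p.r < ρ → q.r < ρ → φ p = φ q → tubeDist α ℓ τ p q = 0) ∧
  ∀ p : BranchedPoint, p.r < ρ → ∃ δ > 0,
    φ '' {q | q.r < ρ ∧ tubeDist α ℓ τ p q < δ} = Metric.ball (φ p) δ ∧
    ∀ q q' : BranchedPoint, q.r < ρ → q'.r < ρ →
      tubeDist α ℓ τ p q < δ → tubeDist α ℓ τ p q' < δ →
        dist (φ q) (φ q') = tubeDist α ℓ τ q q'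

variable {φ : BranchedPoint → M} {S : Set M} {α ℓ τ ρ : ℝ}

theorem tubeDist_self (p : BranchedPoint) : tubeDist α ℓ τ p p = 0 :=
  le_antisymm ((tubeDist_le_branchedDist _ _ _ _ _).trans (branchedDist_self p).le)
    (tubeDist_nonneg _ _ _ _ _)

theorem IsTubeMap.nonempty (h : IsTubeMap φ S α ℓ τ ρ) : S.Nonempty :=
  ⟨φ ⟨0, 0, 0, le_rfl⟩, h.1 ▸ mem_image_of_mem φ rfl⟩

theorem IsTubeMap.mem_of_r_eq_zero (h : IsTubeMap φ S α ℓ τ ρ) {p : BranchedPoint}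
    (hp : p.r = 0) : φ p ∈ S := h.1 ▸ mem_image_of_mem φ hp

theorem IsTubeMap.translate (h : IsTubeMap φ S α ℓ τ ρ) {p : BranchedPoint} (hp : p.r < ρ)
    {g : ℝ × ℝ} (hg : g ∈ tubeGroup α ℓ τ) : φ (p.translate g) = φ p := by
  obtain ⟨δ, hδ, -, hd⟩ := h.2.2.2 p hp
  have h0 := tubeDist_translate p hg
  have := hd p (p.translate g) hp hp (by rwa [tubeDist_self]) (by rwa [h0])
  rw [h0] at this
  exact (dist_eq_zero.1 this).symm

theorem IsTubeMap.r_eq (h : IsTubeMap φ S α ℓ τ ρ) {p q : BranchedPoint} (hp : p.r < ρ)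
    (hq : q.r < ρ) (he : φ p = φ q) : p.r = q.r := by
  have := abs_sub_r_le_tubeDist α ℓ τ p q
  rw [h.2.2.1 p q hp hq he] at this
  exact sub_eq_zero.1 (abs_nonpos_iff.1 this)

theorem IsTubeMap.dist_core_le (h : IsTubeMap φ S α ℓ τ ρ) {p : BranchedPoint} (hp : p.r < ρ) :
    infDist (φ p) S ≤ p.r := by
  let P : ℝ → BranchedPoint := fun t => ⟨|t|, p.θ, p.ζ, abs_nonneg t⟩
  have hPr : ∀ t, 0 ≤ t → (P t).r = t := fun t ht => abs_of_nonneg ht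
  have hray : ∀ s t, 0 ≤ s → 0 ≤ t → tubeDist α ℓ τ (P s) (P t) ≤ |s - t| := fun s t hs ht => by
    refine (tubeDist_le_branchedDist _ _ _ _ _).trans ?_
    rw [branchedDist_ray (P s) (P t) rfl, hPr s hs, hPr t ht]
  have key := le_of_locally_antitone (f := fun t => dist (φ (P 0)) (φ (P t)) - t) p.r_nonneg ?_
  · simp only [dist_self, sub_zero] at key
    have hP : P p.r = p := by simp [P, abs_of_nonneg p.r_nonneg]
    rw [hP] at key
    refine (infDist_le_dist_of_mem (h.mem_of_r_eq_zero (hPr 0 le_rfl))).trans ?_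
    rw [dist_comm]; linarith
  intro t ht
  obtain ⟨δ, hδ, -, hd⟩ := h.2.2.2 (P t) (by rw [hPr t ht.1]; exact ht.2.trans_lt hp)
  refine ⟨δ, hδ, fun t₁ ht₁ t₂ ht₂ h1 h2 h12 => ?_⟩
  have := hd (P t₁) (P t₂) (by rw [hPr _ ht₁.1]; exact ht₁.2.trans_lt hp)
    (by rw [hPr _ ht₂.1]; exact ht₂.2.trans_lt hp)
    ((hray _ _ ht.1 ht₁.1).trans_lt (by rwa [abs_sub_comm]))
    ((hray _ _ ht.1 ht₂.1).trans_lt (by rwa [abs_sub_comm]))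
  have h3 := hray _ _ ht₁.1 ht₂.1
  rw [abs_sub_comm, abs_of_nonneg (by linarith : 0 ≤ t₂ - t₁), ← this] at h3
  linarith [dist_triangle (φ (P 0)) (φ (P t₁)) (φ (P t₂))]

/-- A path to the core shorter than `p.r` would remain in the tube. There the radial coordinate is a
well-defined function, since `φ` is injective modulo the group, and it is locally 1-Lipschitz; so it
cannot drop to `0` along such a path. -/
theorem IsTubeMap.le_dist_core (hM : IsLengthSpace M) (h : IsTubeMap φ S α ℓ τ ρ)
    {p : BranchedPoint} (hp : p.r < ρ) : p.r ≤ infDist (φ p) S := by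
  by_contra! hc
  obtain ⟨s, hs, hd⟩ := (infDist_lt_iff h.nonempty).1 hc
  obtain ⟨L, hL1, hL2⟩ := _root_.exists_between hd
  have hL0 : 0 ≤ L := dist_nonneg.trans hL1.le
  obtain ⟨γ, hγ, hγ0, hγ1, hv⟩ := hM (φ p) s L hL1
  have hmem : ∀ t, ∃ q : BranchedPoint, t ∈ Icc (0 : ℝ) 1 → q.r < ρ ∧ φ q = γ t := by
    intro t
    by_cases ht : t ∈ Icc (0 : ℝ) 1
    · have : γ t ∈ thickening ρ S := by
        refine mem_thickening_iff.2 ⟨s, hs, ?_⟩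
        have h1 := dist_le_variation hL0 hv ht.1 ht.2 le_rfl
        have h2 : 0 ≤ (eVariationOn γ (Icc 0 t)).toReal := ENNReal.toReal_nonneg
        rw [← hγ1]
        linarith [h1.1, h1.2]
      rw [← h.2.1] at this
      obtain ⟨q, hq, he⟩ := this
      exact ⟨q, fun _ => ⟨hq, he⟩⟩
    · exact ⟨p, fun h => absurd h ht⟩
  choose Q hQ using hmem
  have key := le_of_locally_antitone (a := 0) (b := 1)
    (f := fun t => -(Q t).r - (eVariationOn γ (Icc 0 t)).toReal) zero_le_one ?_
  · have h0 := h.r_eq (hQ 0 (by simp)).1 hp ((hQ 0 (by simp)).2.trans hγ0)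
    have h1 : (Q 1).r = 0 := by
      obtain ⟨q, hq, hqs⟩ := h.1.symm ▸ hs
      have hq0 : q.r = 0 := hq
      rw [← hq0]
      refine h.r_eq (hQ 1 (by simp)).1 ?_ ((hQ 1 (by simp)).2.trans (hγ1.trans hqs.symm))
      rw [hq0]; exact p.r_nonneg.trans_lt hp
    have h2 := (dist_le_variation hL0 hv zero_le_one le_rfl le_rfl).2
    simp only [h0, h1, Icc_self, eVariationOn.subsingleton γ subsingleton_singleton,
      ENNReal.toReal_zero] at key
    linarith
  intro t ht
  obtain ⟨δ, hδ, himg, hdist⟩ := h.2.2.2 (Q t) (hQ t ht).1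
  rw [(hQ t ht).2] at himg
  obtain ⟨η, hη, hnear⟩ := Metric.continuousOn_iff.1 hγ t ht δ hδ
  refine ⟨η, hη, fun t₁ ht₁ t₂ ht₂ h1 h2 h12 => ?_⟩
  have hq : ∀ t', t' ∈ Icc (0 : ℝ) 1 → |t' - t| < η → ∃ q : BranchedPoint, q.r < ρ ∧
      tubeDist α ℓ τ (Q t) q < δ ∧ φ q = γ t' ∧ (Q t').r = q.r := by
    intro t' ht' hd'
    have : γ t' ∈ ball (γ t) δ := hnear t' ht' hd'
    rw [← himg] at this
    obtain ⟨q, hq, he⟩ := this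
    exact ⟨q, hq.1, hq.2, he, h.r_eq (hQ t' ht').1 hq.1 ((hQ t' ht').2.trans he.symm)⟩
  obtain ⟨q₁, hr₁, hd₁, he₁, hQ₁⟩ := hq t₁ ht₁ h1
  obtain ⟨q₂, hr₂, hd₂, he₂, hQ₂⟩ := hq t₂ ht₂ h2
  have h3 := hdist q₁ q₂ hr₁ hr₂ hd₁ hd₂
  have h4 := abs_sub_r_le_tubeDist α ℓ τ q₁ q₂
  rw [← h3, he₁, he₂] at h4
  have h5 := (dist_le_variation hL0 hv ht₁.1 h12 ht₂.2).1
  simp only [hQ₁, hQ₂]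
  linarith [(abs_le.1 h4).2]

theorem IsTubeMap.infDist_eq (hM : IsLengthSpace M) (h : IsTubeMap φ S α ℓ τ ρ)
    {p : BranchedPoint} (hp : p.r < ρ) : infDist (φ p) S = p.r :=
  le_antisymm (h.dist_core_le hp) (h.le_dist_core hM hp)

/-- The radius of the balls in the definition of a tube may be decreased. -/
theorem IsTubeMap.image_ball_eq (h : IsTubeMap φ S α ℓ τ ρ) {p : BranchedPoint} (hp : p.r < ρ) :
    ∃ δ > 0, ∀ δ' ≤ δ, φ '' {q | q.r < ρ ∧ tubeDist α ℓ τ p q < δ'} = Metric.ball (φ p) δ' ∧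
    ∀ q q' : BranchedPoint, q.r < ρ → q'.r < ρ →
      tubeDist α ℓ τ p q < δ' → tubeDist α ℓ τ p q' < δ' →
        dist (φ q) (φ q') = tubeDist α ℓ τ q q' := by
  obtain ⟨δ, hδ, himg, hd⟩ := h.2.2.2 p hp
  refine ⟨δ, hδ, fun δ' hδ' => ⟨?_, fun q q' hq hq' h1 h2 =>
    hd q q' hq hq' (h1.trans_le hδ') (h2.trans_le hδ')⟩⟩
  have hpp : tubeDist α ℓ τ p p < δ := by rwa [tubeDist_self]
  ext w
  constructor
  · rintro ⟨q, ⟨hq, hq'⟩, rfl⟩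
    rw [mem_ball, dist_comm, hd p q hp hq hpp (hq'.trans_le hδ')]
    exact hq'
  · intro hw
    obtain ⟨q, ⟨hq, hq'⟩, rfl⟩ := himg.symm ▸ ball_subset_ball hδ' hw
    rw [mem_ball, dist_comm, hd p q hp hq hpp hq'] at hw
    exact ⟨q, ⟨hq, hw⟩, rfl⟩

/-- The point is that the image is exactly the smaller neighbourhood of `S`; this needs the
identification of `r` with the distance from the core. -/
theorem IsTubeMap.mono (hM : IsLengthSpace M) (h : IsTubeMap φ S α ℓ τ ρ) {ρ' : ℝ}
    (hρ : ρ' ≤ ρ) : IsTubeMap φ S α ℓ τ ρ' := by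
  refine ⟨h.1, ?_, fun p q hp hq => h.2.2.1 p q (hp.trans_le hρ) (hq.trans_le hρ),
    fun p hp => ?_⟩
  · ext w
    rw [mem_thickening_iff_infDist_lt h.nonempty]
    constructor
    · rintro ⟨p, hp, rfl⟩
      rw [h.infDist_eq hM (lt_of_lt_of_le hp hρ)]
      exact hp
    · intro hw
      have : w ∈ thickening ρ S :=
        (mem_thickening_iff_infDist_lt h.nonempty).2 (hw.trans_le hρ)
      rw [← h.2.1] at this
      obtain ⟨p, hp, rfl⟩ := this
      rw [h.infDist_eq hM hp] at hw
      exact ⟨p, hw, rfl⟩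
  · obtain ⟨δ, hδ, hd⟩ := h.image_ball_eq (hp.trans_le hρ)
    refine ⟨min δ (ρ' - p.r), lt_min hδ (sub_pos.2 hp), ?_, fun q q' hq hq' =>
      (hd _ (min_le_left _ _)).2 q q' (hq.trans_le hρ) (hq'.trans_le hρ)⟩
    rw [← (hd _ (min_le_left _ _)).1]
    congr 1
    ext q
    refine and_congr_left fun hq => ⟨fun h => h.trans_le hρ, fun _ => ?_⟩
    have h1 := (abs_sub_r_le_tubeDist α ℓ τ p q).trans_lt (hq.trans_le (min_le_right _ _))
    linarith [(abs_lt.1 h1).1]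

/-- The map `Φ`, in cylindrical coordinates, is a local isometry at the point at distance `r` from
the axis in the direction `u`. -/
def LocIsoAt (Φ : ℝ → ℝ × ℝ → M) (r : ℝ) (u : ℝ × ℝ) : Prop :=
  ∃ δ > 0, ∃ Ψ : HypSpace → M, IsoOn Ψ (cyl r u) δ ∧ ∀ r' v, 0 ≤ r' → |v.1 - u.1| ≤ 1 →
    cyl r' v ∈ ball (cyl r u) δ → Ψ (cyl r' v) = Φ r' v

/-- A map of the branched cover as a function of cylindrical coordinates. -/
def cylCoord {N : Type*} (φ : BranchedPoint → N) (r : ℝ) (u : ℝ × ℝ) : N :=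
  φ ⟨|r|, u.1, u.2, abs_nonneg r⟩

theorem cylCoord_apply {N : Type*} (φ : BranchedPoint → N) (p : BranchedPoint) :
    cylCoord φ p.r p.dir = φ p := by
  simp [cylCoord, BranchedPoint.dir, abs_of_nonneg p.r_nonneg]

theorem abs_fst_le_norm (v : ℝ × ℝ) : |v.1| ≤ ‖v‖ := by
  rw [Prod.norm_def]; exact le_max_left _ _

/-- Off the axis, a small hyperbolic ball lifts to the branched cover by choosing angles within `π`
of `u.1`, and on it the distances of hyperbolic space, of the cover and of the quotient tube
coincide. -/
theorem IsTubeMap.locIsoAt (hα : 0 < α) (hℓ : 0 < ℓ) (h : IsTubeMap φ S α ℓ τ ρ) {r : ℝ}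
    {u : ℝ × ℝ} (hr : 0 < r) (hrρ : r < ρ) : LocIsoAt (cylCoord φ) r u := by
  have hr2 := half_pos hr
  have hpi := Real.pi_gt_three
  obtain ⟨η, hη, δ₁, hδ₁, htube⟩ := exists_tubeDist_eq_branchedDist hα hℓ τ hr2
  -- Two directions within `η'` of `u` differ by less than `η`, as `htube` requires, and by less
  -- than `1`, which keeps the angles on one branch.
  set η' := min (η / 2) (1 / 2) with hη'
  have hη'0 : 0 < η' := lt_min (by positivity) (by norm_num)
  obtain ⟨δ₂, hδ₂, hdir⟩ := exists_branchedDist_imp_dir hr2 hη'0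
  let p₀ : BranchedPoint := ⟨r, u.1, u.2, hr.le⟩
  obtain ⟨δ₃, hδ₃, hloc⟩ := h.image_ball_eq (p := p₀) hrρ
  obtain ⟨δ, hδ, hd1, hd2, hd3, hd4⟩ : ∃ δ > 0, δ ≤ δ₁ / 2 ∧ δ ≤ δ₂ ∧ δ ≤ δ₃ ∧
      δ ≤ min (r / 2) (ρ - r) :=
    ⟨min (min (δ₁ / 2) δ₂) (min δ₃ (min (r / 2) (ρ - r))),
      lt_min (lt_min (by positivity) hδ₂) (lt_min hδ₃ (lt_min hr2 (by linarith))),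
      (min_le_left _ _).trans (min_le_left _ _), (min_le_left _ _).trans (min_le_right _ _),
      (min_le_right _ _).trans (min_le_left _ _), (min_le_right _ _).trans (min_le_right _ _)⟩
  have hd5 := hd4.trans (min_le_left _ _)
  have hd6 := hd4.trans (min_le_right _ _)
  have hnear : ∀ q : BranchedPoint, branchedDist p₀ q < δ →
      r / 2 ≤ q.r ∧ q.r < ρ ∧ ‖p₀.dir - q.dir‖ < η' := fun q hq => by
    have h1 := (abs_lt.1 ((abs_sub_r_le_branchedDist p₀ q).trans_lt hq))
    have e : p₀.r = r := rfl
    have h2 : r / 2 ≤ q.r := by linarith [h1.1, h1.2]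
    exact ⟨h2, by linarith [h1.1], hdir p₀ q (by linarith) h2 (hq.trans_le hd2)⟩
  have hbd : ∀ (r' : ℝ) (v : ℝ × ℝ) (h0 : 0 ≤ r'), |v.1 - u.1| ≤ Real.pi →
      branchedDist p₀ ⟨r', v.1, v.2, h0⟩ = dist (cyl r' v) (cyl r u) := fun r' v h0 hv => by
    rw [dist_comm, branchedDist_eq_dist (by rw [abs_sub_comm]; exact hv)]
    rfl
  choose R V hR hV hRV using fun x => exists_eq_cyl x u.1
  let q : HypSpace → BranchedPoint := fun x => ⟨R x, (V x).1, (V x).2, hR x⟩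
  have hq : ∀ x ∈ ball (cyl r u) δ, branchedDist p₀ (q x) < δ := fun x hx => by
    rw [hbd _ _ (hR x) (hV x), ← hRV x]; exact hx
  have hqφ : ∀ x, cylCoord φ (R x) (V x) = φ (q x) := fun x => cylCoord_apply φ (q x)
  have hmatch : ∀ r' v, 0 ≤ r' → |v.1 - u.1| ≤ Real.pi → cyl r' v ∈ ball (cyl r u) δ →
      r' = R (cyl r' v) ∧ v = V (cyl r' v) := by
    intro r' v hr' hv hmem
    have h1 := hnear _ (hq _ hmem)
    have h2 := hnear ⟨r', v.1, v.2, hr'⟩ (by rw [hbd r' v hr' hv]; exact hmem)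
    refine cyl_injective (hr2.trans_le h2.1) (hR _) ?_ (hRV _)
    have h3 : ‖v - V (cyl r' v)‖ < 1 := by
      have e : v - V (cyl r' v) = (p₀.dir - (q (cyl r' v)).dir) - (p₀.dir - v) := by
        change _ = (p₀.dir - V (cyl r' v)) - _
        abel
      rw [e]
      have h4 := norm_sub_le (p₀.dir - (q (cyl r' v)).dir) (p₀.dir - v)
      have h5 : ‖p₀.dir - v‖ < η' := h2.2.2
      linarith [h1.2.2, min_le_right (η / 2) (1 / 2 : ℝ)]
    have h4 := abs_fst_le_norm (v - V (cyl r' v))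
    have h5 : |v.1 - (V (cyl r' v)).1| ≤ ‖v - V (cyl r' v)‖ := h4
    linarith
  have hdist : ∀ x ∈ ball (cyl r u) δ, ∀ y ∈ ball (cyl r u) δ,
      dist (φ (q x)) (φ (q y)) = dist x y := by
    intro x hx y hy
    have hx1 := hnear _ (hq x hx)
    have hy1 := hnear _ (hq y hy)
    have hxy : ‖(q x).dir - (q y).dir‖ < 2 * η' := by
      have e : (q x).dir - (q y).dir = (p₀.dir - (q y).dir) - (p₀.dir - (q x).dir) := by abel
      rw [e]
      linarith [norm_sub_le (p₀.dir - (q y).dir) (p₀.dir - (q x).dir), hx1.2.2, hy1.2.2]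
    have hb : branchedDist (q x) (q y) = dist x y := by
      rw [branchedDist_eq_dist]
      · conv_rhs => rw [hRV x, hRV y]
        rfl
      · have h4 : |(q x).θ - (q y).θ| ≤ ‖(q x).dir - (q y).dir‖ :=
          abs_fst_le_norm ((q x).dir - (q y).dir)
        linarith [min_le_right (η / 2) (1 / 2 : ℝ)]
    rw [(hloc δ hd3).2 (q x) (q y) hx1.2.1 hy1.2.1
      ((tubeDist_le_branchedDist _ _ _ _ _).trans_lt (hq x hx))
      ((tubeDist_le_branchedDist _ _ _ _ _).trans_lt (hq y hy)), ← hb]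
    apply htube _ _ hx1.1 hy1.1
    · linarith [min_le_left (η / 2) (1 / 2 : ℝ)]
    · rw [hb]
      rw [mem_ball] at hx hy
      linarith [dist_triangle_right x y (cyl r u)]
  have hcenter : φ (q (cyl r u)) = φ p₀ := by
    have h1 := hmatch r u hr.le (by simp; linarith) (mem_ball_self hδ)
    rw [← hqφ, ← h1.1, ← h1.2]
    exact cylCoord_apply φ p₀
  refine ⟨δ, hδ, fun x => φ (q x), ⟨hdist, ?_⟩, fun r' v hr' hv hmem => ?_⟩
  · simp only [hcenter]
    ext w
    constructor
    · rintro ⟨x, hx, rfl⟩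
      change φ (q x) ∈ _
      rw [mem_ball, ← hcenter, hdist x hx _ (mem_ball_self hδ)]
      exact hx
    · intro hw
      rw [← (hloc δ hd3).1] at hw
      obtain ⟨p, ⟨hp1, hp2⟩, rfl⟩ := hw
      obtain ⟨g, hg, hp3⟩ := exists_branchedDist_lt_of_tubeDist_lt hp2
      have h1 := hnear _ hp3
      have h2 : |(p.translate g).dir.1 - u.1| ≤ Real.pi := by
        have h4 : |p₀.dir.1 - (p.translate g).dir.1| ≤ ‖p₀.dir - (p.translate g).dir‖ :=
          abs_fst_le_norm (p₀.dir - (p.translate g).dir)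
        rw [abs_sub_comm] at h4
        refine h4.trans ?_
        linarith [h1.2.2, min_le_right (η / 2) (1 / 2 : ℝ)]
      have hmem : cyl p.r (p.translate g).dir ∈ ball (cyl r u) δ := by
        rw [mem_ball, ← hbd p.r (p.translate g).dir p.r_nonneg h2]
        exact hp3
      refine ⟨cyl p.r (p.translate g).dir, hmem, ?_⟩
      have h3 := hmatch _ _ p.r_nonneg h2 hmem
      change φ (q _) = _
      rw [← hqφ, ← h3.1, ← h3.2]
      have := cylCoord_apply φ (p.translate g)
      rw [← h.translate hp1 hg, ← this]
      rfl
  · have h3 := hmatch _ _ hr' (by linarith) hmem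
    change φ (q _) = _
    rw [← hqφ, ← h3.1, ← h3.2]

end Tube

/-! ### Local isometries in cylindrical coordinates -/

section LocIsoAt

theorem exists_box_subset_ball (r : ℝ) (u : ℝ × ℝ) {ε : ℝ} (hε : 0 < ε) :
    ∃ η > 0, ∀ r' v, |r' - r| < η → ‖v - u‖ < η → cyl r' v ∈ ball (cyl r u) ε := by
  obtain ⟨η, hη, h⟩ := Metric.continuousAt_iff.1 (continuous_cyl.continuousAt (x := (r, u))) ε hε
  refine ⟨η, hη, fun r' v hr hv => h (x := (r', v)) ?_⟩
  rw [Prod.dist_eq, max_lt_iff, Real.dist_eq, dist_eq_norm]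
  exact ⟨hr, hv⟩

theorem exists_ball_subset_box {r : ℝ} (hr : 0 < r) (u : ℝ × ℝ) {η : ℝ} (hη : 0 < η) :
    ∃ δ > 0, ∀ r' v, 0 ≤ r' → |v.1 - u.1| ≤ Real.pi → cyl r' v ∈ ball (cyl r u) δ →
      |r' - r| < η ∧ ‖v - u‖ < η := by
  obtain ⟨δ, hδ, h⟩ := exists_dist_cyl_imp_dir (half_pos hr) hη
  refine ⟨min δ (min η (r / 2)), lt_min hδ (lt_min hη (half_pos hr)), fun r' v h0 hv hmem => ?_⟩
  have h1 := (abs_sub_le_dist_cyl h0 hr.le v u).trans_lt (mem_ball.1 hmem)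
  have h2 := h1.trans_le ((min_le_right _ _).trans (min_le_right _ _))
  refine ⟨h1.trans_le ((min_le_right _ _).trans (min_le_left _ _)),
    h r' r v u ?_ (by linarith) hv ((mem_ball.1 hmem).trans_le (min_le_left _ _))⟩
  linarith [(abs_lt.1 h2).1]

variable {M : Type*} [MetricSpace M]

theorem LocIsoAt.of_isoOn {Φ : ℝ → ℝ × ℝ → M} {r : ℝ} {u : ℝ × ℝ} (hr : 0 < r)
    {Ψ : HypSpace → M} {δ η : ℝ} (hδ : 0 < δ) (hη : 0 < η) (h : IsoOn Ψ (cyl r u) δ)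
    (he : ∀ r' v, |r' - r| < η → ‖v - u‖ < η → Ψ (cyl r' v) = Φ r' v) : LocIsoAt Φ r u := by
  obtain ⟨δ', hδ', h'⟩ := exists_ball_subset_box hr u hη
  refine ⟨min δ δ', lt_min hδ hδ', Ψ, h.mono (min_le_left _ _), fun r' v h0 hv hmem => ?_⟩
  have := h' r' v h0 (hv.trans (by linarith [Real.pi_gt_three]))
    (ball_subset_ball (min_le_right _ _) hmem)
  exact he r' v this.1 this.2

/-- Off the axis, small hyperbolic balls and small coordinate boxes contain one another once the
branch of the angle is fixed. This is the form in which local isometries are used below: it allows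
passing between balls and boxes. -/
theorem LocIsoAt.exists_isoOn {Φ : ℝ → ℝ × ℝ → M} {r : ℝ} {u : ℝ × ℝ} (hr : 0 < r)
    (h : LocIsoAt Φ r u) {ε : ℝ} (hε : 0 < ε) : ∃ δ > 0, δ ≤ ε ∧ ∃ Ψ : HypSpace → M,
      IsoOn Ψ (cyl r u) δ ∧ (∀ r' v, 0 ≤ r' → |v.1 - u.1| ≤ 1 → cyl r' v ∈ ball (cyl r u) δ →
        Ψ (cyl r' v) = Φ r' v ∧ |r' - r| < ε ∧ ‖v - u‖ < ε) ∧
      (∀ x ∈ ball (cyl r u) δ, ∃ r' v, 0 < r' ∧ |r' - r| < ε ∧ ‖v - u‖ < ε ∧ x = cyl r' v ∧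
        Ψ x = Φ r' v) ∧
      ∃ η > 0, ∀ r' v, |r' - r| < η → ‖v - u‖ < η →
        cyl r' v ∈ ball (cyl r u) δ ∧ Ψ (cyl r' v) = Φ r' v := by
  obtain ⟨δ, hδ, Ψ, hΨ, he⟩ := h
  obtain ⟨δ', hδ', h'⟩ := exists_ball_subset_box hr u
    (lt_min (lt_min hε one_pos) (half_pos hr))
  obtain ⟨η, hη, hbox⟩ := exists_box_subset_ball r u (lt_min (lt_min hδ hδ') hε)
  refine ⟨min (min δ δ') ε, lt_min (lt_min hδ hδ') hε, min_le_right _ _, Ψ,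
    hΨ.mono ((min_le_left _ _).trans (min_le_left _ _)), fun r' v h0 hv hmem => ?_, fun x hx => ?_,
    min η (min 1 (r / 2)), lt_min hη (lt_min one_pos (half_pos hr)), fun r' v h1 h2 => ?_⟩
  · have h1 := h' r' v h0 (hv.trans (by linarith [Real.pi_gt_three]))
      (ball_subset_ball ((min_le_left _ _).trans (min_le_right _ _)) hmem)
    exact ⟨he r' v h0 hv (ball_subset_ball ((min_le_left _ _).trans (min_le_left _ _)) hmem),
      h1.1.trans_le ((min_le_left _ _).trans (min_le_left _ _)),
      h1.2.trans_le ((min_le_left _ _).trans (min_le_left _ _))⟩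
  · obtain ⟨r', v, h0, hv, rfl⟩ := exists_eq_cyl x u.1
    have h1 := h' r' v h0 hv (ball_subset_ball ((min_le_left _ _).trans (min_le_right _ _)) hx)
    have hv1 : |v.1 - u.1| ≤ 1 := (abs_fst_le_norm (v - u)).trans
      (h1.2.le.trans ((min_le_left _ _).trans (min_le_right _ _)))
    refine ⟨r', v, ?_, h1.1.trans_le ((min_le_left _ _).trans (min_le_left _ _)),
      h1.2.trans_le ((min_le_left _ _).trans (min_le_left _ _)), rfl,
      he r' v h0 hv1 (ball_subset_ball ((min_le_left _ _).trans (min_le_left _ _)) hx)⟩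
    linarith [(abs_lt.1 (h1.1.trans_le (min_le_right _ _))).1]
  · have hb := hbox r' v (h1.trans_le (min_le_left _ _)) (h2.trans_le (min_le_left _ _))
    refine ⟨hb, he r' v ?_ ?_ (ball_subset_ball ((min_le_left _ _).trans (min_le_left _ _)) hb)⟩
    · linarith [(abs_lt.1 (h1.trans_le ((min_le_right _ _).trans (min_le_right _ _)))).1]
    · exact (abs_fst_le_norm (v - u)).trans
        (h2.le.trans ((min_le_right _ _).trans (min_le_left _ _)))

theorem LocIsoAt.congr {Φ Φ' : ℝ → ℝ × ℝ → M} {r : ℝ} {u : ℝ × ℝ} (hr : 0 < r)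
    (h : LocIsoAt Φ r u) {η : ℝ} (hη : 0 < η)
    (he : ∀ r' v, |r' - r| < η → ‖v - u‖ < η → Φ r' v = Φ' r' v) : LocIsoAt Φ' r u := by
  obtain ⟨δ, hδ, -, Ψ, hΨ, -, -, η', hη', hb⟩ := h.exists_isoOn hr one_pos
  exact LocIsoAt.of_isoOn hr hδ (lt_min hη hη') hΨ fun r' v h1 h2 => by
    rw [(hb r' v (h1.trans_le (min_le_right _ _)) (h2.trans_le (min_le_right _ _))).2,
      he r' v (h1.trans_le (min_le_left _ _)) (h2.trans_le (min_le_left _ _))]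

theorem LocIsoAt.eventually {Φ : ℝ → ℝ × ℝ → M} {r : ℝ} {u : ℝ × ℝ} (hr : 0 < r)
    (h : LocIsoAt Φ r u) :
    ∃ η > 0, ∀ r' v, |r' - r| < η → ‖v - u‖ < η → LocIsoAt Φ r' v := by
  obtain ⟨δ, hδ, -, Ψ, hΨ, -, -, η, hη, hb⟩ := h.exists_isoOn hr one_pos
  refine ⟨min (η / 2) (r / 2), lt_min (half_pos hη) (half_pos hr), fun r' v h1 h2 => ?_⟩
  have h1' := h1.trans_le (min_le_left _ _)
  have h2' := h2.trans_le (min_le_left _ _)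
  have hmem := (hb r' v (by linarith) (by linarith)).1
  refine LocIsoAt.of_isoOn (Ψ := Ψ) (δ := δ - dist (cyl r' v) (cyl r u)) (η := η / 2) ?_
    (sub_pos.2 hmem) (half_pos hη) (hΨ.recenter hmem le_rfl) fun r'' w h3 h4 => ?_
  · linarith [(abs_lt.1 (h1.trans_le (min_le_right _ _))).1]
  · refine (hb r'' w ?_ ?_).2
    · linarith [abs_sub_le r'' r' r]
    · have := norm_sub_le_norm_sub_add_norm_sub w v u
      linarith

theorem LocIsoAt.dist_ray_eq {Φ : ℝ → ℝ × ℝ → M} {r : ℝ} {u : ℝ × ℝ} (hr : 0 < r)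
    (h : LocIsoAt Φ r u) :
    ∃ η > 0, ∀ r₁ r₂, |r₁ - r| < η → |r₂ - r| < η → dist (Φ r₁ u) (Φ r₂ u) = |r₁ - r₂| := by
  obtain ⟨δ, hδ, -, Ψ, hΨ, -, -, η, hη, hb⟩ := h.exists_isoOn hr one_pos
  refine ⟨η, hη, fun r₁ r₂ h1 h2 => ?_⟩
  have h1' := hb r₁ u h1 (by simpa using hη)
  have h2' := hb r₂ u h2 (by simpa using hη)
  rw [← h1'.2, ← h2'.2, hΨ.1 _ h1'.1 _ h2'.1, dist_cyl_ray]

theorem LocIsoAt.continuousAt {Φ : ℝ → ℝ × ℝ → M} {r : ℝ} {u : ℝ × ℝ} (hr : 0 < r)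
    (h : LocIsoAt Φ r u) : ContinuousAt (fun p : ℝ × ℝ × ℝ => Φ p.1 p.2) (r, u) := by
  obtain ⟨δ, hδ, -, Ψ, hΨ, -, -, η, hη, hb⟩ := h.exists_isoOn hr one_pos
  have h1 : ContinuousAt (fun p : ℝ × ℝ × ℝ => Ψ (cyl p.1 p.2)) (r, u) :=
    ContinuousAt.comp (f := fun p : ℝ × ℝ × ℝ => cyl p.1 p.2) (hΨ.continuousAt hδ)
      continuous_cyl.continuousAt
  refine h1.congr ?_
  filter_upwards [Metric.ball_mem_nhds (r, u) hη] with p hp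
  rw [mem_ball, Prod.dist_eq, max_lt_iff, Real.dist_eq, dist_eq_norm] at hp
  exact (hb p.1 p.2 hp.1 hp.2).2

/-- A local isometry does not increase distances along a ray. -/
theorem dist_ray_le {Φ : ℝ → ℝ × ℝ → M} {a b : ℝ} {u : ℝ × ℝ} (ha : 0 < a) (hab : a ≤ b)
    (h : ∀ r ∈ Icc a b, LocIsoAt Φ r u) : dist (Φ a u) (Φ b u) ≤ b - a := by
  have := le_of_locally_antitone (f := fun t => dist (Φ a u) (Φ t u) - t) hab ?_
  · simp only [dist_self] at this; linarith
  intro t ht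
  obtain ⟨η, hη, hd⟩ := (h t ht).dist_ray_eq (ha.trans_le ht.1)
  refine ⟨η, hη, fun t₁ _ t₂ _ h1 h2 h12 => ?_⟩
  have h3 := hd t₁ t₂ h1 h2
  rw [abs_sub_comm, abs_of_nonneg (by linarith)] at h3
  linarith [dist_triangle (Φ a u) (Φ t₁ u) (Φ t₂ u)]

/-- Two local isometries along a ray which agree near its origin agree along the ray. -/
theorem LocIsoAt.eq_along_ray {Φ Φ' : ℝ → ℝ × ℝ → M} {a b : ℝ} {u : ℝ × ℝ} (ha : 0 < a)
    (h : ∀ r ∈ Icc a b, LocIsoAt Φ r u) (h' : ∀ r ∈ Icc a b, LocIsoAt Φ' r u)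
    (hinit : ∃ η > 0, ∀ r v, |r - a| < η → ‖v - u‖ < η → Φ r v = Φ' r v) :
    ∀ r ∈ Icc a b, Φ r u = Φ' r u := by
  -- Agreement is propagated on full neighbourhoods of the points of the ray, since rigidity needs
  -- an open set.
  have key := real_induction_Ico (a := a) (b := b + 1) (P := fun t => t ≤ b →
    ∃ η > 0, ∀ r v, |r - t| < η → ‖v - u‖ < η → Φ r v = Φ' r v) ?_
  · intro r hr
    obtain ⟨η, hη, hP⟩ := key r ⟨hr.1, by linarith [hr.2]⟩ hr.2
    exact hP r u (by simpa using hη) (by simpa using hη)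
  intro t ht hs
  rcases lt_or_ge b t with hbt | htb
  · exact ⟨1, one_pos, fun s hs _ hsb => absurd (hbt.trans_le hs.1) (not_lt.2 hsb)⟩
  suffices hmain : ∃ η > 0, ∀ r v, |r - t| < η → ‖v - u‖ < η → Φ r v = Φ' r v by
    obtain ⟨η, hη, hP⟩ := hmain
    refine ⟨η / 2, half_pos hη, fun s hst _ _ => ⟨η / 2, half_pos hη, fun r v h1 h2 => ?_⟩⟩
    refine hP r v ?_ (by linarith)
    have : |s - t| < η / 2 := by
      rw [abs_of_nonneg (by linarith [hst.1])]; linarith [hst.2]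
    linarith [abs_sub_le r s t]
  rcases ht.1.eq_or_lt with rfl | hat
  · exact hinit
  have ht0 : 0 < t := ha.trans hat
  obtain ⟨δ, hδ, -, Ψ, hΨ, -, -, η, hη, hb⟩ := (h t ⟨ht.1, htb⟩).exists_isoOn ht0 one_pos
  obtain ⟨δ', hδ', -, Ψ', hΨ', -, -, η', hη', hb'⟩ := (h' t ⟨ht.1, htb⟩).exists_isoOn ht0 one_pos
  have hΨm := hΨ.mono (min_le_left δ δ')
  have hΨm' := hΨ'.mono (min_le_right δ δ')
  set ε := min (min η η') (min δ δ') with hεdef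
  have hε : 0 < ε := lt_min (lt_min hη hη') (lt_min hδ hδ')
  have hε1 : ε ≤ η := (min_le_left _ _).trans (min_le_left _ _)
  have hε2 : ε ≤ η' := (min_le_left _ _).trans (min_le_right _ _)
  have hε3 : ε ≤ min δ δ' := min_le_right _ _
  have hu : ∀ {e : ℝ}, 0 < e → ‖u - u‖ < e := fun he => by simpa using he
  have hnear : ∀ r, a ≤ r → t - ε < r → r < t → Ψ (cyl r u) = Ψ' (cyl r u) := by
    intro r har h1 h2
    have hr : |r - t| < ε := by rw [abs_of_neg (by linarith)]; linarith
    obtain ⟨η₀, hη₀, hP⟩ := hs r ⟨har, h2⟩ (h2.le.trans htb)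
    rw [(hb r u (hr.trans_le hε1) (hu hη)).2, (hb' r u (hr.trans_le hε2) (hu hη')).2]
    exact hP r u (by simpa using hη₀) (hu hη₀)
  have hcenter : Ψ (cyl t u) = Ψ' (cyl t u) := by
    rw [← dist_le_zero]
    refine le_of_forall_pos_le_add fun e he => ?_
    rw [zero_add]
    set r := max a (t - min (e / 2) (ε / 2)) with hr
    have hm : 0 < min (e / 2) (ε / 2) := lt_min (by positivity) (by positivity)
    have h1 : r < t := max_lt hat (by linarith)
    have h2 : t - min (e / 2) (ε / 2) ≤ r := le_max_right _ _
    have h3 := min_le_left (e / 2) (ε / 2)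
    have h4 := min_le_right (e / 2) (ε / 2)
    have h5 := hnear r (le_max_left _ _) (by linarith) h1
    have hd : dist (cyl r u) (cyl t u) = t - r := by
      rw [dist_cyl_ray, abs_of_neg (by linarith)]; ring
    have hmem : cyl r u ∈ ball (cyl t u) (min δ δ') := by rw [mem_ball, hd]; linarith
    have h6 := hΨm.dist_center hmem
    have h7 := hΨm'.dist_center hmem
    rw [h5] at h6
    have := dist_triangle_left (Ψ (cyl t u)) (Ψ' (cyl t u)) (Ψ' (cyl r u))
    linarith
  set r := max a (t - ε / 2) with hr
  have h1 : r < t := max_lt hat (by linarith)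
  have h2 : t - ε / 2 ≤ r := le_max_right _ _
  have hrt : |r - t| ≤ ε / 2 := by rw [abs_of_neg (by linarith)]; linarith
  obtain ⟨η₀, hη₀, hP⟩ := hs r ⟨le_max_left _ _, h1⟩ (h1.le.trans htb)
  have hr0 : 0 < r := ha.trans_le (le_max_left _ _)
  obtain ⟨δ₀, hδ₀, hball⟩ := exists_ball_subset_box hr0 u (lt_min hη₀ (half_pos hε))
  have hagree : ∀ q ∈ ball (cyl r u) δ₀, Ψ q = Ψ' q := by
    intro q hq
    obtain ⟨r', v, h0, hv, rfl⟩ := exists_eq_cyl q u.1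
    obtain ⟨h3, h4⟩ := hball r' v h0 hv hq
    have h5 : |r' - t| < ε := by
      have := h3.trans_le (min_le_right _ _)
      linarith [abs_sub_le r' r t]
    have h6 : ‖v - u‖ < ε := by
      have := h4.trans_le (min_le_right _ _)
      linarith
    rw [(hb r' v (h5.trans_le hε1) (h6.trans_le hε1)).2,
      (hb' r' v (h5.trans_le hε2) (h6.trans_le hε2)).2]
    exact hP r' v (h3.trans_le (min_le_left _ _)) (h4.trans_le (min_le_left _ _))
  have hmem : cyl r u ∈ ball (cyl t u) (min δ δ') := by
    rw [mem_ball, dist_cyl_ray]; linarith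
  -- The centres agree by passing to the limit along the ray, and the maps agree near an earlier ray
  -- point inside the common ball.
  have hall := hΨm.eqOn_of_eqOn_ball hΨm' hcenter hmem hδ₀ hagree
  obtain ⟨η₁, hη₁, hbox⟩ := exists_box_subset_ball t u (lt_min hδ hδ')
  refine ⟨min η₁ ε, lt_min hη₁ hε, fun r' v h3 h4 => ?_⟩
  rw [← (hb r' v ((h3.trans_le (min_le_right _ _)).trans_le hε1)
      ((h4.trans_le (min_le_right _ _)).trans_le hε1)).2,
    ← (hb' r' v ((h3.trans_le (min_le_right _ _)).trans_le hε2)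
      ((h4.trans_le (min_le_right _ _)).trans_le hε2)).2]
  exact hall _ (hbox r' v (h3.trans_le (min_le_left _ _)) (h4.trans_le (min_le_left _ _)))

/-- Translations of the coordinates `(θ, ζ)` are isometries of hyperbolic space. -/
theorem exists_isometryEquiv_translate (g : ℝ × ℝ) (x : HypSpace) (δ : ℝ) :
    ∃ A : HypSpace ≃ᵢ HypSpace, ∀ r v, cyl r v ∈ ball x δ → A (cyl r v) = cyl r (v + g) := by
  rcases le_or_gt δ 0 with h0 | hδ
  · exact ⟨IsometryEquiv.refl _, fun r v h => by simp [ball_eq_empty.2 h0] at h⟩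
  choose R V hR hV hRV using fun x => exists_eq_cyl x 0
  have hd : ∀ r r' u v, dist (cyl r (u + g)) (cyl r' (v + g)) = dist (cyl r u) (cyl r' v) := by
    intro r r' u v
    refine Real.cosh_injOn (mem_Ici.2 dist_nonneg) (mem_Ici.2 dist_nonneg) ?_
    rw [cosh_dist_cyl, cosh_dist_cyl]
    simp
  obtain ⟨A, hA⟩ := HypSpace.exists_isometryEquiv_extends (x := x) hδ
    (f := fun y => cyl (R y) (V y + g)) fun p _ q _ => by rw [hd, ← hRV, ← hRV]
  refine ⟨A, fun r v h => ?_⟩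
  rw [hA _ h, ← dist_eq_zero, hd, ← hRV, dist_self]

theorem LocIsoAt.translate {Φ : ℝ → ℝ × ℝ → M} {r : ℝ} {u : ℝ × ℝ} (hr : 0 < r) (g : ℝ × ℝ)
    (h : LocIsoAt Φ r (u + g)) : LocIsoAt (fun r v => Φ r (v + g)) r u := by
  obtain ⟨δ, hδ, -, Ψ, hΨ, -, -, η, hη, hb⟩ := h.exists_isoOn hr one_pos
  obtain ⟨A, hA⟩ := exists_isometryEquiv_translate g (cyl r u) 1
  obtain ⟨η', hη', hbox⟩ := exists_box_subset_ball r u one_pos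
  refine LocIsoAt.of_isoOn hr (Ψ := Ψ ∘ A) hδ (lt_min hη hη') ?_ fun r' v h1 h2 => ?_
  · apply IsoOn.comp_isometryEquiv
    rwa [hA r u (mem_ball_self one_pos)]
  · rw [Function.comp_apply, hA r' v (hbox r' v (h1.trans_le (min_le_right _ _))
      (h2.trans_le (min_le_right _ _)))]
    exact (hb r' (v + g) (h1.trans_le (min_le_left _ _)) (by
      rw [add_sub_add_right_eq_sub]; exact h2.trans_le (min_le_left _ _))).2

end LocIsoAt

/-! ### Continuing the normal exponential map to distance `2R` -/

section Development

variable {M : Type*} [MetricSpace M]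

/-- `Φ` continues the map `Φ₀`, given near the ray point at distance `a` in the direction `u`, as
a local isometry along the ray up to the distance `s`. -/
def ContinuesTo (Φ₀ Φ : ℝ → ℝ × ℝ → M) (a : ℝ) (u : ℝ × ℝ) (s : ℝ) : Prop :=
  (∀ r ∈ Icc a s, LocIsoAt Φ r u) ∧
    ∃ η > 0, ∀ r v, |r - a| < η → ‖v - u‖ < η → Φ r v = Φ₀ r v

theorem ContinuesTo.eq {Φ₀ Φ Φ' : ℝ → ℝ × ℝ → M} {a s s' t : ℝ} {u : ℝ × ℝ} (ha : 0 < a)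
    (h : ContinuesTo Φ₀ Φ a u s) (h' : ContinuesTo Φ₀ Φ' a u s') (hat : a ≤ t) (hs : t ≤ s)
    (hs' : t ≤ s') : Φ t u = Φ' t u := by
  refine LocIsoAt.eq_along_ray ha (b := t) (fun r hr => h.1 r ⟨hr.1, hr.2.trans hs⟩)
    (fun r hr => h'.1 r ⟨hr.1, hr.2.trans hs'⟩) ?_ t ⟨hat, le_rfl⟩
  obtain ⟨η, hη, h1⟩ := h.2
  obtain ⟨η', hη', h2⟩ := h'.2
  refine ⟨min η η', lt_min hη hη', fun r v hr hv => ?_⟩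
  rw [h1 r v (hr.trans_le (min_le_left _ _)) (hv.trans_le (min_le_left _ _)),
    h2 r v (hr.trans_le (min_le_right _ _)) (hv.trans_le (min_le_right _ _))]

/-- A continuation along a ray is also a continuation along the nearby rays. -/
theorem ContinuesTo.eventually {Φ₀ Φ : ℝ → ℝ × ℝ → M} {a s : ℝ} {u : ℝ × ℝ} (ha : 0 < a)
    (h : ContinuesTo Φ₀ Φ a u s) : ∃ η > 0, ∀ v, ‖v - u‖ < η → ContinuesTo Φ₀ Φ a v s := by
  have h1 : ∀ᶠ v in 𝓝 u, ∀ r ∈ Icc a s, LocIsoAt Φ r v := by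
    refine isCompact_Icc.eventually_forall_of_forall_eventually fun r hr => ?_
    obtain ⟨η, hη, hb⟩ := (h.1 r hr).eventually (ha.trans_le hr.1)
    filter_upwards [Metric.ball_mem_nhds (u, r) hη] with p hp
    rw [mem_ball, Prod.dist_eq, max_lt_iff, Real.dist_eq, dist_eq_norm] at hp
    exact hb p.2 p.1 hp.2 hp.1
  obtain ⟨η, hη, hb⟩ := Metric.eventually_nhds_iff.1 h1
  obtain ⟨η', hη', hb'⟩ := h.2
  refine ⟨min η (η' / 2), lt_min hη (half_pos hη'), fun v hv => ⟨hb (by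
    rw [dist_eq_norm]; exact hv.trans_le (min_le_left _ _)), η' / 2, half_pos hη',
    fun r w hr hw => hb' r w (by linarith) ?_⟩⟩
  have := norm_sub_le_norm_sub_add_norm_sub w v u
  linarith [hv.trans_le (min_le_right _ _)]

/-- A continuation along a ray exists as long as the endpoints stay away from the singular
locus. -/
theorem exists_continuesTo [CompleteSpace M] {Φ₀ : ℝ → ℝ × ℝ → M} {Sg : Set M}
    (hchart : ∀ x : M, 0 < infDist x Sg → ∃ ε > 0, ∃ χ : HypSpace → M, ∃ y, IsoOn χ y ε ∧ χ y = x)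
    {a b : ℝ} {u : ℝ × ℝ} (ha : 0 < a) (h₀ : LocIsoAt Φ₀ a u)
    (hfar : ∀ s ∈ Ico a b, ∀ Φ, ContinuesTo Φ₀ Φ a u s → min a (b - s) ≤ infDist (Φ s u) Sg) :
    ∀ s ∈ Ico a b, ∃ Φ, ContinuesTo Φ₀ Φ a u s := by
  refine real_induction_Ico fun t ht hs => ?_
  rcases ht.1.eq_or_lt with rfl | hat
  · obtain ⟨η, hη, hb⟩ := h₀.eventually ha
    refine ⟨η, hη, fun s hs _ => ⟨Φ₀, fun r hr => hb r u ?_ (by simpa), 1, one_pos,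
      fun _ _ _ _ => rfl⟩⟩
    rw [abs_of_nonneg (by linarith [hr.1])]; linarith [hr.2, hs.2]
  have : Nonempty M := ⟨Φ₀ 0 0⟩
  choose! Φ hΦ using hs
  -- The curve of endpoints. By uniqueness along the ray it does not depend on the chosen
  -- continuations, so it is 1-Lipschitz and converges as `s → t` by completeness.
  set c : ℝ → M := fun s => Φ s s u with hc
  have hcd : ∀ s ∈ Ico a t, ∀ s' ∈ Ico a t, dist (c s) (c s') ≤ |s - s'| := by
    have key : ∀ s ∈ Ico a t, ∀ s' ∈ Ico a t, s ≤ s' → dist (c s) (c s') ≤ |s - s'| := by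
      intro s hs s' hs' hss
      have : c s = Φ s' s u := (hΦ s hs).eq ha (hΦ s' hs') hs.1 le_rfl hss
      rw [this, abs_sub_comm, abs_of_nonneg (by linarith)]
      exact dist_ray_le (ha.trans_le hs.1) hss fun r hr => (hΦ s' hs').1 r ⟨hs.1.trans hr.1, hr.2⟩
    intro s hs s' hs'
    rcases le_total s s' with h | h
    · exact key s hs s' hs' h
    · rw [dist_comm, abs_sub_comm]; exact key s' hs' s hs h
  obtain ⟨sq, -, hsq, hlim⟩ := exists_seq_strictMono_tendsto' hat
  have hmem : ∀ n, sq n ∈ Ico a t := fun n => ⟨(hsq n).1.le, (hsq n).2⟩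
  have hcauchy : CauchySeq fun n => c (sq n) := by
    have h1 := hlim.cauchySeq
    rw [Metric.cauchySeq_iff] at h1 ⊢
    exact fun ε hε => (h1 ε hε).imp fun N hN m hm n hn =>
      (hcd _ (hmem m) _ (hmem n)).trans_lt (hN m hm n hn)
  obtain ⟨x, hx⟩ := cauchySeq_tendsto_of_complete hcauchy
  have hcx : ∀ s ∈ Ico a t, dist (c s) x ≤ t - s := by
    intro s hs
    have h1 : Tendsto (fun n => dist (c s) (c (sq n))) atTop (𝓝 (dist (c s) x)) :=
      tendsto_const_nhds.dist hx
    have h2 : Tendsto (fun n => |s - sq n|) atTop (𝓝 |s - t|) :=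
      (tendsto_const_nhds.sub hlim).abs
    have := le_of_tendsto_of_tendsto' h1 h2 fun n => hcd s hs _ (hmem n)
    rwa [abs_of_neg (by linarith [hs.2]), neg_sub] at this
  have hxfar : 0 < infDist x Sg := by
    have hbt := lt_min ha (sub_pos.2 ht.2)
    -- Then `c s` is within `min a (b - t) / 3` of the limit but at least `min a (b - t)` away from
    -- `Sg`, so the limit is not in the closure of `Sg`.
    set s := max a (t - min a (b - t) / 3) with hsdef
    have hst : s ∈ Ico a t := ⟨le_max_left _ _, max_lt hat (by linarith)⟩
    have h1 := hfar s ⟨hst.1, hst.2.trans ht.2⟩ _ (hΦ s hst)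
    have h2 := hcx s hst
    have h3 := infDist_le_infDist_add_dist (s := Sg) (x := c s) (y := x)
    have h4 : t - min a (b - t) / 3 ≤ s := le_max_right _ _
    have h6 : min a (b - t) ≤ min a (b - s) := min_le_min le_rfl (by linarith [hst.2])
    have h5 : c s = Φ s s u := rfl
    rw [h5] at h2 h3
    linarith
  obtain ⟨ε, hε, χ, y, hχ, hχy⟩ := hchart x hxfar
  -- From here the distance to the centre of the chart is at most `ε / 4`, so the adapted chart of
  -- radius `ε` contains the ray up to `t + ε / 4`. The old continuation and the new chart are glued
  -- at `s`.
  set s := max ((a + t) / 2) (t - ε / 4) with hsdef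
  have hst : s < t := max_lt (by linarith) (by linarith)
  have has : a < s := lt_of_lt_of_le (by linarith) (le_max_left _ _)
  have hs4 : t - ε / 4 ≤ s := le_max_right _ _
  have hs0 : 0 < s := ha.trans has
  have hsmem : s ∈ Ico a t := ⟨has.le, hst⟩
  have hG := hΦ s hsmem
  obtain ⟨δ, hδ, -, Ψ, hΨ, -, -, η, hη, hb⟩ := (hG.1 s ⟨has.le, le_rfl⟩).exists_isoOn hs0 one_pos
  have hΨs : Ψ (cyl s u) = c s := (hb s u (by simpa) (by simpa)).2
  have hds : dist (c s) x ≤ ε / 4 := (hcx s hsmem).trans (by linarith)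
  obtain ⟨χ', y', δ', hδ', hχ', hmem', hχy', hagree⟩ := IsoOn.exists_continuation hδ hΨ hχ
    (by rw [hΨs, hχy, mem_ball]; linarith)
  have hdy : dist (cyl s u) y' ≤ ε / 4 := by
    rw [← hχ'.dist_center hmem', hagree _ (mem_ball_self hδ'), hΨs, hχy', hχy]; exact hds
  obtain ⟨η', hη', hbox⟩ := exists_box_subset_ball s u hδ'
  set Φ' : ℝ → ℝ × ℝ → M := fun r v => if r < s then Φ s r v else χ' (cyl r v) with hΦ'
  refine ⟨ε / 4, by positivity, fun s' hs' _ => ⟨Φ', fun r hr => ?_, ?_⟩⟩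
  · have hr0 : 0 < r := ha.trans_le hr.1
    rcases lt_or_ge r s with hrs | hrs
    · refine (hG.1 r ⟨hr.1, hrs.le⟩).congr hr0 (sub_pos.2 hrs) fun r' v h1 _ => ?_
      have : r' < s := by linarith [(abs_lt.1 h1).2]
      simp only [hΦ', this, if_true]
    have hry : dist (cyl r u) y' < ε := by
      have h1 := dist_triangle (cyl r u) (cyl s u) y'
      rw [dist_cyl_ray, abs_of_nonneg (by linarith)] at h1
      linarith [hr.2, hs'.2]
    have hiso := hχ'.recenter (mem_ball.2 hry) le_rfl
    rcases hrs.eq_or_lt with rfl | hrs'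
    · refine LocIsoAt.of_isoOn hr0 (sub_pos.2 hry) (lt_min hη hη') hiso fun r' v h1 h2 => ?_
      by_cases hc : r' < s
      · simp only [hΦ', hc, if_true]
        rw [hagree _ (hbox r' v (h1.trans_le (min_le_right _ _)) (h2.trans_le (min_le_right _ _))),
          (hb r' v (h1.trans_le (min_le_left _ _)) (h2.trans_le (min_le_left _ _))).2]
      · simp only [hΦ', hc, if_false]
    · refine LocIsoAt.of_isoOn hr0 (sub_pos.2 hry) (sub_pos.2 hrs') hiso fun r' v h1 _ => ?_
      have : ¬ r' < s := by linarith [(abs_lt.1 h1).1]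
      simp only [hΦ', this, if_false]
  · obtain ⟨η₀, hη₀, h0⟩ := hG.2
    refine ⟨min η₀ (s - a), lt_min hη₀ (sub_pos.2 has), fun r v h1 h2 => ?_⟩
    have : r < s := by linarith [(abs_lt.1 (h1.trans_le (min_le_right _ _))).2]
    simp only [hΦ', this, if_true]
    exact h0 r v (h1.trans_le (min_le_left _ _)) (h2.trans_le (min_le_left _ _))

variable {φ : BranchedPoint → M} {S Sg : Set M} {α ℓ τ R : ℝ}

/-- `Φ` is the normal exponential map of a component of the singular locus, up to the
distance `2R`, extending the parametrization of the tube of radius `R`. -/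
structure IsDevelopment (Φ : ℝ → ℝ × ℝ → M) (φ : BranchedPoint → M) (S Sg : Set M)
    (α ℓ τ R : ℝ) : Prop where
  tube : IsTubeMap φ S α ℓ τ R
  radius_pos : 0 < R
  angle_pos : 0 < α
  length_pos : 0 < ℓ
  eq_tube : ∀ r < R, ∀ u, Φ r u = cylCoord φ r u
  infDist_tube : ∀ r, 0 ≤ r → r < R → ∀ u, infDist (Φ r u) Sg = r
  locIsoAt : ∀ r, 0 < r → r < 2 * R → ∀ u, LocIsoAt Φ r u

theorem IsTubeMap.exists_development [CompleteSpace M]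
    (hchart : ∀ x : M, 0 < infDist x Sg → ∃ ε > 0, ∃ χ : HypSpace → M, ∃ y, IsoOn χ y ε ∧ χ y = x)
    (hR : 0 < R) (hα : 0 < α) (hℓ : 0 < ℓ) (h : IsTubeMap φ S α ℓ τ R)
    (hF : ∀ p : BranchedPoint, p.r < R → infDist (φ p) Sg = p.r) :
    ∃ Φ, IsDevelopment Φ φ S Sg α ℓ τ R := by
  have hF' : ∀ r, 0 ≤ r → r < R → ∀ u, infDist (cylCoord φ r u) Sg = r := fun r h0 hr u => by
    have h1 : |r| < R := by rwa [abs_of_nonneg h0]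
    exact (hF ⟨|r|, u.1, u.2, abs_nonneg r⟩ h1).trans (abs_of_nonneg h0)
  have hR2 := half_pos hR
  have hφ : ∀ u, ∀ s < R, ContinuesTo (cylCoord φ) (cylCoord φ) (R / 2) u s := fun u s hs =>
    ⟨fun r hr => h.locIsoAt hα hℓ (hR2.trans_le hr.1) (hr.2.trans_lt hs), 1, one_pos,
      fun _ _ _ _ => rfl⟩
  have hex : ∀ u, ∀ s ∈ Ico (R / 2) (2 * R), ∃ Φ,
      ContinuesTo (cylCoord φ) Φ (R / 2) u s := fun u => by
    refine exists_continuesTo hchart hR2 (h.locIsoAt hα hℓ hR2 (by linarith)) ?_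
    intro s hs Φ hΦ
    rcases lt_or_ge s R with hsR | hsR
    · rw [show Φ s u = cylCoord φ s u from hΦ.eq hR2 (hφ u s hsR) hs.1 le_rfl le_rfl,
        hF' s (hR2.le.trans hs.1) hsR]
      exact (min_le_left _ _).trans hs.1
    -- Beyond `R`, the point is compared with one of the same ray just inside the tube, where the
    -- distance from `Sg` is known.
    refine (min_le_right _ _).trans (le_of_forall_pos_le_add fun e he => ?_)
    set r := max (R / 2) (R - e / 2) with hr
    have hrR : r < R := max_lt (by linarith) (by linarith)
    have h2r : R / 2 ≤ r := le_max_left _ _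
    have hr1 : R - e / 2 ≤ r := le_max_right _ _
    have hrs : r ≤ s := hrR.le.trans hsR
    have h1 : Φ r u = cylCoord φ r u := hΦ.eq hR2 (hφ u r hrR) h2r hrs le_rfl
    have h2 := dist_ray_le (hR2.trans_le h2r) hrs fun t ht => hΦ.1 t ⟨h2r.trans ht.1, ht.2⟩
    have h3 := infDist_le_infDist_add_dist (s := Sg) (x := Φ r u) (y := Φ s u)
    rw [h1, hF' r (hR2.le.trans h2r) hrR] at h3
    rw [h1] at h2
    linarith
  have : Nonempty M := h.nonempty.to_type
  choose! G hG using hex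
  -- Outside the tube each value comes from a continuation of its own; uniqueness along rays shows
  -- that one continuation gives all the values near a given point.
  set Φ : ℝ → ℝ × ℝ → M := fun r u => if r < R then cylCoord φ r u else G u r r u with hΦ
  have hΦ1 : ∀ r < R, ∀ u, Φ r u = cylCoord φ r u := fun r hr u => by simp only [hΦ, hr, if_true]
  refine ⟨Φ, h, hR, hα, hℓ, hΦ1, fun r h0 hr u => by rw [hΦ1 r hr, hF' r h0 hr],
    fun r h0 hr u => ?_⟩
  rcases lt_or_ge r R with hrR | hrR
  · exact (h.locIsoAt hα hℓ h0 hrR).congr h0 (sub_pos.2 hrR) fun r' v h1 _ =>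
      (hΦ1 r' (by linarith [(abs_lt.1 h1).2]) v).symm
  set s := (r + 2 * R) / 2 with hs
  have hsmem : s ∈ Ico (R / 2) (2 * R) := ⟨by linarith, by linarith⟩
  obtain ⟨η, hη, hnear⟩ := (hG u s hsmem).eventually hR2
  refine ((hG u s hsmem).1 r ⟨by linarith, by linarith⟩).congr h0
    (lt_min hη (lt_min (sub_pos.2 (show r < s by linarith)) hR2)) fun r' v h1 h2 => ?_
  have h3 := hnear v (h2.trans_le (min_le_left _ _))
  have h4 := abs_lt.1 (h1.trans_le (min_le_right _ _))
  have h5 : r' ≤ s := by linarith [min_le_left (s - r) (R / 2)]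
  have h6 : R / 2 ≤ r' := by linarith [min_le_right (s - r) (R / 2)]
  by_cases hr' : r' < R
  · rw [hΦ1 r' hr']
    exact h3.eq hR2 (hφ v r' hr') h6 h5 le_rfl
  · simp only [hΦ, hr', if_false]
    exact h3.eq hR2 (hG v r' ⟨h6, h5.trans_lt hsmem.2⟩) h6 h5 le_rfl

variable {Φ : ℝ → ℝ × ℝ → M}

theorem IsDevelopment.dist_ray_le (D : IsDevelopment Φ φ S Sg α ℓ τ R) {r r' : ℝ} (hr : 0 < r)
    (hrr : r ≤ r') (hr' : r' < 2 * R) (u : ℝ × ℝ) : dist (Φ r u) (Φ r' u) ≤ r' - r :=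
  _root_.dist_ray_le hr hrr fun t ht =>
    D.locIsoAt t (hr.trans_le ht.1) (ht.2.trans_lt hr') u

theorem IsDevelopment.le_infDist (D : IsDevelopment Φ φ S Sg α ℓ τ R) {r : ℝ} (hr : 0 ≤ r)
    (hr' : r < 2 * R) (u : ℝ × ℝ) : min r (2 * R - r) ≤ infDist (Φ r u) Sg := by
  rcases lt_or_ge r R with h | h
  · rw [D.infDist_tube r hr h]; exact min_le_left _ _
  refine (min_le_right _ _).trans (le_of_forall_pos_le_add fun e he => ?_)
  have hR := D.radius_pos
  set s := max (R / 2) (R - e / 2) with hs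
  have hsR : s < R := max_lt (by linarith) (by linarith)
  have h2s : R / 2 ≤ s := le_max_left _ _
  have hs1 : R - e / 2 ≤ s := le_max_right _ _
  have h2 := D.dist_ray_le (show 0 < s by linarith) (hsR.le.trans h) hr' u
  have h3 := infDist_le_infDist_add_dist (s := Sg) (x := Φ s u) (y := Φ r u)
  rw [D.infDist_tube s (by linarith) hsR] at h3
  linarith

theorem IsDevelopment.infDist_core_le (D : IsDevelopment Φ φ S Sg α ℓ τ R) {r : ℝ} (hr : 0 ≤ r)
    (hr' : r < 2 * R) (u : ℝ × ℝ) : infDist (Φ r u) S ≤ r := by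
  have key : ∀ s, 0 ≤ s → s < R → infDist (Φ s u) S ≤ s := fun s h0 hs => by
    rw [D.eq_tube s hs]
    have := D.tube.dist_core_le (p := ⟨|s|, u.1, u.2, abs_nonneg s⟩)
      (by change |s| < R; rwa [abs_of_nonneg h0])
    exact this.trans (abs_of_nonneg h0).le
  rcases lt_or_ge r R with h | h
  · exact key r hr h
  have hR := D.radius_pos
  have h1 := D.dist_ray_le (half_pos hR) (show R / 2 ≤ r by linarith) hr' u
  have h2 := key (R / 2) (half_pos hR).le (by linarith)
  have h3 := infDist_le_infDist_add_dist (s := S) (x := Φ r u) (y := Φ (R / 2) u)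
  rw [dist_comm] at h3
  linarith

/-- Equivariance holds in the tube because `φ` factors through the quotient; it persists beyond
because both sides are local isometries along the ray that agree near radius `R / 2`. -/
theorem IsDevelopment.translate (D : IsDevelopment Φ φ S Sg α ℓ τ R) {r : ℝ} (hr : 0 ≤ r)
    (hr' : r < 2 * R) (u : ℝ × ℝ) {g : ℝ × ℝ} (hg : g ∈ tubeGroup α ℓ τ) :
    Φ r (u + g) = Φ r u := by
  have key : ∀ s, 0 ≤ s → s < R → ∀ v, Φ s (v + g) = Φ s v := fun s h0 hs v => by
    rw [D.eq_tube s hs, D.eq_tube s hs]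
    exact D.tube.translate (p := ⟨|s|, v.1, v.2, abs_nonneg s⟩)
      (by change |s| < R; rwa [abs_of_nonneg h0]) hg
  rcases lt_or_ge r R with h | h
  · exact key r hr h u
  have hR := D.radius_pos
  have hR2 := half_pos hR
  refine LocIsoAt.eq_along_ray (Φ := fun r v => Φ r (v + g)) hR2 (fun t ht => ?_)
    (fun t ht => D.locIsoAt t (hR2.trans_le ht.1) (ht.2.trans_lt hr') u)
    ⟨R / 2, hR2, fun s v hs _ => ?_⟩ r ⟨by linarith, le_rfl⟩
  · exact (D.locIsoAt t (hR2.trans_le ht.1) (ht.2.trans_lt hr') (u + g)).translate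
      (hR2.trans_le ht.1) g
  · have := abs_lt.1 hs
    exact key s (by linarith) (by linarith) v

end Development

/-! ### At a tangency the ray runs to the core of the other tube -/

section Tangency

variable {M : Type*} [MetricSpace M]

/-- Geodesics do not branch in a ball isometric to a hyperbolic one. -/
theorem IsoOn.antipode_unique {Ψ : HypSpace → M} {z : HypSpace} {δ k : ℝ} (h : IsoOn Ψ z δ)
    (hk : k < δ) {a b b' : M} (ha : dist a (Ψ z) = k) (hb : dist b (Ψ z) = k)
    (hb' : dist b' (Ψ z) = k) (hab : dist a b = 2 * k) (hab' : dist a b' = 2 * k) : b = b' := by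
  obtain ⟨p, hp, rfl⟩ := h.exists_eq (w := a) (by rw [mem_ball, ha]; exact hk)
  obtain ⟨q, hq, rfl⟩ := h.exists_eq (w := b) (by rw [mem_ball, hb]; exact hk)
  obtain ⟨q', hq', rfl⟩ := h.exists_eq (w := b') (by rw [mem_ball, hb']; exact hk)
  rw [h.dist_center hp] at ha
  rw [h.dist_center hq] at hb
  rw [h.dist_center hq'] at hb'
  rw [h.1 _ hp _ hq] at hab
  rw [h.1 _ hp _ hq'] at hab'
  rw [HypSpace.eq_of_dist_eq ha hb hb' hab hab']

variable {φ φ' : BranchedPoint → M} {S S' Sg : Set M} {α ℓ τ α' ℓ' τ' R : ℝ}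
  {Φ Φ' : ℝ → ℝ × ℝ → M}

theorem IsDevelopment.dist_ray_eq (D : IsDevelopment Φ φ S Sg α ℓ τ R) {r : ℝ} (hr : 0 < r)
    (hr' : r < 2 * R) (u : ℝ × ℝ) :
    ∃ η > 0, ∀ r₁ r₂, |r₁ - r| < η → |r₂ - r| < η → dist (Φ r₁ u) (Φ r₂ u) = |r₁ - r₂| :=
  (D.locIsoAt r hr hr' u).dist_ray_eq hr

/-- A ray which leaves a tube at a point of tangency with a second tube runs straight to the core of
the second tube: local version. -/
theorem IsDevelopment.eq_near_tangency (D : IsDevelopment Φ φ S Sg α ℓ τ R)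
    (D' : IsDevelopment Φ' φ' S' Sg α' ℓ' τ' R) {x y : ℝ × ℝ} (hxy : Φ R x = Φ' R y) {η : ℝ}
    (hη : 0 < η) (hdisj : ∀ r r' v v', 0 < r → 0 < r' → r < R → r' < R → ‖v - x‖ < η →
      ‖v' - y‖ < η → Φ r v ≠ Φ' r' v') :
    ∃ δ > 0, ∀ h, 0 ≤ h → h < δ → Φ (R + h) x = Φ' (R - h) y := by
  have hR := D.radius_pos
  obtain ⟨δ, hδ, -, Ψ, hΨ, -, hcyl, η₁, hη₁, hb⟩ :=
    (D.locIsoAt R hR (by linarith) x).exists_isoOn hR hη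
  obtain ⟨δ', hδ', -, Ψ', hΨ', -, hcyl', η₂, hη₂, hb'⟩ :=
    (D'.locIsoAt R hR (by linarith) y).exists_isoOn hR hη
  refine ⟨min (min (min η₁ η₂) (min (δ / 2) (δ' / 2))) R, lt_min (lt_min (lt_min hη₁ hη₂)
    (lt_min (half_pos hδ) (half_pos hδ'))) hR, fun h h0 hh' => ?_⟩
  have hhR : h < R := hh'.trans_le (min_le_right _ _)
  have hh := hh'.trans_le (min_le_left _ _)
  have hh1 : h < η₁ := hh.trans_le ((min_le_left _ _).trans (min_le_left _ _))
  have hh2 : h < η₂ := hh.trans_le ((min_le_left _ _).trans (min_le_right _ _))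
  have hh3 : h < δ / 2 := hh.trans_le ((min_le_right _ _).trans (min_le_left _ _))
  have hh4 : h < δ' / 2 := hh.trans_le ((min_le_right _ _).trans (min_le_right _ _))
  have e1 : |R - h - R| = h := by rw [sub_sub_cancel_left, abs_neg, abs_of_nonneg h0]
  have e2 : |R + h - R| = h := by rw [add_sub_cancel_left, abs_of_nonneg h0]
  obtain ⟨ma, ea⟩ := hb (R - h) x (by rwa [e1]) (by simpa)
  obtain ⟨mb, eb⟩ := hb (R + h) x (by rwa [e2]) (by simpa)
  obtain ⟨mb', eb'⟩ := hb' (R - h) y (by rwa [e1]) (by simpa)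
  have ez : Ψ (cyl R x) = Φ R x := (hb R x (by simpa) (by simpa)).2
  have ez' : Ψ' (cyl R y) = Φ R x := by rw [hxy]; exact (hb' R y (by simpa) (by simpa)).2
  have da : dist (Φ (R - h) x) (Φ R x) = h := by
    rw [← ea, ← ez, hΨ.dist_center ma, dist_cyl_ray, e1]
  have db : dist (Φ (R + h) x) (Φ R x) = h := by
    rw [← eb, ← ez, hΨ.dist_center mb, dist_cyl_ray, e2]
  have db' : dist (Φ' (R - h) y) (Φ R x) = h := by
    rw [← eb', ← ez', hΨ'.dist_center mb', dist_cyl_ray, e1]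
  have dab : dist (Φ (R - h) x) (Φ (R + h) x) = 2 * h := by
    rw [← ea, ← eb, hΨ.1 _ ma _ mb, dist_cyl_ray, abs_sub_comm, abs_of_nonneg (by linarith)]
    ring
  have dab' : dist (Φ (R - h) x) (Φ' (R - h) y) = 2 * h := by
    refine le_antisymm ?_ ?_
    · have := dist_triangle_right (Φ (R - h) x) (Φ' (R - h) y) (Φ R x)
      linarith
    -- If the two inner points were closer than `2h`, their midpoint would be at distance less than
    -- `h` from both, hence would lie in both tubes at once.
    by_contra! hlt
    obtain ⟨q, hq, eq⟩ := hΨ.exists_eq (w := Φ' (R - h) y) (by rw [mem_ball, ez, db']; linarith)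
    rw [← ea, ← eq, hΨ.1 _ ma _ hq] at hlt
    obtain ⟨m, hm1, hm2, -⟩ := HypSpace.exists_midpoint (cyl (R - h) x) q
    have hmball : m ∈ ball (cyl R x) δ := by
      have h1 := dist_triangle_left m (cyl R x) (cyl (R - h) x)
      rw [dist_cyl_ray, e1] at h1
      rw [mem_ball]; linarith
    obtain ⟨r, v, hr0, -, hv, hmc, hΨm⟩ := hcyl m hmball
    have hrR : r < R := by
      have h1 := abs_sub_le_dist_cyl (show 0 ≤ R - h by linarith) hr0.le x v
      rw [← hmc] at h1
      linarith [(abs_le.1 (h1.trans hm1.le)).1]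
    have hw1 : dist (Ψ m) (Φ' (R - h) y) < h := by
      rw [← eq, hΨ.1 _ hmball _ hq, hm2]; linarith
    obtain ⟨m', hm', em'⟩ := hΨ'.exists_eq (w := Ψ m) (by
      rw [mem_ball, ez']
      linarith [dist_triangle (Ψ m) (Φ' (R - h) y) (Φ R x)])
    obtain ⟨r', v', hr0', -, hv', hmc', hΨm'⟩ := hcyl' m' hm'
    have hrR' : r' < R := by
      have h1 := abs_sub_le_dist_cyl (show 0 ≤ R - h by linarith) hr0'.le y v'
      rw [← hmc', ← hΨ'.1 _ mb' _ hm', em', eb', dist_comm] at h1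
      linarith [(abs_lt.1 (h1.trans_lt hw1)).1]
    exact hdisj r r' v v' hr0 hr0' hrR hrR' hv hv' (by rw [← hΨm, ← hΨm', em'])
  exact hΨ.antipode_unique (k := h) (by linarith) (by rw [ez, da]) (by rw [ez, db])
    (by rw [ez, db']) dab dab'

/-- A ray which leaves a tube at a point of tangency with a second tube runs straight to the core of
the second tube. -/
theorem IsDevelopment.eq_of_tangency (D : IsDevelopment Φ φ S Sg α ℓ τ R)
    (D' : IsDevelopment Φ' φ' S' Sg α' ℓ' τ' R) {x y : ℝ × ℝ} (hxy : Φ R x = Φ' R y) {η : ℝ}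
    (hη : 0 < η) (hdisj : ∀ r r' v v', 0 < r → 0 < r' → r < R → r' < R → ‖v - x‖ < η →
      ‖v' - y‖ < η → Φ r v ≠ Φ' r' v') :
    ∀ t ∈ Ico 0 R, Φ (R + t) x = Φ' (R - t) y := by
  have hR := D.radius_pos
  refine real_induction_Ico fun t ht hs => ?_
  rcases ht.1.eq_or_lt with rfl | h0
  · obtain ⟨δ, hδ, h⟩ := D.eq_near_tangency D' hxy hη hdisj
    exact ⟨δ, hδ, fun s hs _ => h s hs.1 (by linarith [hs.2])⟩
  have hz : Φ (R + t) x = Φ' (R - t) y := by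
    rw [← dist_le_zero]
    refine le_of_forall_pos_le_add fun e he => ?_
    have hm : 0 < min (e / 2) t := lt_min (half_pos he) h0
    have h1 := min_le_left (e / 2) t
    have h2 := min_le_right (e / 2) t
    have h3 := hs (t - min (e / 2) t) ⟨by linarith, by linarith⟩
    have h4 := D.dist_ray_le (r := R + (t - min (e / 2) t)) (r' := R + t) (by linarith)
      (by linarith) (by linarith [ht.2]) x
    have h5 := D'.dist_ray_le (r := R - t) (r' := R - (t - min (e / 2) t)) (by linarith [ht.2])
      (by linarith) (by linarith) y
    rw [← h3] at h5
    have := dist_triangle_left (Φ (R + t) x) (Φ' (R - t) y) (Φ (R + (t - min (e / 2) t)) x)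
    rw [dist_comm] at h5
    linarith
  obtain ⟨η₁, hη₁, hd⟩ := D.dist_ray_eq (r := R + t) (by linarith) (by linarith [ht.2]) x
  obtain ⟨η₂, hη₂, hd'⟩ := D'.dist_ray_eq (r := R - t) (by linarith [ht.2]) (by linarith) y
  obtain ⟨δ, hδ, -, Ψ, hΨ, -, -, η₃, hη₃, hb⟩ :=
    (D.locIsoAt (R + t) (by linarith) (by linarith [ht.2]) x).exists_isoOn (by linarith) one_pos
  have ez : Ψ (cyl (R + t) x) = Φ (R + t) x := (hb (R + t) x (by simpa) (by simpa)).2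
  refine ⟨min (min η₁ η₂) (min δ t), lt_min (lt_min hη₁ hη₂) (lt_min hδ h0), fun s hst _ => ?_⟩
  obtain ⟨k, rfl⟩ : ∃ k, s = t + k := ⟨s - t, by ring⟩
  have hk0 : 0 ≤ k := by linarith [hst.1]
  have hk : k < min (min η₁ η₂) (min δ t) := by linarith [hst.2]
  have hk1 : k < η₁ := hk.trans_le ((min_le_left _ _).trans (min_le_left _ _))
  have hk2 : k < η₂ := hk.trans_le ((min_le_left _ _).trans (min_le_right _ _))
  have hk3 : k < δ := hk.trans_le ((min_le_right _ _).trans (min_le_left _ _))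
  have hk4 : k < t := hk.trans_le ((min_le_right _ _).trans (min_le_right _ _))
  rcases hk0.eq_or_lt with rfl | hkpos
  · simpa using hz
  have h3 := hs (t - k) ⟨by linarith, by linarith⟩
  have a1 : |R + (t - k) - (R + t)| = k := by rw [abs_of_neg (by linarith)]; ring
  have a2 : |R + (t + k) - (R + t)| = k := by rw [abs_of_pos (by linarith)]; ring
  have a3 : |R - (t - k) - (R - t)| = k := by rw [abs_of_pos (by linarith)]; ring
  have a4 : |R - (t + k) - (R - t)| = k := by rw [abs_of_neg (by linarith)]; ring
  -- The next points on both rays are antipodal, about the common point at time `t`, to the common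
  -- point at time `t - k`.
  refine hΨ.antipode_unique hk3 (a := Φ (R + (t - k)) x) ?_ ?_ ?_ ?_ ?_
  · rw [ez, hd _ _ (by rwa [a1]) (by simpa), a1]
  · rw [ez, hd _ _ (by rwa [a2]) (by simpa), a2]
  · rw [ez, hz, hd' _ _ (by rwa [a4]) (by simpa), a4]
  · rw [hd _ _ (by rwa [a1]) (by rwa [a2]), abs_of_neg (by linarith)]; ring
  · rw [h3, hd' _ _ (by rwa [a3]) (by rwa [a4]), abs_of_pos (by linarith)]; ring

/-- The ray in the direction `x` meets the singular locus at the distance `2R`. -/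
def MeetsSingularLocus (Φ : ℝ → ℝ × ℝ → M) (Sg : Set M) (R : ℝ) (x : ℝ × ℝ) : Prop :=
  ∀ r, R < r → r < 2 * R → infDist (Φ r x) Sg ≤ 2 * R - r

theorem IsDevelopment.meetsSingularLocus (D : IsDevelopment Φ φ S Sg α ℓ τ R)
    (D' : IsDevelopment Φ' φ' S' Sg α' ℓ' τ' R) {x y : ℝ × ℝ} (hxy : Φ R x = Φ' R y) {η : ℝ}
    (hη : 0 < η) (hdisj : ∀ r r' v v', 0 < r → 0 < r' → r < R → r' < R → ‖v - x‖ < η →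
      ‖v' - y‖ < η → Φ r v ≠ Φ' r' v') : MeetsSingularLocus Φ Sg R x := fun r h1 h2 => by
  have := D.eq_of_tangency D' hxy hη hdisj (r - R) ⟨by linarith, by linarith⟩
  rw [add_sub_cancel, show R - (r - R) = 2 * R - r by ring] at this
  rw [this, D'.infDist_tube _ (by linarith) (by linarith)]

theorem MeetsSingularLocus.translate (D : IsDevelopment Φ φ S Sg α ℓ τ R) {x g : ℝ × ℝ}
    (h : MeetsSingularLocus Φ Sg R x) (hg : g ∈ tubeGroup α ℓ τ) :
    MeetsSingularLocus Φ Sg R (x + g) := fun r h1 h2 => by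
  rw [D.translate (by linarith [D.radius_pos]) h2 x hg]; exact h r h1 h2

end Tangency

/-! ### Chords between points at equal distance from the axis -/

section Geodesics

/-- The linear formula is kept because its coefficients are nonnegative with an explicit sum, which
controls both the distance of the chord from the axis and its angle. -/
theorem HypSpace.exists_geodesic {p q : HypSpace} (hpq : p ≠ q) : ∃ γ : ℝ → HypSpace,
    (∀ s ∈ Icc 0 (dist p q), ∀ t ∈ Icc 0 (dist p q), dist (γ s) (γ t) = |s - t|) ∧
    ∀ t ∈ Icc 0 (dist p q), (γ t).1 = (Real.sinh (dist p q - t) / Real.sinh (dist p q)) • p.1 +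
      (Real.sinh t / Real.sinh (dist p q)) • q.1 := by
  set d := dist p q with hd
  have hd0 : 0 < d := dist_pos.2 hpq
  have hS : 0 < Real.sinh d := Real.sinh_pos_iff.2 hd0
  let c : ℝ → Fin 4 → ℝ := fun t => (Real.sinh (d - t) / Real.sinh d) • p.1 +
      (Real.sinh t / Real.sinh d) • q.1
  have hform : ∀ s t, lorentzForm (c s) (c t) = -Real.cosh (s - t) := by
    intro s t
    simp only [c, lorentzForm_add_left, lorentzForm_smul_left, lorentzForm_add_right,
      lorentzForm_smul_right, p.2.1, q.2.1, lorentzForm_comm q.1 p.1, HypSpace.lorentzForm_eq,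
      ← hd, Real.sinh_sub, Real.cosh_sub]
    have h2 := Real.cosh_sq d
    field_simp
    linear_combination (Real.sinh s * Real.sinh t) * h2
  have hpos : ∀ t ∈ Icc 0 d, 0 < c t 0 := by
    intro t ht
    have h1 := p.2.2
    have h2 := q.2.2
    have h3 : 0 ≤ Real.sinh (d - t) := Real.sinh_nonneg_iff.2 (by linarith [ht.2])
    have h4 : 0 ≤ Real.sinh t := Real.sinh_nonneg_iff.2 ht.1
    simp only [c, Pi.add_apply, Pi.smul_apply, smul_eq_mul]
    rcases ht.1.eq_or_lt with h0 | h0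
    · subst h0
      have : 0 < Real.sinh (d - 0) := by simpa using hS
      positivity
    · have : 0 < Real.sinh t := Real.sinh_pos_iff.2 h0
      positivity
  have hex : ∀ t, ∃ x : HypSpace, t ∈ Icc 0 d → x.1 = c t := fun t => by
    by_cases ht : t ∈ Icc 0 d
    · exact ⟨⟨c t, by rw [hform]; simp, hpos t ht⟩, fun _ => rfl⟩
    · exact ⟨p, fun h => absurd h ht⟩
  choose γ hγ using hex
  refine ⟨γ, fun s hs t ht => ?_, hγ⟩
  refine Real.cosh_injOn (mem_Ici.2 dist_nonneg) (mem_Ici.2 (abs_nonneg _)) ?_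
  rw [HypSpace.cosh_dist, Real.cosh_abs, hγ s hs, hγ t ht, hform, neg_neg]

theorem cyl_coords (r : ℝ) (u : ℝ × ℝ) : (cyl r u).1 2 = Real.sinh r * Real.cos u.1 ∧
    (cyl r u).1 3 = Real.sinh r * Real.sin u.1 := by
  simp [cyl, cylPoint]

theorem cyl_coords_sq (r : ℝ) (u : ℝ × ℝ) :
    (cyl r u).1 2 ^ 2 + (cyl r u).1 3 ^ 2 = Real.sinh r ^ 2 := by
  rw [(cyl_coords r u).1, (cyl_coords r u).2]
  linear_combination Real.sinh r ^ 2 * Real.sin_sq_add_cos_sq u.1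

/-- A nonnegative combination of two points at equal distance from the axis, with a small angle
between them. -/
theorem cyl_coords_of_combination {s A B r : ℝ} {x y u : ℝ × ℝ} (hs : 0 ≤ s) (hA : 0 ≤ A)
    (hB : 0 ≤ B) (hr : 0 < r) (hxy : |x.1 - y.1| < 1)
    (hu : |u.1 - (x.1 + y.1) / 2| ≤ Real.pi)
    (h : (cyl r u).1 = A • (cyl s x).1 + B • (cyl s y).1) :
    Real.sinh r ≤ Real.sinh s * (A + B) ∧ |u.1 - (x.1 + y.1) / 2| ≤ 1 / 2 := by
  have hss : 0 ≤ Real.sinh s := Real.sinh_nonneg_iff.2 hs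
  have hsr : 0 < Real.sinh r := Real.sinh_pos_iff.2 hr
  have h2 := congrFun h 2
  have h3 := congrFun h 3
  simp only [Pi.add_apply, Pi.smul_apply, smul_eq_mul, (cyl_coords _ _).1,
    (cyl_coords _ _).2] at h2 h3
  have hsum : (Real.sinh r) ^ 2 = Real.sinh s ^ 2 *
      (A ^ 2 + B ^ 2 + 2 * A * B * Real.cos (x.1 - y.1)) := by
    have e1 := Real.sin_sq_add_cos_sq u.1
    have e2 := Real.sin_sq_add_cos_sq x.1
    have e3 := Real.sin_sq_add_cos_sq y.1
    have : Real.sinh r ^ 2 = (Real.sinh r * Real.cos u.1) ^ 2 + (Real.sinh r * Real.sin u.1) ^ 2 := by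
      linear_combination (-Real.sinh r ^ 2) * e1
    rw [this, h2, h3, Real.cos_sub]
    linear_combination Real.sinh s ^ 2 * (A ^ 2 * e2 + B ^ 2 * e3)
  have hle : Real.sinh r ≤ Real.sinh s * (A + B) := by
    refine le_of_sq_le_sq ?_ (by positivity)
    rw [hsum, mul_pow]
    refine mul_le_mul_of_nonneg_left ?_ (sq_nonneg _)
    nlinarith [Real.cos_le_one (x.1 - y.1), mul_nonneg hA hB]
  refine ⟨hle, ?_⟩
  set m := (x.1 + y.1) / 2 with hm
  set k := (x.1 - y.1) / 2 with hk
  have hx : x.1 = m + k := by rw [hm, hk]; ring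
  have hy : y.1 = m - k := by rw [hm, hk]; ring
  -- Projection to the bisecting direction `m`, about which the two points have angles `± k`. With
  -- the bound on `sinh r` this yields `cos (u.1 - m) ≥ cos k`.
  have hcos : Real.sinh r * Real.cos (u.1 - m) = Real.sinh s * (A + B) * Real.cos k := by
    rw [Real.cos_sub]
    have e := Real.sin_sq_add_cos_sq m
    rw [hx, hy, Real.cos_add, Real.cos_sub] at h2
    rw [hx, hy, Real.sin_add, Real.sin_sub] at h3
    linear_combination Real.cos m * h2 + Real.sin m * h3 +
      (Real.sinh s * (A + B) * Real.cos k) * e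
  have hk2 : |k| < 1 / 2 := by
    rw [hk, abs_div, abs_two]; linarith
  have hpi := Real.pi_gt_three
  have hck : 0 < Real.cos k := Real.cos_pos_of_mem_Ioo ⟨by linarith [(abs_lt.1 hk2).1],
    by linarith [(abs_lt.1 hk2).2]⟩
  have hcc : Real.cos |k| ≤ Real.cos |u.1 - m| := by
    rw [Real.cos_abs, Real.cos_abs]
    have : Real.sinh r * Real.cos k ≤ Real.sinh r * Real.cos (u.1 - m) := by
      rw [hcos]; exact mul_le_mul_of_nonneg_right hle hck.le
    exact le_of_mul_le_mul_left this hsr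
  by_contra! hcon
  have := Real.cos_lt_cos_of_nonneg_of_le_pi (abs_nonneg k) hu (hk2.trans hcon)
  linarith

end Geodesics

/-! ### Maximum principle and separation of rays meeting the singular locus -/

section MaximumPrinciple

variable {M : Type*} [MetricSpace M]

/-- The punctured `R`-neighbourhood of `Sg` is covered by tubes in which the distance from `Sg` is
the distance from the axis. -/
def HasTubeCharts (Sg : Set M) (R : ℝ) : Prop :=
  ∀ w, 0 < infDist w Sg → infDist w Sg < R → ∃ (Φ : ℝ → ℝ × ℝ → M) (r : ℝ) (v : ℝ × ℝ),
    0 < r ∧ r < R ∧ Φ r v = w ∧ LocIsoAt Φ r v ∧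
      ∀ r', 0 ≤ r' → r' < R → ∀ v', infDist (Φ r' v') Sg = r'

/-- The distance from `Sg` has no local maximum along a geodesic in the tubes. -/
theorem HasTubeCharts.infDist_lt_max {Sg : Set M} {R : ℝ} (hT : HasTubeCharts Sg R) {w : M}
    (h0 : 0 < infDist w Sg) (hR : infDist w Sg < R) : ∃ κ > 0, ∀ h, 0 < h → h < κ → ∀ a b,
      dist a w = h → dist b w = h → dist a b = 2 * h →
        infDist w Sg < max (infDist a Sg) (infDist b Sg) := by
  obtain ⟨Φ, r, v, hr, hrR, rfl, hΦ, hF⟩ := hT w h0 hR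
  obtain ⟨δ, hδ, -, Ψ, hΨ, -, hcyl, η, hη, hb⟩ := hΦ.exists_isoOn hr (sub_pos.2 hrR)
  have ez : Ψ (cyl r v) = Φ r v := (hb r v (by simpa) (by simpa)).2
  refine ⟨δ, hδ, fun h hh hhδ a b ha hb hab => ?_⟩
  obtain ⟨p, hp, rfl⟩ := hΨ.exists_eq (w := a) (by rw [mem_ball, ez, ha]; exact hhδ)
  obtain ⟨q, hq, rfl⟩ := hΨ.exists_eq (w := b) (by rw [mem_ball, ez, hb]; exact hhδ)
  rw [← ez, hΨ.dist_center hp] at ha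
  rw [← ez, hΨ.dist_center hq] at hb
  rw [hΨ.1 _ hp _ hq] at hab
  have hsum := HypSpace.add_eq_of_dist_eq ha hb hab
  obtain ⟨r₁, v₁, h1, h1', -, rfl, e1⟩ := hcyl p hp
  obtain ⟨r₂, v₂, h2, h2', -, rfl, e2⟩ := hcyl q hq
  rw [e1, e2, hF r hr.le hrR, hF r₁ h1.le (by linarith [(abs_lt.1 h1').2]),
    hF r₂ h2.le (by linarith [(abs_lt.1 h2').2])]
  by_contra! hcon
  have g1 : r₁ ≤ r := (le_max_left _ _).trans hcon
  have g2 : r₂ ≤ r := (le_max_right _ _).trans hcon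
  have c2 := congrFun hsum 2
  have c3 := congrFun hsum 3
  simp only [Pi.add_apply, Pi.smul_apply, smul_eq_mul] at c2 c3
  have k0 := cyl_coords_sq r v
  have k1 := cyl_coords_sq r₁ v₁
  have k2 := cyl_coords_sq r₂ v₂
  have s1 : Real.sinh r₁ ^ 2 ≤ Real.sinh r ^ 2 :=
    pow_le_pow_left₀ (Real.sinh_nonneg_iff.2 h1.le) (Real.sinh_le_sinh.2 g1) 2
  have s2 : Real.sinh r₂ ^ 2 ≤ Real.sinh r ^ 2 :=
    pow_le_pow_left₀ (Real.sinh_nonneg_iff.2 h2.le) (Real.sinh_le_sinh.2 g2) 2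
  have s0 : 0 < Real.sinh r ^ 2 := pow_pos (Real.sinh_pos_iff.2 hr) 2
  have hc : 1 < Real.cosh h ^ 2 := by
    have := Real.one_lt_cosh.2 hh.ne'
    nlinarith
  -- The last two coordinates have squared norm `sinh² r`, and the endpoints sum to `2 cosh h` times
  -- the midpoint. The factor `cosh² h > 1` makes the convexity strict.
  have e : 4 * Real.cosh h ^ 2 * Real.sinh r ^ 2 ≤ 2 * (Real.sinh r₁ ^ 2 + Real.sinh r₂ ^ 2) := by
    rw [← k0, ← k1, ← k2]
    have : 4 * Real.cosh h ^ 2 * ((cyl r v).1 2 ^ 2 + (cyl r v).1 3 ^ 2) =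
        ((cyl r₁ v₁).1 2 + (cyl r₂ v₂).1 2) ^ 2 + ((cyl r₁ v₁).1 3 + (cyl r₂ v₂).1 3) ^ 2 := by
      rw [c2, c3]; ring
    rw [this]
    nlinarith [sq_nonneg ((cyl r₁ v₁).1 2 - (cyl r₂ v₂).1 2),
      sq_nonneg ((cyl r₁ v₁).1 3 - (cyl r₂ v₂).1 3)]
  nlinarith

variable {φ : BranchedPoint → M} {S Sg : Set M} {α ℓ τ R : ℝ} {Φ : ℝ → ℝ × ℝ → M}

/-- Distinct nearby rays which meet the singular locus at the distance `2R` stay apart. -/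
theorem IsDevelopment.le_dist_of_lt (D : IsDevelopment Φ φ S Sg α ℓ τ R) (hT : HasTubeCharts Sg R)
    {x y : ℝ × ℝ} (hxy : x ≠ y) (hθ : |x.1 - y.1| < 1) (hx : MeetsSingularLocus Φ Sg R x)
    (hy : MeetsSingularLocus Φ Sg R y) {s : ℝ} (hs : R < s) (hs2 : s < 2 * R) :
    2 * (s - R) ≤ dist (cyl s x) (cyl s y) := by
  by_contra! hd
  have hR := D.radius_pos
  have hs0 : 0 < s := hR.trans hs
  have hne : cyl s x ≠ cyl s y := fun h => hxy
    (cyl_injective hs0 hs0.le (hθ.le.trans (by linarith [Real.pi_gt_three])) h).2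
  obtain ⟨γ, hγ, hγc⟩ := HypSpace.exists_geodesic hne
  set d := dist (cyl s x) (cyl s y) with hdd
  have hd0 : 0 < d := dist_pos.2 hne
  have hS : 0 < Real.sinh d := Real.sinh_pos_iff.2 hd0
  choose ρ v hρ hv hγv using fun t => exists_eq_cyl (γ t) ((x.1 + y.1) / 2)
  have hγ0 : γ 0 = cyl s x := by
    apply Subtype.ext
    rw [hγc 0 ⟨le_rfl, hd0.le⟩]
    simp [hS.ne']
  have hγd : γ d = cyl s y := by
    apply Subtype.ext
    rw [hγc d ⟨hd0.le, le_rfl⟩]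
    simp [hS.ne']
  -- Every point of the chord is within `d / 2 < s - R` of an endpoint, and the radius is
  -- 1-Lipschitz.
  have hρR : ∀ t ∈ Icc 0 d, R < ρ t := by
    intro t ht
    have h1 := abs_sub_le_dist_cyl hs0.le (hρ t) x (v t)
    have h2 := abs_sub_le_dist_cyl hs0.le (hρ t) y (v t)
    rw [← hγv, ← hγ0, hγ 0 ⟨le_rfl, hd0.le⟩ t ht, zero_sub, abs_neg, abs_of_nonneg ht.1] at h1
    rw [← hγv, ← hγd, hγ d ⟨hd0.le, le_rfl⟩ t ht, abs_of_nonneg (show 0 ≤ d - t by linarith [ht.2])] at h2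
    linarith [(abs_le.1 h1).2, (abs_le.1 h2).2]
  have hcomb : ∀ t ∈ Icc 0 d, Real.sinh (ρ t) ≤ Real.sinh s *
      (Real.sinh (d - t) / Real.sinh d + Real.sinh t / Real.sinh d) ∧
      |(v t).1 - (x.1 + y.1) / 2| ≤ 1 / 2 := by
    intro t ht
    have h1 : 0 ≤ Real.sinh (d - t) := Real.sinh_nonneg_iff.2 (by linarith [ht.2])
    have h2 : 0 ≤ Real.sinh t := Real.sinh_nonneg_iff.2 ht.1
    refine cyl_coords_of_combination hs0.le (by positivity) (by positivity)
      (hR.trans (hρR t ht)) hθ (hv t) ?_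
    rw [← hγv, hγc t ht]
  have hρs : ∀ t ∈ Icc 0 d, ρ t ≤ s := by
    intro t ht
    have h1 : 0 ≤ Real.sinh (d - t) := Real.sinh_nonneg_iff.2 (by linarith [ht.2])
    have h2 : 0 ≤ Real.sinh t := Real.sinh_nonneg_iff.2 ht.1
    have h3 : Real.sinh (d - t) + Real.sinh t ≤ Real.sinh d := by
      have := Real.sinh_add (d - t) t
      rw [sub_add_cancel] at this
      rw [this]
      nlinarith [Real.one_le_cosh (d - t), Real.one_le_cosh t]
    rw [← Real.sinh_le_sinh]
    refine (hcomb t ht).1.trans ?_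
    rw [← add_div]
    exact mul_le_of_le_one_right (Real.sinh_nonneg_iff.2 hs0.le) ((div_le_one hS).2 h3)
  -- The image of the chord in `M`. It is a local geodesic: the chord stays at radii in `(R, s]`,
  -- and its angles stay within `1 / 2` of the mean, on one branch of `cyl`.
  set N : ℝ → M := fun t => Φ (ρ t) (v t) with hN
  have hloc : ∀ t ∈ Icc 0 d, ∃ δ > 0, ∀ t₁ ∈ Icc 0 d, ∀ t₂ ∈ Icc 0 d, |t₁ - t| < δ →
      |t₂ - t| < δ → dist (N t₁) (N t₂) = |t₁ - t₂| := by
    intro t ht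
    obtain ⟨δ, hδ, Ψ, hΨ, hb⟩ := D.locIsoAt (ρ t) (hR.trans (hρR t ht))
      ((hρs t ht).trans_lt hs2) (v t)
    have hm : ∀ t' ∈ Icc 0 d, |t' - t| < δ → γ t' ∈ ball (cyl (ρ t) (v t)) δ ∧
        Ψ (γ t') = N t' := by
      intro t' ht' h'
      have h1 : γ t' ∈ ball (cyl (ρ t) (v t)) δ := by
        rw [← hγv, mem_ball, hγ t' ht' t ht]; exact h'
      refine ⟨h1, ?_⟩
      rw [hγv t'] at h1 ⊢
      refine hb _ _ (hρ t') ?_ h1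
      have h2 := (hcomb t ht).2
      have h3 := (hcomb t' ht').2
      rw [abs_le] at h2 h3 ⊢
      constructor <;> linarith [h2.1, h2.2, h3.1, h3.2]
    refine ⟨δ, hδ, fun t₁ ht₁ t₂ ht₂ h1 h2 => ?_⟩
    rw [← (hm t₁ ht₁ h1).2, ← (hm t₂ ht₂ h2).2, hΨ.1 _ (hm t₁ ht₁ h1).1 _ (hm t₂ ht₂ h2).1,
      hγ t₁ ht₁ t₂ ht₂]
  have hlip : ∀ s ∈ Icc 0 d, ∀ t ∈ Icc 0 d, s ≤ t → dist (N s) (N t) ≤ t - s := by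
    intro s hs t ht hst
    have := le_of_locally_antitone (f := fun t' => dist (N s) (N t') - t') hst ?_
    · simp only [dist_self] at this; linarith
    intro t' ht'
    obtain ⟨δ, hδ, h⟩ := hloc t' ⟨hs.1.trans ht'.1, ht'.2.trans ht.2⟩
    refine ⟨δ, hδ, fun t₁ ht₁ t₂ ht₂ h1 h2 h12 => ?_⟩
    have h3 := h t₁ ⟨hs.1.trans ht₁.1, ht₁.2.trans ht.2⟩ t₂ ⟨hs.1.trans ht₂.1, ht₂.2.trans ht.2⟩
      h1 h2
    rw [abs_sub_comm, abs_of_nonneg (by linarith)] at h3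
    linarith [dist_triangle (N s) (N t₁) (N t₂)]
  have hangle : ∀ z : ℝ × ℝ, |z.1 - (x.1 + y.1) / 2| ≤ 1 / 2 → ∀ t ∈ Icc 0 d,
      |z.1 - (v t).1| ≤ Real.pi := fun z hz t ht => by
    have h2 := (hcomb t ht).2
    rw [abs_le] at h2 hz ⊢
    constructor <;> linarith [h2.1, h2.2, hz.1, hz.2, Real.pi_gt_three]
  have hθ' := abs_lt.1 hθ
  have hN0 : N 0 = Φ s x := by
    have h0 : (0 : ℝ) ∈ Icc 0 d := ⟨le_rfl, hd0.le⟩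
    have := cyl_injective hs0 (hρ 0) (hangle x (by rw [abs_le]; constructor <;> linarith) 0 h0)
      (hγ0.symm.trans (hγv 0))
    rw [hN]; simp only; rw [← this.1, ← this.2]
  have hNd : N d = Φ s y := by
    have h0 : d ∈ Icc 0 d := ⟨hd0.le, le_rfl⟩
    have := cyl_injective hs0 (hρ d) (hangle y (by rw [abs_le]; constructor <;> linarith) d h0)
      (hγd.symm.trans (hγv d))
    rw [hN]; simp only; rw [← this.1, ← this.2]
  set F : ℝ → ℝ := fun t => infDist (N t) Sg with hF
  have hF0 : F 0 ≤ 2 * R - s := by rw [hF]; simp only; rw [hN0]; exact hx s hs hs2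
  have hFd : F d ≤ 2 * R - s := by rw [hF]; simp only; rw [hNd]; exact hy s hs hs2
  have hFlow : ∀ t ∈ Icc 0 d, 2 * R - ρ t ≤ F t := by
    intro t ht
    have := D.le_infDist (hρ t) ((hρs t ht).trans_lt hs2) (v t)
    rwa [min_eq_right (by linarith [hρR t ht])] at this
  -- At the endpoints `F` is at most `2R - s`, and one of them is within `d / 2 < s - R`. So the
  -- whole image lies where the maximum principle applies.
  have hFup : ∀ t ∈ Icc 0 d, F t < R := by
    intro t ht
    have h1 := hlip 0 ⟨le_rfl, hd0.le⟩ t ht ht.1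
    have h2 := hlip t ht d ⟨hd0.le, le_rfl⟩ ht.2
    have h3 := infDist_le_infDist_add_dist (s := Sg) (x := N t) (y := N 0)
    have h4 := infDist_le_infDist_add_dist (s := Sg) (x := N t) (y := N d)
    rw [dist_comm] at h3
    simp only [hF] at hF0 hFd ⊢
    linarith
  have hcont : ContinuousOn F (Icc 0 d) := by
    refine (continuous_infDist_pt Sg).comp_continuousOn fun t ht => ?_
    obtain ⟨δ, hδ, h⟩ := hloc t ht
    rw [Metric.continuousWithinAt_iff]
    intro ε hε
    refine ⟨min δ ε, lt_min hδ hε, fun t' ht' h' => ?_⟩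
    rw [Real.dist_eq] at h'
    rw [h t' ht' t ht (h'.trans_le (min_le_left _ _)) (by simpa)]
    exact h'.trans_le (min_le_right _ _)
  obtain ⟨t₀, ht₀, hmax⟩ := isCompact_Icc.exists_isMaxOn ⟨0, le_rfl, hd0.le⟩ hcont
  have hend : t₀ = 0 ∨ t₀ = d := by
    by_contra! hcon
    have h1 : 0 < t₀ := lt_of_le_of_ne ht₀.1 (Ne.symm hcon.1)
    have h2 : t₀ < d := lt_of_le_of_ne ht₀.2 hcon.2
    obtain ⟨κ, hκ, hk⟩ := hT.infDist_lt_max (w := N t₀)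
      (lt_of_lt_of_le (by linarith [hρs t₀ ht₀]) (hFlow t₀ ht₀)) (hFup t₀ ht₀)
    obtain ⟨δ, hδ, h⟩ := hloc t₀ ht₀
    obtain ⟨k, hk0, hk1⟩ := exists_between (lt_min (lt_min hκ hδ) (lt_min h1 (sub_pos.2 h2)))
    have hkκ := hk1.trans_le ((min_le_left _ _).trans (min_le_left _ _))
    have hkδ := hk1.trans_le ((min_le_left _ _).trans (min_le_right _ _))
    have hkt := hk1.trans_le ((min_le_right _ _).trans (min_le_left _ _))
    have hkd := hk1.trans_le ((min_le_right _ _).trans (min_le_right _ _))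
    have m1 : t₀ - k ∈ Icc 0 d := ⟨by linarith, by linarith⟩
    have m2 : t₀ + k ∈ Icc 0 d := ⟨by linarith, by linarith⟩
    have a1 : |t₀ - k - t₀| = k := by rw [abs_of_neg (by linarith)]; ring
    have a2 : |t₀ + k - t₀| = k := by rw [abs_of_pos (by linarith)]; ring
    have a3 : |t₀ - k - (t₀ + k)| = 2 * k := by rw [abs_of_neg (by linarith)]; ring
    have := hk k hk0 hkκ (N (t₀ - k)) (N (t₀ + k))
      (by rw [h _ m1 _ ht₀ (by rwa [a1]) (by simpa), a1])
      (by rw [h _ m2 _ ht₀ (by rwa [a2]) (by simpa), a2])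
      (by rw [h _ m1 _ m2 (by rwa [a1]) (by rwa [a2]), a3])
    exact absurd this (not_lt.2 (max_le (hmax m1) (hmax m2)))
  have hFmax : F t₀ ≤ 2 * R - s := by
    rcases hend with h | h <;> rw [h] <;> assumption
  have hmid : d / 2 ∈ Icc 0 d := ⟨by linarith, by linarith⟩
  -- Now `2R - ρ ≤ F ≤ 2R - s` at the midpoint, whereas the chord formula gives `sinh ρ ≤ sinh s /
  -- cosh (d / 2)` there.
  have h0 : s ≤ ρ (d / 2) := by linarith [(hFlow _ hmid).trans ((hmax hmid).trans hFmax)]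
  have h1 := (hcomb _ hmid).1
  have h2 : 0 < Real.sinh (d / 2) := Real.sinh_pos_iff.2 (by linarith)
  have h3 : 0 < Real.cosh (d / 2) := Real.cosh_pos _
  have h4 : Real.sinh d = 2 * Real.sinh (d / 2) * Real.cosh (d / 2) := by
    rw [← Real.sinh_two_mul]; congr 1; ring
  rw [h4, show d - d / 2 = d / 2 by ring] at h1
  have h5 : Real.sinh (ρ (d / 2)) * Real.cosh (d / 2) ≤ Real.sinh s := by
    refine (mul_le_mul_of_nonneg_right h1 h3.le).trans (le_of_eq ?_)
    field_simp
    ring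
  have h6 := Real.sinh_le_sinh.2 h0
  have h7 := Real.one_lt_cosh.2 (half_pos hd0).ne'
  have h8 : 0 < Real.sinh s := Real.sinh_pos_iff.2 hs0
  nlinarith

/-- Distinct nearby rays which meet the singular locus at the distance `2R` do so at points of the
cover at distance at least `2R`. -/
theorem IsDevelopment.two_mul_le_dist (D : IsDevelopment Φ φ S Sg α ℓ τ R)
    (hT : HasTubeCharts Sg R) {x y : ℝ × ℝ} (hxy : x ≠ y) (hθ : |x.1 - y.1| < 1)
    (hx : MeetsSingularLocus Φ Sg R x) (hy : MeetsSingularLocus Φ Sg R y) :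
    2 * R ≤ dist (cyl (2 * R) x) (cyl (2 * R) y) := by
  have hR := D.radius_pos
  have hcont : Continuous fun s => dist (cyl s x) (cyl s y) :=
    (continuous_cyl.comp (by fun_prop : Continuous fun s : ℝ => (s, x))).dist
      (continuous_cyl.comp (by fun_prop : Continuous fun s : ℝ => (s, y)))
  -- The development is controlled only for radii below `2R`, so the bound at `2R` is a limit from
  -- the left.
  have hl : Tendsto (fun s => 2 * (s - R)) (𝓝[<] (2 * R)) (𝓝 (2 * (2 * R - R))) :=
    (Continuous.tendsto (by fun_prop) _).mono_left nhdsWithin_le_nhds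
  have := le_of_tendsto_of_tendsto hl ((hcont.tendsto _).mono_left nhdsWithin_le_nhds)
    (Filter.eventually_of_mem (Ioo_mem_nhdsLT (show R < 2 * R by linarith))
      fun s hs => D.le_dist_of_lt hT hxy hθ hx hy hs.1 hs.2)
  linarith

end MaximumPrinciple

/-! ### Invariance of the tube distance under the group -/

section TubeDist

theorem branchedDist_translate (p q : BranchedPoint) (g : ℝ × ℝ) :
    branchedDist (p.translate g) (q.translate g) = branchedDist p q := by
  refine Real.cosh_injOn (mem_Ici.2 (branchedDist_nonneg _ _))
    (mem_Ici.2 (branchedDist_nonneg _ _)) ?_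
  rw [cosh_branchedDist, cosh_branchedDist]
  simp [BranchedPoint.translate]

theorem tubeDist_translate_le {α ℓ τ : ℝ} (p q : BranchedPoint) {g h : ℝ × ℝ}
    (hg : g ∈ tubeGroup α ℓ τ) (hh : h ∈ tubeGroup α ℓ τ) :
    tubeDist α ℓ τ (p.translate g) (q.translate h) ≤ tubeDist α ℓ τ p q :=
  le_tubeDist fun k hk => by
    refine (tubeDist_le _ _ (sub_mem (add_mem hk hg) hh)).trans ?_
    rw [show (q.translate h).translate (k + g - h) = (q.translate k).translate g by
      simp only [BranchedPoint.translate, BranchedPoint.mk.injEq, Prod.fst_add, Prod.fst_sub,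
        Prod.snd_add, Prod.snd_sub]
      exact ⟨trivial, by ring, by ring⟩, branchedDist_translate]

theorem BranchedPoint.translate_neg_translate (p : BranchedPoint) (g : ℝ × ℝ) :
    (p.translate g).translate (-g) = p := by
  simp [BranchedPoint.translate]

theorem tubeDist_translate_translate {α ℓ τ : ℝ} (p q : BranchedPoint) {g h : ℝ × ℝ}
    (hg : g ∈ tubeGroup α ℓ τ) (hh : h ∈ tubeGroup α ℓ τ) :
    tubeDist α ℓ τ (p.translate g) (q.translate h) = tubeDist α ℓ τ p q := by
  refine le_antisymm (tubeDist_translate_le p q hg hh) ?_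
  have := tubeDist_translate_le (p.translate g) (q.translate h) (neg_mem hg) (neg_mem hh)
  rwa [BranchedPoint.translate_neg_translate, BranchedPoint.translate_neg_translate] at this

theorem tubeDist_eq_zero_of_dir_eq {α ℓ τ : ℝ} {p q : BranchedPoint} (hr : p.r = q.r) {g : ℝ × ℝ}
    (hg : g ∈ tubeGroup α ℓ τ) (h : p.dir = q.dir + g) : tubeDist α ℓ τ p q = 0 := by
  refine le_antisymm ((tubeDist_le p q hg).trans (le_of_eq ?_)) (tubeDist_nonneg _ _ _ _ _)
  rw [branchedDist_ray _ _ h, show (q.translate g).r = q.r from rfl, hr, sub_self, abs_zero]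

end TubeDist

/-! ### Enlarging a tube that has no contacts -/

section Enlargement

variable {M : Type*} [MetricSpace M] {φ φ' : BranchedPoint → M} {S S' Sg : Set M}
  {α ℓ τ α' ℓ' τ' R : ℝ} {Φ Φ' : ℝ → ℝ × ℝ → M}

theorem IsDevelopment.apply_eq (D : IsDevelopment Φ φ S Sg α ℓ τ R) {p : BranchedPoint}
    (hp : p.r < R) : Φ p.r p.dir = φ p := by
  rw [D.eq_tube _ hp, cylCoord_apply]

theorem IsDevelopment.eq_of_lt (D : IsDevelopment Φ φ S Sg α ℓ τ R) {r : ℝ} (h0 : 0 ≤ r)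
    (hr : r < R) (u : ℝ × ℝ) : Φ r u = φ ⟨r, u.1, u.2, h0⟩ :=
  D.apply_eq (p := ⟨r, u.1, u.2, h0⟩) hr

theorem IsDevelopment.mem_thickening (D : IsDevelopment Φ φ S Sg α ℓ τ R) {r : ℝ} (h0 : 0 ≤ r)
    (hr : r < R) (u : ℝ × ℝ) : Φ r u ∈ thickening R S := by
  rw [D.eq_of_lt h0 hr, ← D.tube.2.1]
  exact mem_image_of_mem φ hr

/-- Coincidences between points just outside two tubes accumulate at a point of contact. -/
theorem IsDevelopment.exists_contact (D : IsDevelopment Φ φ S Sg α ℓ τ R)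
    (D' : IsDevelopment Φ' φ' S' Sg α' ℓ' τ' R) {P : ℝ → ℝ × ℝ → ℝ → ℝ × ℝ → Prop}
    (hP : ∀ r u r' v, P r u r' v → ∀ g ∈ tubeGroup α ℓ τ, ∀ g' ∈ tubeGroup α' ℓ' τ',
      P r (u + g) r' (v + g'))
    (h : ∀ ε > 0, ∃ r u r' v, R ≤ r ∧ r < R + ε ∧ 0 ≤ r' ∧ r' < R + ε ∧ Φ r u = Φ' r' v ∧
      P r u r' v) :
    ∃ x y, Φ R x = Φ' R y ∧ ∀ η > 0, ∃ r u r' v, |r - R| < η ∧ ‖u - x‖ < η ∧ |r' - R| < η ∧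
      ‖v - y‖ < η ∧ Φ r u = Φ' r' v ∧ P r u r' v := by
  have hR := D.radius_pos
  have hseq : ∀ n : ℕ, ∃ (a b : ℝ × ℝ × ℝ), |a.1 - R| ≤ R / (n + 2) ∧ |b.1 - R| ≤ R / (n + 2) ∧
      a.2 ∈ Icc (0 : ℝ × ℝ) (α, ℓ) ∧ b.2 ∈ Icc (0 : ℝ × ℝ) (α', ℓ') ∧
      Φ a.1 a.2 = Φ' b.1 b.2 ∧ P a.1 a.2 b.1 b.2 := by
    intro n
    have hε : 0 < R / ((n : ℝ) + 2) := by positivity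
    have hεR : R / ((n : ℝ) + 2) < R := div_lt_self hR (by
      have : (0 : ℝ) ≤ n := n.cast_nonneg
      linarith)
    obtain ⟨r, u, r', v, h1, h2, h3, h4, h5, h6⟩ := h _ hε
    obtain ⟨g, hg, hgm⟩ := exists_tubeGroup_add_mem_Icc D.angle_pos D.length_pos τ u
    obtain ⟨g', hg', hgm'⟩ := exists_tubeGroup_add_mem_Icc D'.angle_pos D'.length_pos τ' v
    refine ⟨(r, u + g), (r', v + g'), ?_, ?_, hgm, hgm', ?_, hP _ _ _ _ h6 g hg g' hg'⟩
    · rw [abs_le]; constructor <;> simp only <;> linarith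
    · have h7 : R - R / ((n : ℝ) + 2) ≤ r' := by
        rcases lt_or_ge r' R with hr' | hr'
        · have h8 := D.le_infDist (r := r) (by linarith) (by linarith) u
          rw [h5, D'.infDist_tube r' h3 hr', min_eq_right (by linarith)] at h8
          linarith
        · linarith
      rw [abs_le]; constructor <;> simp only <;> linarith
    · simp only
      rw [D.translate (by linarith) (by linarith) u hg,
        D'.translate h3 (by linarith) v hg', h5]
  choose a b ha hb hau hbv hab hPab using hseq
  obtain ⟨⟨x, y⟩, -, κ, hκ, hlim⟩ := (isCompact_Icc.prod isCompact_Icc).tendsto_subseq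
    (x := fun n => ((a n).2, (b n).2)) fun n => mem_prod.2 ⟨hau n, hbv n⟩
  have hto : Tendsto (fun n : ℕ => R / ((n : ℝ) + 2)) atTop (𝓝 0) :=
    tendsto_const_nhds.div_atTop (tendsto_atTop_add_const_right _ _ tendsto_natCast_atTop_atTop)
  have har : Tendsto (fun n => (a (κ n)).1) atTop (𝓝 R) := by
    rw [tendsto_iff_dist_tendsto_zero]
    exact squeeze_zero (fun _ => dist_nonneg) (fun n => ha (κ n)) (hto.comp hκ.tendsto_atTop)
  have hbr : Tendsto (fun n => (b (κ n)).1) atTop (𝓝 R) := by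
    rw [tendsto_iff_dist_tendsto_zero]
    exact squeeze_zero (fun _ => dist_nonneg) (fun n => hb (κ n)) (hto.comp hκ.tendsto_atTop)
  rw [nhds_prod_eq] at hlim
  have hax : Tendsto (fun n => (a (κ n)).2) atTop (𝓝 x) := hlim.fst
  have hby : Tendsto (fun n => (b (κ n)).2) atTop (𝓝 y) := hlim.snd
  have ha' : Tendsto (fun n => a (κ n)) atTop (𝓝 (R, x)) := har.prodMk_nhds hax
  have hb' : Tendsto (fun n => b (κ n)) atTop (𝓝 (R, y)) := hbr.prodMk_nhds hby
  refine ⟨x, y, ?_, fun η hη => ?_⟩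
  · have h1 := ((D.locIsoAt R hR (by linarith) x).continuousAt hR).tendsto.comp ha'
    have h2 := ((D'.locIsoAt R hR (by linarith) y).continuousAt hR).tendsto.comp hb'
    refine tendsto_nhds_unique h1 (h2.congr fun n => ?_)
    simp only [Function.comp_apply]
    exact (hab (κ n)).symm
  · have h1 := Metric.tendsto_nhds.1 ha' η hη
    have h2 := Metric.tendsto_nhds.1 hb' η hη
    obtain ⟨n, hn1, hn2⟩ := (h1.and h2).exists
    rw [Prod.dist_eq, max_lt_iff, Real.dist_eq, dist_eq_norm] at hn1 hn2
    exact ⟨_, _, _, _, hn1.1, hn1.2, hn2.1, hn2.2, hab (κ n), hPab (κ n)⟩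

/-- The local isometry is injective near every point. -/
theorem LocIsoAt.injective_near {r : ℝ} {u : ℝ × ℝ} (hr : 0 < r) (h : LocIsoAt Φ r u) :
    ∃ η > 0, ∀ r₁ r₂ u₁ u₂, |r₁ - r| < η → |r₂ - r| < η → ‖u₁ - u‖ < η → ‖u₂ - u‖ < η →
      Φ r₁ u₁ = Φ r₂ u₂ → r₁ = r₂ ∧ u₁ = u₂ := by
  obtain ⟨δ, hδ, -, Ψ, hΨ, -, -, η, hη, hb⟩ := h.exists_isoOn hr one_pos
  refine ⟨min η (min 1 r), lt_min hη (lt_min one_pos hr), fun r₁ r₂ u₁ u₂ h1 h2 h3 h4 he => ?_⟩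
  have b1 := hb r₁ u₁ (h1.trans_le (min_le_left _ _)) (h3.trans_le (min_le_left _ _))
  have b2 := hb r₂ u₂ (h2.trans_le (min_le_left _ _)) (h4.trans_le (min_le_left _ _))
  have hr1 := abs_lt.1 (h1.trans_le ((min_le_right _ _).trans (min_le_right _ _)))
  have hr2 := abs_lt.1 (h2.trans_le ((min_le_right _ _).trans (min_le_right _ _)))
  have n3 := h3.trans_le ((min_le_right _ _).trans (min_le_left _ _))
  have n4 := h4.trans_le ((min_le_right _ _).trans (min_le_left _ _))
  refine cyl_injective (by linarith) (by linarith) ?_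
    (hΨ.injOn b1.1 b2.1 (by rw [b1.2, b2.2, he]))
  have h5 := abs_fst_le_norm (u₁ - u₂)
  have h6 := norm_sub_le_norm_sub_add_norm_sub u₁ u u₂
  rw [norm_sub_rev u u₂] at h6
  refine h5.trans (by linarith [Real.pi_gt_three])

/-- Near the boundary of the tube, points are reached by the development without gain of
distance from the axis. -/
theorem IsDevelopment.exists_uniform_radius (D : IsDevelopment Φ φ S Sg α ℓ τ R) :
    ∃ δ > 0, ∀ r ∈ Icc (R / 2) R, ∀ u, ∀ w ∈ ball (Φ r u) δ,
      ∃ r' v, 0 ≤ r' ∧ Φ r' v = w ∧ r' ≤ r + dist w (Φ r u) := by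
  have hR := D.radius_pos
  -- The local charts work for all small `δ` near each point; compactness modulo the group makes the
  -- choice uniform.
  have key : ∀ᶠ δ in 𝓝 (0 : ℝ), ∀ p ∈ Icc (R / 2) R ×ˢ Icc (0 : ℝ × ℝ) (α, ℓ),
      ∀ w ∈ ball (Φ p.1 p.2) δ, ∃ r' v, 0 ≤ r' ∧ Φ r' v = w ∧
        r' ≤ p.1 + dist w (Φ p.1 p.2) := by
    refine (isCompact_Icc.prod isCompact_Icc).eventually_forall_of_forall_eventually ?_
    rintro ⟨r₀, u₀⟩ hp
    have hr₀ : 0 < r₀ := (half_pos hR).trans_le hp.1.1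
    obtain ⟨δ, hδ, -, Ψ, hΨ, -, hcyl, η, hη, hb⟩ :=
      (D.locIsoAt r₀ hr₀ (by linarith [hp.1.2]) u₀).exists_isoOn hr₀ one_pos
    obtain ⟨η', hη', hbox⟩ := exists_box_subset_ball r₀ u₀ (half_pos hδ)
    have hη2 : 0 < min (min η η') (min (δ / 2) r₀) :=
      lt_min (lt_min hη hη') (lt_min (half_pos hδ) hr₀)
    filter_upwards [Metric.ball_mem_nhds (((0 : ℝ), (r₀, u₀)) : ℝ × ℝ × ℝ × ℝ) hη2] with z hz
    obtain ⟨δ', r, u⟩ := z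
    rw [mem_ball, Prod.dist_eq, max_lt_iff, Prod.dist_eq, max_lt_iff, Real.dist_eq, Real.dist_eq,
      dist_eq_norm] at hz
    obtain ⟨h1, h2, h3⟩ := hz
    simp only at h1 h2 h3
    intro w hw
    have hδ' : δ' < δ / 2 := by
      have := h1.trans_le ((min_le_right _ _).trans (min_le_left _ _))
      rw [sub_zero] at this
      exact lt_of_abs_lt this
    have b1 := hb r u (h2.trans_le ((min_le_left _ _).trans (min_le_left _ _)))
      (h3.trans_le ((min_le_left _ _).trans (min_le_left _ _)))
    have b2 := hbox r u (h2.trans_le ((min_le_left _ _).trans (min_le_right _ _)))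
      (h3.trans_le ((min_le_left _ _).trans (min_le_right _ _)))
    have hr0 : 0 < r := by
      have := abs_lt.1 (h2.trans_le ((min_le_right _ _).trans (min_le_right _ _)))
      linarith [this.1]
    obtain ⟨x, hx, rfl⟩ := hΨ.exists_eq (w := w) (by
      have h4 := hΨ.dist_center b1.1
      rw [b1.2] at h4
      rw [mem_ball] at hw b2 ⊢
      linarith [dist_triangle w (Φ r u) (Ψ (cyl r₀ u₀))])
    obtain ⟨r', v, hr', -, -, rfl, he⟩ := hcyl x hx
    refine ⟨r', v, hr'.le, he.symm, ?_⟩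
    change r' ≤ r + dist _ (Φ r u)
    rw [← b1.2, hΨ.1 _ hx _ b1.1]
    linarith [(abs_le.1 (abs_sub_le_dist_cyl hr'.le hr0.le v u)).2]
  obtain ⟨ε, hε, h⟩ := Metric.eventually_nhds_iff.1 key
  refine ⟨ε / 2, half_pos hε, fun r hr u w hw => ?_⟩
  obtain ⟨g, hg, hgm⟩ := exists_tubeGroup_add_mem_Icc D.angle_pos D.length_pos τ u
  have h1 := h (y := ε / 2) (by rw [Real.dist_eq, sub_zero, abs_of_pos (half_pos hε)]; linarith)
    (r, u + g) ⟨hr, hgm⟩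
  have ht : Φ r (u + g) = Φ r u := by
    have h2 : 0 ≤ r := by linarith [hr.1]
    have h3 : r < 2 * R := by linarith [hr.2]
    exact D.translate h2 h3 u hg
  simp only at h1
  rw [ht] at h1
  exact h1 w hw

/-- A development is locally isometric for the distance in the model tube. -/
theorem IsDevelopment.image_ball_eq (D : IsDevelopment Φ φ S Sg α ℓ τ R) {ρ : ℝ}
    (hρ : ρ ≤ 2 * R) {p : BranchedPoint} (h0 : 0 < p.r) (hp : p.r < ρ) : ∃ δ > 0,
    (fun q : BranchedPoint => Φ q.r q.dir) '' {q | q.r < ρ ∧ tubeDist α ℓ τ p q < δ} =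
      ball (Φ p.r p.dir) δ ∧
    ∀ q q' : BranchedPoint, q.r < ρ → q'.r < ρ → tubeDist α ℓ τ p q < δ →
      tubeDist α ℓ τ p q' < δ → dist (Φ q.r q.dir) (Φ q'.r q'.dir) = tubeDist α ℓ τ q q' := by
  have hp2 := half_pos h0
  obtain ⟨η, hη, δ₁, hδ₁, htube⟩ :=
    exists_tubeDist_eq_branchedDist D.angle_pos D.length_pos τ hp2
  set η' := min (η / 2) (1 / 2) with hη'
  have hη'0 : 0 < η' := lt_min (by positivity) (by norm_num)
  obtain ⟨δ₂, hδ₂, hdir⟩ := exists_branchedDist_imp_dir hp2 hη'0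
  obtain ⟨δ₀, hδ₀, -, Ψ, hΨ₀, hmatch₀, hcyl₀, -⟩ :=
    (D.locIsoAt p.r h0 (hp.trans_le hρ) p.dir).exists_isoOn h0 hη'0
  obtain ⟨δ, hδ, hd0, hd1, hd2, hd4⟩ : ∃ δ > 0, δ ≤ δ₀ ∧ δ ≤ δ₁ / 2 ∧ δ ≤ δ₂ ∧
      δ ≤ min (p.r / 2) (ρ - p.r) :=
    ⟨min (min (δ₁ / 2) δ₂) (min δ₀ (min (p.r / 2) (ρ - p.r))),
      lt_min (lt_min (by positivity) hδ₂) (lt_min hδ₀ (lt_min hp2 (by linarith))),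
      (min_le_right _ _).trans (min_le_left _ _),
      (min_le_left _ _).trans (min_le_left _ _), (min_le_left _ _).trans (min_le_right _ _),
      (min_le_right _ _).trans (min_le_right _ _)⟩
  have hd5 := hd4.trans (min_le_left _ _)
  have hd6 := hd4.trans (min_le_right _ _)
  have hΨ := hΨ₀.mono hd0
  have hnear : ∀ q : BranchedPoint, branchedDist p q < δ →
      p.r / 2 ≤ q.r ∧ q.r < ρ ∧ ‖p.dir - q.dir‖ < η' ∧ cyl q.r q.dir ∈ ball (cyl p.r p.dir) δ ∧
        Ψ (cyl q.r q.dir) = Φ q.r q.dir := fun q hq => by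
    have h1 := (abs_lt.1 ((abs_sub_r_le_branchedDist p q).trans_lt hq))
    have h2 : p.r / 2 ≤ q.r := by linarith [h1.1, h1.2]
    have h3 := hdir p q (by linarith) h2 (hq.trans_le hd2)
    have h4 : |p.θ - q.θ| ≤ 1 := (abs_fst_le_norm (p.dir - q.dir)).trans
      (by linarith [min_le_right (η / 2) (1 / 2 : ℝ)])
    have h5 : cyl q.r q.dir ∈ ball (cyl p.r p.dir) δ := by
      rw [mem_ball, dist_comm, ← branchedDist_eq_dist (h4.trans (by linarith [Real.pi_gt_three]))]
      exact hq
    refine ⟨h2, by linarith [h1.1], h3, h5, (hmatch₀ q.r q.dir q.r_nonneg ?_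
      (ball_subset_ball hd0 h5)).1⟩
    rw [abs_sub_comm]; exact h4
  have hlift : ∀ q : BranchedPoint, q.r < ρ → tubeDist α ℓ τ p q < δ → ∃ g ∈ tubeGroup α ℓ τ,
      branchedDist p (q.translate g) < δ ∧ Φ (q.translate g).r (q.translate g).dir = Φ q.r q.dir :=
    fun q hq hpq => by
      obtain ⟨g, hg, h1⟩ := exists_branchedDist_lt_of_tubeDist_lt hpq
      exact ⟨g, hg, h1, D.translate q.r_nonneg (hq.trans_le hρ) q.dir hg⟩
  have hdist : ∀ q q' : BranchedPoint, q.r < ρ → q'.r < ρ → tubeDist α ℓ τ p q < δ →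
      tubeDist α ℓ τ p q' < δ → dist (Φ q.r q.dir) (Φ q'.r q'.dir) = tubeDist α ℓ τ q q' := by
    intro q q' hq hq' h h'
    obtain ⟨g, hg, h1, h2⟩ := hlift q hq h
    obtain ⟨g', hg', h1', h2'⟩ := hlift q' hq' h'
    obtain ⟨n1, n2, n3, n4, n5⟩ := hnear _ h1
    obtain ⟨n1', n2', n3', n4', n5'⟩ := hnear _ h1'
    have hxy : ‖(q.translate g).dir - (q'.translate g').dir‖ < 2 * η' := by
      rw [show (q.translate g).dir - (q'.translate g').dir = (p.dir - (q'.translate g').dir) -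
        (p.dir - (q.translate g).dir) by abel]
      linarith [norm_sub_le (p.dir - (q'.translate g').dir) (p.dir - (q.translate g).dir)]
    have hb : branchedDist (q.translate g) (q'.translate g') =
        dist (cyl (q.translate g).r (q.translate g).dir)
          (cyl (q'.translate g').r (q'.translate g').dir) := by
      refine branchedDist_eq_dist ((abs_fst_le_norm
        ((q.translate g).dir - (q'.translate g').dir)).trans ?_)
      linarith [min_le_right (η / 2) (1 / 2 : ℝ), Real.pi_gt_three]
    rw [← tubeDist_translate_translate q q' hg hg', ← h2, ← h2', ← n5, ← n5', hΨ.1 _ n4 _ n4',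
      ← hb]
    refine (htube _ _ n1 n1' ?_ ?_).symm
    · linarith [min_le_left (η / 2) (1 / 2 : ℝ)]
    · rw [hb]
      rw [mem_ball] at n4 n4'
      linarith [dist_triangle_right (cyl (q.translate g).r (q.translate g).dir)
        (cyl (q'.translate g').r (q'.translate g').dir) (cyl p.r p.dir)]
  have hpp : tubeDist α ℓ τ p p < δ := by rwa [tubeDist_self]
  refine ⟨δ, hδ, ?_, hdist⟩
  ext w
  constructor
  · rintro ⟨q, ⟨hq, hpq⟩, rfl⟩
    rw [mem_ball, dist_comm, hdist p q hp hq hpp hpq]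
    exact hpq
  · intro hw
    have hΨp := (hnear p (by rwa [branchedDist_self])).2.2.2.2
    obtain ⟨x, hx, rfl⟩ := hΨ.exists_eq (w := w) (by rwa [hΨp])
    obtain ⟨r', v, hr', -, hv, rfl, he⟩ := hcyl₀ x (ball_subset_ball hd0 hx)
    have h1 : branchedDist p ⟨r', v.1, v.2, hr'.le⟩ < δ := by
      rw [branchedDist_eq_dist, dist_comm]
      · exact hx
      · have h2 := abs_fst_le_norm (v - p.dir)
        have h3 : |p.θ - v.1| = |(v - p.dir).1| := abs_sub_comm _ _
        rw [h3]
        linarith [min_le_right (η / 2) (1 / 2 : ℝ), Real.pi_gt_three]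
    exact ⟨⟨r', v.1, v.2, hr'.le⟩, ⟨(hnear _ h1).2.1,
      (tubeDist_le_branchedDist _ _ _ _ _).trans_lt h1⟩, he.symm⟩

/-- A tube whose development is injective modulo the group slightly beyond the boundary can be
enlarged. -/
theorem IsDevelopment.isTubeMap_enlarge (hM : IsLengthSpace M)
    (D : IsDevelopment Φ φ S Sg α ℓ τ R) {ε : ℝ} (hε : 0 < ε)
    (hinj : ∀ r r' u v, R ≤ r → r < R + ε → 0 ≤ r' → r' < R + ε → Φ r u = Φ r' v →
      r = r' ∧ ∃ g ∈ tubeGroup α ℓ τ, u = v + g) :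
    ∃ ε' > 0, ε' ≤ ε ∧ IsTubeMap (fun q => Φ q.r q.dir) S α ℓ τ (R + ε') := by
  have hR := D.radius_pos
  obtain ⟨δ, hδ, hunif⟩ := D.exists_uniform_radius
  obtain ⟨ε', hε', h1, h2, h3⟩ : ∃ ε' > 0, ε' ≤ ε ∧ 2 * ε' ≤ δ ∧ ε' ≤ R / 4 :=
    ⟨min ε (min (δ / 2) (R / 4)), lt_min hε (lt_min (half_pos hδ) (by positivity)),
      min_le_left _ _, by linarith [(min_le_right ε (min (δ / 2) (R / 4))).trans (min_le_left _ _)],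
      (min_le_right _ _).trans (min_le_right _ _)⟩
  refine ⟨ε', hε', h1, ?_, ?_, fun p q hp hq he => ?_, fun p hp => ?_⟩
  · rw [← D.tube.1]
    refine image_congr fun p hp => D.apply_eq ?_
    rw [show p.r = 0 from hp]; exact hR
  · ext w
    rw [mem_thickening_iff_infDist_lt D.tube.nonempty]
    constructor
    · rintro ⟨p, hp, rfl⟩
      have hp' : p.r < R + ε' := hp
      exact (D.infDist_core_le p.r_nonneg (by linarith) p.dir).trans_lt hp'
    · intro hw
      rcases lt_or_ge (infDist w S) R with hlt | hge
      · have h4 := (mem_thickening_iff_infDist_lt D.tube.nonempty).2 hlt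
        rw [← D.tube.2.1] at h4
        obtain ⟨p, hp, rfl⟩ := h4
        have hp' : p.r < R := hp
        exact ⟨p, show p.r < R + ε' by linarith, D.apply_eq hp⟩
      -- To reach a point `w` of the new shell, step back along a nearly shortest path to a point of
      -- the tube with `r < R - ε'` at distance less than `2ε'` from `w`. The uniform radius then
      -- gives coordinates for `w` with `r' < (R - ε') + 2ε'`.
      obtain ⟨s, hs, hsw⟩ := (infDist_lt_iff D.tube.nonempty).1 hw
      obtain ⟨w', hw1, hw2⟩ := hM.exists_between (x := s) (y := w) (a := R - ε') (b := 2 * ε')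
        (by linarith) (by linarith) (by rw [dist_comm]; linarith)
      have h4 : infDist w' S < R - ε' :=
        (infDist_le_dist_of_mem hs).trans_lt (by rwa [dist_comm])
      have h5 := (mem_thickening_iff_infDist_lt D.tube.nonempty).2
        (show infDist w' S < R by linarith)
      rw [← D.tube.2.1] at h5
      obtain ⟨p, hp, rfl⟩ := h5
      have hpR : p.r < R := hp
      rw [D.tube.infDist_eq hM hpR] at h4
      have h6 := infDist_le_infDist_add_dist (s := S) (x := w) (y := φ p)
      rw [D.tube.infDist_eq hM hpR, dist_comm] at h6
      rw [← D.apply_eq hpR] at hw2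
      obtain ⟨r', v, hr', he, hle⟩ := hunif p.r ⟨by
        rw [← D.apply_eq hpR] at h6; linarith, hpR.le⟩ p.dir w (by
          rw [mem_ball, dist_comm]; linarith)
      rw [dist_comm] at hle
      exact ⟨⟨r', v.1, v.2, hr'⟩, show r' < R + ε' by linarith, he⟩
  · simp only at he
    rcases lt_or_ge p.r R with hpR | hpR
    · rcases lt_or_ge q.r R with hqR | hqR
      · rw [D.apply_eq hpR, D.apply_eq hqR] at he
        exact D.tube.2.2.1 p q hpR hqR he
      · obtain ⟨h4, g, hg, h5⟩ := hinj q.r p.r q.dir p.dir hqR (by linarith) p.r_nonneg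
          (by linarith) he.symm
        refine tubeDist_eq_zero_of_dir_eq h4.symm (neg_mem hg) ?_
        rw [h5, add_neg_cancel_right]
    · obtain ⟨h4, g, hg, h5⟩ := hinj p.r q.r p.dir q.dir hpR (by linarith) q.r_nonneg
        (by linarith) he
      exact tubeDist_eq_zero_of_dir_eq h4 hg h5
  · rcases lt_or_ge p.r R with hpR | hpR
    · obtain ⟨d, hd, hball⟩ := D.tube.image_ball_eq hpR
      have hlt : ∀ q : BranchedPoint, tubeDist α ℓ τ p q < min d (R - p.r) → q.r < R := by
        intro q hq
        have := (abs_lt.1 ((abs_sub_r_le_tubeDist α ℓ τ p q).trans_lt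
          (hq.trans_le (min_le_right _ _)))).1
        linarith
      refine ⟨min d (R - p.r), lt_min hd (sub_pos.2 hpR), ?_, fun q q' _ _ hq hq' => ?_⟩
      · simp only [D.apply_eq hpR]
        rw [← (hball _ (min_le_left _ _)).1]
        have hset : {q : BranchedPoint | q.r < R + ε' ∧ tubeDist α ℓ τ p q < min d (R - p.r)} =
            {q | q.r < R ∧ tubeDist α ℓ τ p q < min d (R - p.r)} := by
          ext q
          exact and_congr_left fun hq => ⟨fun _ => hlt q hq, fun h => by linarith⟩
        rw [hset]
        exact image_congr fun q hq => D.apply_eq hq.1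
      · simp only [D.apply_eq (hlt q hq), D.apply_eq (hlt q' hq')]
        exact (hball _ (min_le_left _ _)).2 q q' (hlt q hq) (hlt q' hq') hq hq'
    · exact D.image_ball_eq (by linarith) (hR.trans_le hpR) hp

end Enlargement

/-! ### Contacts and maximal tubes in a cone-manifold -/

namespace HyperbolicConeManifold

variable {M : Type*} [MetricSpace M] {ι : Type*} {C : HyperbolicConeManifold M ι} {R : ℝ}

theorem isLengthSpace (C : HyperbolicConeManifold M ι) : IsLengthSpace M := C.length_metric

theorem component_subset (C : HyperbolicConeManifold M ι) (i : ι) :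
    C.component i ⊆ C.singularLocus := subset_iUnion C.component i

/-- The charts of the structure go from `M` to hyperbolic space; continuation along rays uses their
inverses. -/
theorem exists_chart (C : HyperbolicConeManifold M ι) {x : M}
    (hx : 0 < infDist x C.singularLocus) :
    ∃ ε > 0, ∃ χ : HypSpace → M, ∃ y, IsoOn χ y ε ∧ χ y = x := by
  have hx' : x ∉ ⋃ i, C.component i := fun h => hx.ne' (infDist_zero_of_mem h)
  obtain ⟨ε, hε, f, himg, hd⟩ := C.locally_hyperbolic x hx'
  have : Nonempty M := ⟨x⟩
  have hball : ∀ p ∈ ball (f x) ε, p ∈ f '' ball x ε := fun p hp => by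
    rw [himg]
    exact mem_ball'.1 hp
  have hinj : InjOn f (ball x ε) := fun a ha b hb hab => by
    have h1 := hd a ha b hb
    rw [hab] at h1
    exact dist_eq_zero.1 (h1.symm.trans (dist_self (f b)))
  have hxx : Function.invFunOn f (ball x ε) (f x) = x := by
    have hm := hball (f x) (mem_ball_self hε)
    exact hinj (Function.invFunOn_mem hm) (mem_ball_self hε) (Function.invFunOn_eq hm)
  refine ⟨ε, hε, Function.invFunOn f (ball x ε), f x, ⟨fun p hp q hq => ?_, ?_⟩, hxx⟩
  · have h1 := hball p hp
    have h2 := hball q hq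
    rw [← hd _ (Function.invFunOn_mem h1) _ (Function.invFunOn_mem h2),
      Function.invFunOn_eq h1, Function.invFunOn_eq h2]
    rfl
  · rw [hxx]
    ext w
    constructor
    · rintro ⟨p, hp, rfl⟩
      exact Function.invFunOn_mem (hball p hp)
    · intro hw
      have h1 : f w ∈ f '' ball x ε := mem_image_of_mem f hw
      refine ⟨f w, ?_, hinj (Function.invFunOn_mem h1) hw (Function.invFunOn_eq h1)⟩
      rw [himg] at h1
      exact mem_ball'.2 h1

/-- A point of another component nearer than the core would put `φ p` into a second tube, against
disjointness. -/
theorem EmbeddedTubes.infDist_eq (h : C.EmbeddedTubes fun _ => R) {i : ι}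
    {φ : BranchedPoint → M}
    (hφ : IsTubeMap φ (C.component i) (C.coneAngle i) (C.length i) (C.twist i) R)
    {p : BranchedPoint} (hp : p.r < R) : infDist (φ p) C.singularLocus = p.r := by
  have h1 := hφ.infDist_eq C.isLengthSpace hp
  refine le_antisymm ((infDist_le_infDist_of_subset (C.component_subset i) hφ.nonempty).trans h1.le)
    ?_
  by_contra! hlt
  obtain ⟨s, hs, hd⟩ := (infDist_lt_iff (hφ.nonempty.mono (C.component_subset i))).1 hlt
  obtain ⟨j, hj⟩ := mem_iUnion.1 hs
  have h2 : φ p ∈ thickening R (C.component j) := mem_thickening_iff.2 ⟨s, hj, hd.trans hp⟩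
  have h3 : φ p ∈ thickening R (C.component i) := hφ.2.1 ▸ mem_image_of_mem φ hp
  obtain rfl : i = j := by
    by_contra hij
    exact disjoint_left.1 (h.2 hij) h3 h2
  linarith [infDist_le_dist_of_mem hj (x := φ p)]

/-- The tubes of radius `R` have developments of radius `2 R`. -/
def Developments (C : HyperbolicConeManifold M ι) (R : ℝ) (φ : ι → BranchedPoint → M)
    (Φ : ι → ℝ → ℝ × ℝ → M) : Prop :=
  ∀ i, IsDevelopment (Φ i) (φ i) (C.component i) C.singularLocus (C.coneAngle i) (C.length i)
    (C.twist i) R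

theorem EmbeddedTubes.exists_developments [CompleteSpace M] (h : C.EmbeddedTubes fun _ => R) :
    ∃ φ Φ, C.Developments R φ Φ := by
  have h1 : ∀ i, ∃ φ Φ, IsDevelopment Φ φ (C.component i) C.singularLocus (C.coneAngle i)
      (C.length i) (C.twist i) R := fun i => by
    obtain ⟨hR, φ, hφ⟩ := h.1 i
    have hφ' : IsTubeMap φ (C.component i) (C.coneAngle i) (C.length i) (C.twist i) R := hφ
    exact ⟨φ, hφ'.exists_development (fun _ => C.exists_chart) hR (C.coneAngle_pos i)
      (C.length_pos i) fun p hp => h.infDist_eq hφ' hp⟩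
  choose φ Φ hΦ using h1
  exact ⟨φ, Φ, hΦ⟩

variable {φ : ι → BranchedPoint → M} {Φ : ι → ℝ → ℝ × ℝ → M}

theorem Developments.hasTubeCharts (D : C.Developments R φ Φ) :
    HasTubeCharts C.singularLocus R := by
  intro w h0 hw
  have hne : C.singularLocus.Nonempty := by
    rw [nonempty_iff_ne_empty]
    rintro he
    rw [he, infDist_empty] at h0
    exact h0.false
  obtain ⟨s, hs, hd⟩ := (infDist_lt_iff hne).1 hw
  obtain ⟨i, hi⟩ := mem_iUnion.1 hs
  have h1 : w ∈ thickening R (C.component i) := mem_thickening_iff.2 ⟨s, hi, hd⟩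
  rw [← (D i).tube.2.1] at h1
  obtain ⟨p, hp, rfl⟩ := h1
  have hp' : p.r < R := hp
  have h2 := (D i).infDist_tube p.r p.r_nonneg hp p.dir
  rw [(D i).apply_eq hp] at h2
  rw [h2] at h0
  exact ⟨Φ i, p.r, p.dir, h0, hp, (D i).apply_eq hp, (D i).locIsoAt p.r h0 (by linarith) _,
    (D i).infDist_tube⟩

/-- A maximal tube touches itself or another tube. -/
theorem Developments.exists_contact [Finite ι] (D : C.Developments R φ Φ)
    (h : C.EmbeddedTubes fun _ => R) {c : ι} (hc : C.TubeIsMaximalAt R c) :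
    ∃ j x y, Φ c R x = Φ j R y ∧
      (j = c → x - y ∉ tubeGroup (C.coneAngle c) (C.length c) (C.twist c)) := by
  classical
  have hR := (D c).radius_pos
  by_contra! hno
  -- Nontrivial coincidences in ever thinner shells would accumulate at a contact. That contact is
  -- trivial by assumption, and the local injectivity of `Φ` there makes the nearby coincidences
  -- trivial as well.
  have hε : ∀ j, ∃ ε > 0, ∀ r u r' v, R ≤ r → r < R + ε → 0 ≤ r' → r' < R + ε →
      Φ c r u = Φ j r' v → j = c ∧ r = r' ∧
        ∃ g ∈ tubeGroup (C.coneAngle c) (C.length c) (C.twist c), u = v + g := by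
    intro j
    by_contra! hcon
    obtain ⟨x, y, hxy, hnear⟩ := (D c).exists_contact (D j)
      (P := fun r u r' v => ¬ (j = c ∧ r = r' ∧
        ∃ g ∈ tubeGroup (C.coneAngle c) (C.length c) (C.twist c), u = v + g))
      (fun r u r' v hP g hg g' hg' hn => by
        obtain ⟨rfl, hr, k, hk, he⟩ := hn
        refine hP ⟨rfl, hr, g' + k - g, sub_mem (add_mem hg' hk) hg, ?_⟩
        rw [eq_sub_of_add_eq he]; abel)
      (fun ε hε => by
        obtain ⟨r, u, r', v, h1, h2, h3, h4, h5, h6⟩ := hcon ε hε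
        exact ⟨r, u, r', v, h1, h2, h3, h4, h5, fun hn => by
          obtain ⟨hj, hr, g, hg, he⟩ := hn
          exact h6 hj hr g hg he⟩)
    obtain ⟨rfl, hg⟩ := hno j x y hxy
    obtain ⟨η, hη, hinj⟩ := ((D j).locIsoAt R hR (by linarith) x).injective_near hR
    obtain ⟨r, u, r', v, h1, h2, h3, h4, h5, h6⟩ := hnear (min η R) (lt_min hη hR)
    have h3' := abs_lt.1 (h3.trans_le (min_le_right _ _))
    have ht := (D j).translate (by linarith [h3'.1]) (by linarith [h3'.2]) v hg
    obtain ⟨hr, hu⟩ := hinj r r' u (v + (x - y)) (h1.trans_le (min_le_left _ _))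
      (h3.trans_le (min_le_left _ _)) (h2.trans_le (min_le_left _ _))
      (by rw [show v + (x - y) - x = v - y by abel]; exact h4.trans_le (min_le_left _ _))
      (by rw [ht, h5])
    exact h6 ⟨rfl, hr, x - y, hg, hu⟩
  choose ε hε0 hεinj using hε
  have : Nonempty ι := ⟨c⟩
  obtain ⟨i₀, hi₀⟩ := Finite.exists_min ε
  obtain ⟨ε', hε', hle, htube⟩ := (D c).isTubeMap_enlarge C.isLengthSpace (hε0 i₀)
    (fun r r' u v h1 h2 h3 h4 h5 => (hεinj c r u r' v h1 (by linarith [hi₀ c]) h3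
      (by linarith [hi₀ c]) h5).2)
  have hdisj : ∀ j, j ≠ c →
      Disjoint (thickening (R + ε') (C.component c)) (thickening R (C.component j)) := by
    intro j hj
    rw [disjoint_left]
    intro w hw hw'
    have hw0 := hw'
    rw [← htube.2.1] at hw
    rw [← (D j).tube.2.1] at hw'
    obtain ⟨q, hq, rfl⟩ := hw
    obtain ⟨p, hp, hpq⟩ := hw'
    have hq' : q.r < R + ε' := hq
    have hp' : p.r < R := hp
    rw [← (D j).apply_eq hp] at hpq
    rcases lt_or_ge q.r R with hqR | hqR
    · exact disjoint_left.1 (h.2 hj.symm) ((D c).mem_thickening q.r_nonneg hqR q.dir) hw0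
    · exact hj (hεinj j q.r q.dir p.r p.dir hqR (by linarith [hi₀ j]) p.r_nonneg
        (by linarith [hi₀ j]) hpq.symm).1
  have hmax := hc (Function.update (fun _ => R) c (R + ε'))
    (fun i hi => by rw [Function.update_of_ne hi])
    ⟨fun i => ?_, fun i j hij => ?_⟩
  · rw [Function.update_self] at hmax
    linarith
  · rcases eq_or_ne i c with rfl | hi
    · rw [Function.update_self]
      exact ⟨by linarith, _, htube⟩
    · rw [Function.update_of_ne hi]
      exact h.1 i
  · change Disjoint _ _
    rcases eq_or_ne i c with rfl | hi
    · rw [Function.update_self, Function.update_of_ne hij.symm]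
      exact hdisj j hij.symm
    · rw [Function.update_of_ne hi]
      rcases eq_or_ne j c with rfl | hj
      · rw [Function.update_self]
        exact (hdisj i hi).symm
      · rw [Function.update_of_ne hj]
        exact h.2 hij

/-- The two sheets of open tube near the contact are disjoint: for different components by
hypothesis, and for a self-contact because `x - y` has positive distance from the discrete group, so
that nearby directions remain inequivalent. -/
theorem Developments.meetsSingularLocus (D : C.Developments R φ Φ)
    (h : C.EmbeddedTubes fun _ => R) {c j : ι} {x y : ℝ × ℝ} (hxy : Φ c R x = Φ j R y)
    (hne : j = c → x - y ∉ tubeGroup (C.coneAngle c) (C.length c) (C.twist c)) :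
    MeetsSingularLocus (Φ c) C.singularLocus R x := by
  rcases eq_or_ne j c with rfl | hj
  · obtain ⟨η, hη, hsep⟩ := exists_forall_norm_sub_ge_of_notMem (C.coneAngle_pos j)
      (C.length_pos j) (hne rfl)
    refine (D j).meetsSingularLocus (D j) hxy (half_pos hη)
      fun r r' v v' h0 h0' hr hr' hv hv' he => ?_
    rw [(D j).eq_of_lt h0.le hr, (D j).eq_of_lt h0'.le hr'] at he
    have h1 := (D j).tube.2.2.1 _ _ hr hr' he
    obtain ⟨-, g, hg, hgv⟩ := exists_dir_eq_of_tubeDist_eq_zero (C.coneAngle_pos j)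
      (C.length_pos j) h0 h1
    have h2 : v = v' + g := hgv
    have h3 := hsep g hg
    rw [show x - y - g = (v' - y) - (v - x) by rw [h2]; abel] at h3
    linarith [norm_sub_le (v' - y) (v - x)]
  · refine (D c).meetsSingularLocus (D j) hxy one_pos fun r r' v v' h0 h0' hr hr' _ _ he => ?_
    have h1 := (D c).mem_thickening h0.le hr v
    rw [he] at h1
    exact disjoint_left.1 (h.2 hj.symm) h1 ((D j).mem_thickening h0'.le hr' v')

/-- The disjoint open tubes would separate the singular locus. -/
theorem subsingleton_of_isConnected (hR : 0 < R) (h : C.EmbeddedTubes fun _ => R)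
    (hc : IsConnected C.singularLocus) : Subsingleton ι := by
  refine ⟨fun i j => ?_⟩
  by_contra hij
  have hne : ∀ k, (C.component k).Nonempty := fun k => by
    obtain ⟨-, φ, hφ⟩ := h.1 k
    exact IsTubeMap.nonempty hφ
  obtain ⟨s, hs⟩ := hne i
  obtain ⟨t, ht⟩ := hne j
  obtain ⟨w, -, hw1, hw2⟩ := hc.isPreconnected (thickening R (C.component i))
    (⋃ k ∈ {k | k ≠ i}, thickening R (C.component k)) isOpen_thickening
    (isOpen_biUnion fun _ _ => isOpen_thickening)
    (fun z hz => by
      obtain ⟨k, hk⟩ := mem_iUnion.1 hz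
      rcases eq_or_ne k i with rfl | hki
      · exact Or.inl (self_subset_thickening hR _ hk)
      · exact Or.inr (mem_biUnion hki (self_subset_thickening hR _ hk)))
    ⟨s, C.component_subset i hs, self_subset_thickening hR _ hs⟩
    ⟨t, C.component_subset j ht, mem_biUnion (x := j) (Ne.symm hij)
      (self_subset_thickening hR _ ht)⟩
  simp only [mem_iUnion] at hw2
  obtain ⟨k, hk, hw2⟩ := hw2
  exact disjoint_left.1 (h.2 (Ne.symm hk)) hw1 hw2

theorem IsMaximalTubeRadius.tubeIsMaximalAt [Subsingleton ι] (hR : C.IsMaximalTubeRadius R)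
    (c : ι) : C.TubeIsMaximalAt R c := fun ρ _ h => by
  refine hR.2 ⟨(h.1 c).1, ?_⟩
  rwa [show (fun _ => ρ c) = ρ from funext fun i => by rw [Subsingleton.elim c i]]

/-- If each tube could be enlarged separately, to radius `ρ i i > R`, then all could be enlarged at
once, to the mean of `R` and the least of these radii, against the maximality of `R`. -/
theorem IsMaximalTubeRadius.exists_tubeIsMaximalAt [Finite ι] (hR : C.IsMaximalTubeRadius R) :
    ∃ c, C.TubeIsMaximalAt R c := by
  have hR0 : 0 < R := hR.1.1
  have hmax : ∀ r, 0 < r → C.EmbeddedTubes (fun _ => r) → r ≤ R := fun r h0 h => hR.2 ⟨h0, h⟩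
  by_contra! hcon
  -- Without components every positive radius is admissible, and there is no greatest one.
  rcases isEmpty_or_nonempty ι with hι | hι
  · have := hmax (R + 1) (by linarith) ⟨fun i => hι.elim i, fun i => hι.elim i⟩
    linarith
  simp only [TubeIsMaximalAt] at hcon
  push Not at hcon
  choose ρ hρ1 hρ2 hρ3 using hcon
  obtain ⟨c, hc⟩ := Finite.exists_min fun i => ρ i i
  have := hmax ((R + ρ c c) / 2) (by linarith [hρ3 c]) ⟨fun i => ?_, fun i j hij => ?_⟩
  · linarith [hρ3 c]
  · obtain ⟨-, φ, hφ⟩ := (hρ2 i).1 i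
    exact ⟨by linarith [hρ3 c], φ,
      IsTubeMap.mono C.isLengthSpace hφ (by linarith [hρ3 c, hc i])⟩
  · change Disjoint _ _
    rw [disjoint_left]
    intro w hw1 hw2
    obtain ⟨s, hs, hs'⟩ := mem_thickening_iff.1 hw1
    obtain ⟨t, ht, ht'⟩ := mem_thickening_iff.1 hw2
    -- A point common to two enlarged tubes makes the cores so close that, in a length space, some
    -- point lies within `ρ i i` of one and within `R` of the other.
    have hlt : dist s t < ρ i i + R := by
      linarith [dist_triangle_left s t w, hc i]
    obtain ⟨z, hz1, hz2⟩ := C.isLengthSpace.exists_between (by linarith [hρ3 i]) hR0 hlt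
    have hd := (hρ2 i).2 hij
    change Disjoint _ _ at hd
    rw [hρ1 i j hij.symm] at hd
    exact disjoint_left.1 hd (mem_thickening_iff.2 ⟨s, hs, by rwa [dist_comm]⟩)
      (mem_thickening_iff.2 ⟨t, ht, hz2⟩)

end HyperbolicConeManifold

/-! ### Covolume bounds for planar lattices -/

section Lattice

open UpperHalfPlane MatrixGroups in
/-- A lattice in the plane has a reduced basis `e`, `w * e`. -/
theorem exists_reduced_basis {a d : ℝ} (ha : 0 < a) (hd : 0 < d) (b : ℝ) :
    ∃ e w : ℂ, Complex.normSq e * w.im = a * d ∧ e ≠ 0 ∧ 0 < w.im ∧ 3 ≤ 4 * w.im ^ 2 ∧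
      ∀ m n : ℤ, ∃ m' n' : ℤ, (m + n * w) * e = ⟨m' * a + n' * b, n' * d⟩ := by
  -- The quotient of the two generators. Moving it to the fundamental domain of `SL(2, ℤ)` gives
  -- `w`, and `e` is `a` times the denominator `D` of the Möbius map; since `im w = im z / |D|²`,
  -- the covolume `|e|² im w = a² im z` is unchanged.
  let z : ℍ := ⟨⟨b / a, d / a⟩, div_pos hd ha⟩
  have hzim : z.im = d / a := rfl
  have hz : (a : ℂ) * z = b + d * Complex.I := by
    apply Complex.ext
    · change (a : ℂ).re * (b / a) - (a : ℂ).im * (d / a) = _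
      simp [mul_div_cancel₀ _ ha.ne']
    · change (a : ℂ).re * (d / a) + (a : ℂ).im * (b / a) = _
      simp [mul_div_cancel₀ _ ha.ne']
  obtain ⟨g, hg⟩ := ModularGroup.exists_smul_mem_fd z
  have hw := UpperHalfPlane.coe_specialLinearGroup_apply g z
  have him : (g • z).im =
      z.im / Complex.normSq (((g 1 0 : ℤ) : ℂ) * z + ((g 1 1 : ℤ) : ℂ)) := by
    simpa [UpperHalfPlane.denom] using ModularGroup.im_smul_eq_div_normSq g z
  simp only [algebraMap_int_eq, eq_intCast, Complex.ofReal_intCast] at hw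
  generalize hDdef : ((g 1 0 : ℤ) : ℂ) * z + ((g 1 1 : ℤ) : ℂ) = D at hw him
  have hpos : 0 < (g • z).im := (g • z).im_pos
  have hD : D ≠ 0 := by
    rintro rfl
    rw [map_zero, div_zero] at him
    exact hpos.ne' him
  have hN : Complex.normSq D ≠ 0 := fun h => hD (Complex.normSq_eq_zero.1 h)
  have hwD : ((g • z : ℍ) : ℂ) * D = ((g 0 0 : ℤ) : ℂ) * z + ((g 0 1 : ℤ) : ℂ) := by
    rw [hw, div_mul_cancel₀ _ hD]
  refine ⟨a * D, (g • z : ℍ), ?_, mul_ne_zero (Complex.ofReal_ne_zero.2 ha.ne') hD, hpos,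
    ModularGroup.three_le_four_mul_im_sq_of_mem_fd hg, fun m n =>
      ⟨m * g 1 1 + n * g 0 1, m * g 1 0 + n * g 0 0, ?_⟩⟩
  · change _ * (g • z).im = _
    rw [him, hzim, map_mul, Complex.normSq_ofReal]
    field_simp
  · rw [show (m + n * ((g • z : ℍ) : ℂ)) * (a * D) = a * (m * D + n * (((g • z : ℍ) : ℂ) * D)) by
      ring, hwD, ← hDdef, show (a : ℂ) * (m * (((g 1 0 : ℤ) : ℂ) * z + ((g 1 1 : ℤ) : ℂ)) +
        n * (((g 0 0 : ℤ) : ℂ) * z + ((g 0 1 : ℤ) : ℂ))) = (m * ((g 1 1 : ℤ) : ℂ) +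
        n * ((g 0 1 : ℤ) : ℂ)) * a + (m * ((g 1 0 : ℤ) : ℂ) + n * ((g 0 0 : ℤ) : ℂ)) * (a * z) by
      ring, hz]
    apply Complex.ext <;> simp

theorem one_le_normSq_of_forall {a b d : ℝ}
    (h : ∀ m n : ℤ, ¬ (m = 0 ∧ n = 0) → 1 ≤ (m * a + n * b) ^ 2 + (n * d) ^ 2) {e : ℂ} (he : e ≠ 0)
    (hmem : ∃ m n : ℤ, e = ⟨m * a + n * b, n * d⟩) : 1 ≤ Complex.normSq e := by
  obtain ⟨m, n, rfl⟩ := hmem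
  rw [Complex.normSq_mk, ← sq, ← sq]
  refine h m n fun hmn => he ?_
  rw [hmn.1, hmn.2]
  apply Complex.ext <;> simp

/-- If all nonzero vectors of a lattice have length at least `1`, its covolume is at least
`√3 / 2`. -/
theorem sqrt_three_div_two_le_of_forall {a d : ℝ} (ha : 0 < a) (hd : 0 < d) (b : ℝ)
    (h : ∀ m n : ℤ, ¬ (m = 0 ∧ n = 0) → 1 ≤ (m * a + n * b) ^ 2 + (n * d) ^ 2) :
    √3 / 2 ≤ a * d := by
  obtain ⟨e, w, hN, he, hq, h3, hmem⟩ := exists_reduced_basis ha hd b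
  have h1 := one_le_normSq_of_forall h he (by simpa using hmem 1 0)
  rw [← hN]
  have h4 : √3 ≤ w.im * 2 := Real.sqrt_le_iff.2 ⟨by positivity, by linarith⟩
  nlinarith

/-- If moreover some point has distance at least `1` from all points of the lattice, the covolume
is at least `√3`. -/
theorem sqrt_three_le_of_forall {a d : ℝ} (ha : 0 < a) (hd : 0 < d) (b : ℝ)
    (h : ∀ m n : ℤ, ¬ (m = 0 ∧ n = 0) → 1 ≤ (m * a + n * b) ^ 2 + (n * d) ^ 2) (s t : ℝ)
    (hst : ∀ m n : ℤ, 1 ≤ (m * a + n * b - s) ^ 2 + (n * d - t) ^ 2) :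
    √3 ≤ a * d := by
  obtain ⟨e, w, hN, he, hq, h3, hmem⟩ := exists_reduced_basis ha hd b
  have h1 := one_le_normSq_of_forall h he (by simpa using hmem 1 0)
  rw [← hN]
  set N := Complex.normSq e
  set q := w.im
  have h4 : √3 ≤ q * 2 := Real.sqrt_le_iff.2 ⟨by positivity, by linarith⟩
  set ξ : ℂ := ⟨s, t⟩ / e with hξ
  have hξe : ξ * e = ⟨s, t⟩ := div_mul_cancel₀ _ he
  -- Rounding to the nearest row and then within the row gives a lattice point at squared distance
  -- at most `(1 + q²) N / 4` from `(s, t)`.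
  set n := round (ξ.im / q)
  set m := round (ξ.re - n * w.re)
  have hn : |ξ.im - n * q| ≤ q / 2 := by
    have h5 := abs_sub_round (ξ.im / q)
    rw [show ξ.im - n * q = (ξ.im / q - n) * q by field_simp, abs_mul, abs_of_pos hq]
    nlinarith
  have hm : |ξ.re - n * w.re - m| ≤ 1 / 2 := abs_sub_round _
  obtain ⟨m', n', he'⟩ := hmem m n
  have h5 : 1 ≤ Complex.normSq ((m + n * w - ξ) * e) := by
    rw [sub_mul, he', hξe]
    have := hst m' n'
    simp only [Complex.normSq_apply, Complex.sub_re, Complex.sub_im]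
    linarith
  have h6 : Complex.normSq (m + n * w - ξ) = (ξ.re - n * w.re - m) ^ 2 + (ξ.im - n * q) ^ 2 := by
    simp [Complex.normSq_apply, q]
    ring
  rw [map_mul, h6] at h5
  have h7 : (ξ.re - n * w.re - m) ^ 2 ≤ 1 / 4 := by
    rw [← sq_abs]; nlinarith [abs_nonneg (ξ.re - n * w.re - m)]
  have h8 : (ξ.im - n * q) ^ 2 ≤ q ^ 2 / 4 := by
    rw [← sq_abs]; nlinarith [abs_nonneg (ξ.im - n * q)]
  have h9 : 4 ≤ (1 + q ^ 2) * N := by nlinarith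
  have hs := Real.sq_sqrt (show (0 : ℝ) ≤ 3 by norm_num)
  have hs0 := Real.sqrt_nonneg 3
  -- For `q ≥ √3` the bound `N ≥ 1` suffices. For `√3 / 2 ≤ q < √3`, `N ≥ 4 / (1 + q²)` does,
  -- because `(√3 - q)(√3 q - 1) ≥ 0`.
  rcases le_or_gt (√3) q with hq3 | hq3
  · nlinarith
  · have h10 : √3 * (1 + q ^ 2) ≤ 4 * q := by
      nlinarith [mul_nonneg (sub_nonneg.2 hq3.le) (show (0 : ℝ) ≤ √3 * q - 1 by nlinarith)]
    have h11 : (1 + q ^ 2) * √3 ≤ (1 + q ^ 2) * (N * q) := by nlinarith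
    exact le_of_mul_le_mul_left h11 (by positivity)

end Lattice

/-! ### The ellipse inscribed in the forbidden region -/

section Ellipse

theorem Real.convexOn_sinh : ConvexOn ℝ (Ici 0) Real.sinh := by
  refine MonotoneOn.convexOn_of_deriv (convex_Ici 0) Real.continuous_sinh.continuousOn
    Real.differentiable_sinh.differentiableOn ?_
  rw [Real.deriv_sinh]
  exact Real.cosh_strictMonoOn.monotoneOn.mono interior_subset

/-- Write `cosh t - 1 = 2 sinh² (t / 2)` and use that the convex function `sinh` lies below its
chord from `0`. The constant comes from `cosh (log 2) - 1 = 1 / 4`, where equality holds. -/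
theorem cosh_sub_one_le {t : ℝ} (ht : |t| ≤ Real.log 2) :
    Real.cosh t - 1 ≤ t ^ 2 / (4 * Real.log 2 ^ 2) := by
  have hL : 0 < Real.log 2 := Real.log_pos one_lt_two
  have hc : Real.cosh (Real.log 2) = 5 / 4 := by
    rw [Real.cosh_log two_pos]; norm_num
  have hdouble : ∀ s : ℝ, Real.cosh s - 1 = 2 * Real.sinh (s / 2) ^ 2 := fun s => by
    have h1 := Real.cosh_two_mul (s / 2)
    have h2 := Real.cosh_sq (s / 2)
    rw [mul_div_cancel₀ _ two_ne_zero] at h1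
    linarith
  have h2 := hdouble (Real.log 2)
  set k := |t| / Real.log 2
  have hk0 : 0 ≤ k := by positivity
  have hk1 : k ≤ 1 := div_le_one_of_le₀ ht hL.le
  have h3 := Real.convexOn_sinh.2 (x := Real.log 2 / 2) (y := 0) (mem_Ici.2 (by positivity))
    (mem_Ici.2 le_rfl) hk0 (sub_nonneg.2 hk1) (by ring)
  simp only [smul_eq_mul, mul_zero, add_zero, Real.sinh_zero] at h3
  rw [show k * (Real.log 2 / 2) = |t| / 2 by simp only [k]; field_simp] at h3
  have h4 : 0 ≤ Real.sinh (|t| / 2) := Real.sinh_nonneg_iff.2 (by positivity)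
  have h5 : Real.sinh (|t| / 2) ^ 2 ≤ k ^ 2 * Real.sinh (Real.log 2 / 2) ^ 2 := by
    rw [← mul_pow]
    exact pow_le_pow_left₀ h4 h3 2
  rw [← Real.cosh_abs, hdouble, show t ^ 2 / (4 * Real.log 2 ^ 2) = k ^ 2 / 4 by
    simp only [k]; rw [div_pow, sq_abs]; field_simp]
  nlinarith

/-- Points outside the disc of hyperbolic radius `2 R` on the surface at distance `2 R` from the
axis lie outside an inscribed ellipse. -/
theorem one_le_ellipse {R : ℝ} (hR : 0 < R) {θ ζ : ℝ}
    (h : |θ| < 1 → Real.cosh (2 * R) - 1 ≤ Real.cosh (2 * R) ^ 2 * (Real.cosh ζ - 1) +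
      Real.sinh (2 * R) ^ 2 * (1 - Real.cos θ)) :
    1 ≤ (θ * Real.cosh R) ^ 2 +
      (ζ * (Real.cosh (2 * R) / (2 * √2 * Real.log 2 * Real.sinh R))) ^ 2 := by
  have hL : 0 < Real.log 2 := Real.log_pos one_lt_two
  have hs : 0 < Real.sinh R := Real.sinh_pos_iff.2 hR
  have hC := Real.one_le_cosh R
  have hc1 := Real.cosh_two_mul R
  have hCs := Real.cosh_sq R
  have hs2 := Real.sinh_two_mul R
  set c := Real.cosh (2 * R)
  have h2 := Real.sq_sqrt (show (0 : ℝ) ≤ 2 by norm_num)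
  have hB : (ζ * (c / (2 * √2 * Real.log 2 * Real.sinh R))) ^ 2 =
      c ^ 2 * ζ ^ 2 / (8 * Real.sinh R ^ 2 * Real.log 2 ^ 2) := by
    rw [mul_pow, div_pow, mul_pow, mul_pow, mul_pow, h2]
    ring
  rw [hB]
  -- Large angles are outside the ellipse because `cosh R ≥ 1`, so the geometric estimate is needed
  -- only for angles below `1`.
  rcases le_or_gt 1 |θ| with hθ | hθ
  · have h3 : 1 ≤ θ ^ 2 := by rw [← sq_abs]; nlinarith
    have h4 : 1 ≤ (θ * Real.cosh R) ^ 2 := by rw [mul_pow]; nlinarith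
    have : 0 ≤ c ^ 2 * ζ ^ 2 / (8 * Real.sinh R ^ 2 * Real.log 2 ^ 2) := by positivity
    linarith
  rcases lt_or_ge (Real.log 2) |ζ| with hζ | hζ
  · have h3 : Real.log 2 ^ 2 ≤ ζ ^ 2 := by
      rw [← sq_abs ζ]; exact pow_le_pow_left₀ hL.le hζ.le 2
    -- By the arithmetic-geometric mean inequality for `c = 1 + 2 sinh² R`: the semi-axis in the
    -- `ζ`-direction never exceeds `log 2`.
    have h4 : 8 * Real.sinh R ^ 2 ≤ c ^ 2 := by
      rw [hc1, hCs]; nlinarith [sq_nonneg (2 * Real.sinh R ^ 2 - 1)]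
    have h5 : 1 ≤ c ^ 2 * ζ ^ 2 / (8 * Real.sinh R ^ 2 * Real.log 2 ^ 2) := by
      rw [one_le_div (by positivity)]
      exact mul_le_mul h4 h3 (by positivity) (by positivity)
    nlinarith [sq_nonneg (θ * Real.cosh R)]
  · have h3 := h hθ
    have h4 := cosh_sub_one_le hζ
    have h5 := Real.one_sub_sq_div_two_le_cos (x := θ)
    rw [hs2] at h3
    have h6 : c ^ 2 * (Real.cosh ζ - 1) ≤ c ^ 2 * (ζ ^ 2 / (4 * Real.log 2 ^ 2)) := by gcongr
    have h7 : (2 * Real.sinh R * Real.cosh R) ^ 2 * (1 - Real.cos θ) ≤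
        (2 * Real.sinh R * Real.cosh R) ^ 2 * (θ ^ 2 / 2) :=
      mul_le_mul_of_nonneg_left (by linarith) (by positivity)
    -- Dividing the hypothesis by `cosh 2R - 1 = 2 sinh² R`, after the quadratic bounds for `cosh`
    -- and `cos`, leaves the equation of the ellipse.
    have h8 : c ^ 2 * (ζ ^ 2 / (4 * Real.log 2 ^ 2)) =
        2 * Real.sinh R ^ 2 * (c ^ 2 * ζ ^ 2 / (8 * Real.sinh R ^ 2 * Real.log 2 ^ 2)) := by
      field_simp; ring
    have h9 : 2 * Real.sinh R ^ 2 * 1 ≤ 2 * Real.sinh R ^ 2 * ((θ * Real.cosh R) ^ 2 +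
        c ^ 2 * ζ ^ 2 / (8 * Real.sinh R ^ 2 * Real.log 2 ^ 2)) := by
      rw [mul_add, ← h8]
      nlinarith
    exact le_of_mul_le_mul_left h9 (by positivity)

end Ellipse

/-! ### Area of the boundary torus as a determinant -/

theorem covolume_map_tubeGroup {α ℓ : ℝ} (hα : 0 < α) (hℓ : 0 < ℓ) (τ : ℝ) {R : ℝ} (hR : 0 < R) :
    ZLattice.covolume ((tubeGroup α ℓ τ).map (cylinderCoords R)) =
      α * ℓ * (Real.sinh R * Real.cosh R) := by
  have hs : 0 < Real.sinh R := Real.sinh_pos_iff.2 hR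
  have hc := Real.cosh_pos R
  let v : Fin 2 → EuclideanSpace ℝ (Fin 2) := ![cylinderCoords R (α, 0), cylinderCoords R (τ, ℓ)]
  have hli : LinearIndependent ℝ v := by
    refine LinearIndependent.pair_iff.2 fun s t hst => ?_
    have h0 := congrArg (fun x : EuclideanSpace ℝ (Fin 2) => x 0) hst
    have h1 := congrArg (fun x : EuclideanSpace ℝ (Fin 2) => x 1) hst
    simp [cylinderCoords, hℓ.ne', hc.ne'] at h0 h1
    subst h1
    simpa [hα.ne', hs.ne'] using h0
  let b := basisOfLinearIndependentOfCardEqFinrank hli (by simp)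
  have hb : ⇑b = v := coe_basisOfLinearIndependentOfCardEqFinrank _ _
  have hL : (tubeGroup α ℓ τ).map (cylinderCoords R) = Submodule.span ℤ (range b) := by
    rw [tubeGroup, Submodule.map_span, image_pair, hb]
    simp [v, Matrix.range_cons, Matrix.range_empty, pair_comm]
  let e := EuclideanSpace.basisFun (Fin 2) ℝ
  rw [hL, ZLattice.covolume_eq_measure_fundamentalDomain _ _ (ZSpan.isAddFundamentalDomain b _),
    ZSpan.measureReal_fundamentalDomain b _ e.toBasis, MeasureTheory.measureReal_def,
    MeasureTheory.measure_congr (ZSpan.fundamentalDomain_ae_parallelepiped _ _),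
    OrthonormalBasis.coe_toBasis, OrthonormalBasis.volume_parallelepiped, ENNReal.toReal_one,
    mul_one, hb, Module.Basis.det_apply, Matrix.det_fin_two]
  simp only [Module.Basis.toMatrix_apply, OrthonormalBasis.coe_toBasis_repr_apply, e,
    EuclideanSpace.basisFun_repr, v, cylinderCoords]
  simp
  rw [abs_of_pos hα, abs_of_pos hℓ, abs_of_pos hs, abs_of_pos hc]
  ring

/-! ### From contacts to the final bounds -/

namespace HyperbolicConeManifold

variable {M : Type*} [MetricSpace M] {ι : Type*} {C : HyperbolicConeManifold M ι} {R : ℝ}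
  {φ : ι → BranchedPoint → M} {Φ : ι → ℝ → ℝ × ℝ → M}

/-- Two directions meeting the singular locus differ by a vector outside an ellipse. -/
theorem Developments.one_le_ellipse (D : C.Developments R φ Φ) {c : ι} {x y : ℝ × ℝ}
    (hx : MeetsSingularLocus (Φ c) C.singularLocus R x)
    (hy : MeetsSingularLocus (Φ c) C.singularLocus R y) (hxy : x ≠ y) :
    1 ≤ ((x.1 - y.1) * Real.cosh R) ^ 2 + ((x.2 - y.2) *
      (Real.cosh (2 * R) / (2 * √2 * Real.log 2 * Real.sinh R))) ^ 2 := by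
  have hR := (D c).radius_pos
  refine _root_.one_le_ellipse hR fun hθ => ?_
  have h1 := (D c).two_mul_le_dist D.hasTubeCharts hxy hθ hx hy
  have h2 := Real.cosh_le_cosh.2 (abs_le_abs_of_nonneg (by positivity) h1)
  rw [cosh_dist_cyl, sub_self, Real.cosh_zero] at h2
  linarith

/-- Undoes the rescaling that turns the ellipse into the unit disc. -/
theorem sqrt_mul_tanh_div_le {α ℓ k : ℝ} (hR : 0 < R) (h : k ≤ α * Real.cosh R *
    (ℓ * (Real.cosh (2 * R) / (2 * √2 * Real.log 2 * Real.sinh R)))) :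
    2 * √2 * Real.log 2 * k * (Real.tanh R / Real.cosh (2 * R)) ≤ α * ℓ := by
  have hL : 0 < Real.log 2 := Real.log_pos one_lt_two
  have hs : 0 < Real.sinh R := Real.sinh_pos_iff.2 hR
  have hc := Real.cosh_pos R
  have hc2 := Real.cosh_pos (2 * R)
  have h2 : 0 < √2 := Real.sqrt_pos.2 two_pos
  rw [Real.tanh_eq_sinh_div_cosh]
  have h3 : 0 < 2 * √2 * Real.log 2 * (Real.sinh R / Real.cosh R / Real.cosh (2 * R)) := by
    positivity
  calc _ = 2 * √2 * Real.log 2 * (Real.sinh R / Real.cosh R / Real.cosh (2 * R)) * k := by ring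
    _ ≤ _ := mul_le_mul_of_nonneg_left h h3.le
    _ = α * ℓ := by field_simp

/-- The right-hand side is `3.39571…`, so the decimal bounds must be taken to about six places. -/
theorem tubeConstant_le : 3.3957 ≤ 2 * √2 * Real.log 2 * √3 := by
  have h1 := Real.log_two_gt_d9
  have h2 : (1.414213 : ℝ) ≤ √2 := Real.le_sqrt_of_sq_le (by norm_num)
  have h3 : (1.732050 : ℝ) ≤ √3 := Real.le_sqrt_of_sq_le (by norm_num)
  calc (3.3957 : ℝ) ≤ 2 * 1.414213 * 0.6931471803 * 1.732050 := by norm_num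
    _ ≤ _ := by gcongr

theorem torusArea_eq (C : HyperbolicConeManifold M ι) (c : ι) (hR : 0 < R) :
    C.torusArea c R = C.coneAngle c * C.length c * (Real.sinh R * Real.cosh R) :=
  covolume_map_tubeGroup (C.coneAngle_pos c) (C.length_pos c) _ hR

/-- The bound for the area follows from the one for the product of angle and length. -/
theorem le_torusArea_and_le {c : ι} (hR : 0 < R) {k : ℝ}
    (h : k * (Real.tanh R / Real.cosh (2 * R)) ≤ C.coneAngle c * C.length c) :
    k * (Real.sinh R ^ 2 / Real.cosh (2 * R)) ≤ C.torusArea c R := by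
  have hs : 0 < Real.sinh R := Real.sinh_pos_iff.2 hR
  have hc := Real.cosh_pos R
  rw [C.torusArea_eq c hR]
  refine le_trans (le_of_eq ?_) (mul_le_mul_of_nonneg_right h (mul_pos hs hc).le)
  rw [Real.tanh_eq_sinh_div_cosh]
  field_simp

/-- The vectors of the tube group lie outside the ellipse. -/
theorem Developments.one_le_of_int (D : C.Developments R φ Φ) {c : ι} {x y : ℝ × ℝ}
    (hx : MeetsSingularLocus (Φ c) C.singularLocus R x)
    (hy : MeetsSingularLocus (Φ c) C.singularLocus R y) (m n : ℤ)
    (hmn : y ≠ x + (m * C.coneAngle c + n * C.twist c, n * C.length c)) :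
    1 ≤ (m * (C.coneAngle c * Real.cosh R) + n * (C.twist c * Real.cosh R) -
        (y.1 - x.1) * Real.cosh R) ^ 2 +
      (n * (C.length c * (Real.cosh (2 * R) / (2 * √2 * Real.log 2 * Real.sinh R))) -
        (y.2 - x.2) * (Real.cosh (2 * R) / (2 * √2 * Real.log 2 * Real.sinh R))) ^ 2 := by
  have hg : ((m * C.coneAngle c + n * C.twist c, n * C.length c) : ℝ × ℝ) ∈
      tubeGroup (C.coneAngle c) (C.length c) (C.twist c) := mem_tubeGroup_iff.2 ⟨m, n, rfl⟩
  refine (D.one_le_ellipse (hx.translate (D c) hg) hy hmn.symm).trans (le_of_eq ?_)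
  simp only [Prod.fst_add, Prod.snd_add]
  ring

/-- The orbit of `x` alone gives a lattice of minimal length at least `1`, hence half of the bound.
With a single component the contact is a self-contact, and the orbit of `y` doubles the covolume. -/
theorem tubeFunction_bounds [CompleteSpace M] [Finite ι] (h : C.EmbeddedTubes fun _ => R)
    {c : ι} (hc : C.TubeIsMaximalAt R c) :
    3.3957 / 2 * (Real.tanh R / Real.cosh (2 * R)) ≤ C.coneAngle c * C.length c ∧
      (Subsingleton ι → 3.3957 * (Real.tanh R / Real.cosh (2 * R)) ≤
        C.coneAngle c * C.length c) := by
  have hR : 0 < R := (h.1 c).1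
  obtain ⟨φ, Φ, D⟩ := h.exists_developments
  obtain ⟨j, x, y, hxy, hne⟩ := D.exists_contact h hc
  have hx := D.meetsSingularLocus h hxy hne
  have hα := C.coneAngle_pos c
  have hℓ := C.length_pos c
  have hL : 0 < Real.log 2 := Real.log_pos one_lt_two
  have hs : 0 < Real.sinh R := Real.sinh_pos_iff.2 hR
  have hch := Real.cosh_pos R
  have hc2 := Real.cosh_pos (2 * R)
  have h2 : 0 < √2 := Real.sqrt_pos.2 two_pos
  have hpos : 0 ≤ Real.tanh R / Real.cosh (2 * R) := by
    rw [Real.tanh_eq_sinh_div_cosh]; positivity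
  have hlat : ∀ m n : ℤ, ¬ (m = 0 ∧ n = 0) →
      1 ≤ (m * (C.coneAngle c * Real.cosh R) + n * (C.twist c * Real.cosh R)) ^ 2 +
        (n * (C.length c * (Real.cosh (2 * R) / (2 * √2 * Real.log 2 * Real.sinh R)))) ^ 2 := by
    intro m n hmn
    have h1 := D.one_le_of_int hx hx m n fun he => hmn ?_
    · simpa using h1
    · rw [left_eq_add, Prod.mk_eq_zero] at he
      have hn : n = 0 := by simpa [hℓ.ne'] using he.2
      subst hn
      exact ⟨by simpa [hα.ne'] using he.1, rfl⟩
  have ha : 0 < C.coneAngle c * Real.cosh R := by positivity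
  have hd : 0 < C.length c * (Real.cosh (2 * R) / (2 * √2 * Real.log 2 * Real.sinh R)) := by
    positivity
  refine ⟨(mul_le_mul_of_nonneg_right ?_ hpos).trans (sqrt_mul_tanh_div_le hR
    (sqrt_three_div_two_le_of_forall ha hd _ hlat)), fun hι => ?_⟩
  · linarith [tubeConstant_le]
  obtain rfl : j = c := Subsingleton.elim _ _
  -- The contact is symmetric in its two directions, so the ray in the direction `y` meets the
  -- singular locus as well.
  have hy := D.meetsSingularLocus h hxy.symm fun _ hg => hne rfl (by
    rw [← neg_sub]; exact neg_mem hg)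
  exact (mul_le_mul_of_nonneg_right tubeConstant_le hpos).trans (sqrt_mul_tanh_div_le hR
    (sqrt_three_le_of_forall ha hd _ hlat _ _ fun m n => D.one_le_of_int hx hy m n fun he =>
      hne rfl (by
        rw [he, sub_add_cancel_left]
        exact neg_mem (mem_tubeGroup_iff.2 ⟨m, n, rfl⟩))))

end HyperbolicConeManifold

theorem mainTheorem7 {M : Type*} [MetricSpace M] [CompleteSpace M] {ι : Type*} [Finite ι]
    (C : HyperbolicConeManifold M ι) (R : ℝ) (hR : C.IsMaximalTubeRadius R) :
    (IsConnected C.singularLocus → ∀ c : ι,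
      3.3957 * (Real.sinh R ^ 2 / Real.cosh (2 * R)) ≤ C.torusArea c R ∧
      tubeFunction R ≤ C.coneAngle c * C.length c) ∧
    (∀ c : ι, C.TubeIsMaximalAt R c →
      3.3957 / 2 * (Real.sinh R ^ 2 / Real.cosh (2 * R)) ≤ C.torusArea c R ∧
      tubeFunction R / 2 ≤ C.coneAngle c * C.length c) ∧
    ∃ c : ι, C.TubeIsMaximalAt R c := by
  have hR0 : 0 < R := hR.1.1
  have hE : C.EmbeddedTubes fun _ => R := hR.1.2
  refine ⟨fun hconn c => ?_, fun c hc => ?_, hR.exists_tubeIsMaximalAt⟩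
  · have := HyperbolicConeManifold.subsingleton_of_isConnected hR0 hE hconn
    have h := (HyperbolicConeManifold.tubeFunction_bounds hE (hR.tubeIsMaximalAt c)).2 this
    exact ⟨HyperbolicConeManifold.le_torusArea_and_le hR0 h, h⟩
  · have h := (HyperbolicConeManifold.tubeFunction_bounds hE hc).1
    refine ⟨HyperbolicConeManifold.le_torusArea_and_le hR0 h, ?_⟩
    rw [tubeFunction, mul_div_right_comm]
    exact h
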